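/- Let $\pi:\mathcal E\to\mathcal M$ be a smooth fibre bundle with $N$-dimensional fibres over a smooth manifold $\mathcal M$ of dimension $n\ge 1$, let $V\mathcal E=\ker T\pi$, and let $$\mathcal P=(V\mathcal E)^*\otimes T\mathcal M\otimes\Lambda^nT^*\mathcal M$$ (a vector bundle over $\mathcal E$, with projection $\mathrm{pr}:\mathcal P\to\mathcal E$) be the polysymplectic phase space, with coordinates $(x^\mu,v^A,p^\mu_A)$ induced by fibred coordinates $(x^\mu,v^A)$ of $\mathcal E$. Let $\Gamma$ be a connection on $\mathcal E$ with vertical projection $P_\Gamma:T\mathcal E\to V\mathcal E$, and let $\bar\Gamma$ be any connection on $\mathcal P\to\mathcal M$ that projects onto $\Gamma$. Let $\Theta_\Gamma$ be the $n$-form on $\mathcal P$ with $$(\Theta_\Gamma)_{\alpha\otimes\omega}(w_1,\dots,w_n)=\frac1{n!}\sum_{\sigma}\operatorname{sgn}(\sigma)\,\omega\bigl(\alpha(P_\Gamma T\mathrm{pr}\,w_{\sigma(1)}),T(\pi\circ \mathrm{pr})w_{\sigma(2)},\dots,T(\pi\circ \mathrm{pr})w_{\sigma(n)}\bigr),$$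 let $d_{\bar\Gamma}$ be the $\bar\Gamma$-vertical differential on $\mathcal P$, i.e. the graded derivation of degree $1$ with $d_{\bar\Gamma}f=df\circ P_{\bar\Gamma}$ on functions, $d_{\bar\Gamma}^2=0$, and $d_{\bar\Gamma}=0$ on forms pulled back from $\mathcal M$, and put $\Omega_\Gamma=-d_{\bar\Gamma}\Theta_\Gamma$. Write $Z\lrcorner\beta=\beta(Z,\cdot,\dots,\cdot)$. For a smooth $\pi$-vertical vector field $X=X^A\partial_A$ on $\mathcal E$ let $\hat X$ be its canonical lift to $\mathcal P$, in coordinates $\hat X=X^A\partial_A-p^\nu_B\,\partial_AX^B\,\frac{\partial}{\partial p^\nu_A}$, and let $I(X)=\hat X\lrcorner\Theta_\Gamma$. A smooth horizontal $(n-1)$-form $F$ on $\mathcal P$ is called Hamiltonian if $d_{\bar\Gamma}F=X_F\lrcorner\Omega_\Gamma$ for some smooth vector field $X_F$ on $\mathcal P$, called a Hamiltonian vector field of $F$; the bracket of two such forms is $\{F,G\}=X_F\lrcorner(X_G\lrcorner\Omega_\Gamma)$. Then: 1. $\hat X$ is smooth, and it is the infinitesimal generator of the induced action on $\mathcal P$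 of every smooth one-parameter family of local fibre-preserving maps $\varphi_t$ of $\mathcal E$ over $\mathrm{id}_{\mathcal M}$ with $\varphi_0=\mathrm{id}$ and $\frac{d}{dt}\big|_{t=0}\varphi_t=X$ (in particular of the local flow of $X$). 2. $X\mapsto\hat X$ and $X\mapsto I(X)$ are $\mathbb R$-linear, and for vertical $X,Y$ the field $[X,Y]$ is vertical and $\widehat{[X,Y]}=[\hat X,\hat Y]$; so lifting is a homomorphism of Lie algebras. 3. For each vertical $X$, the form $I(X)$ is Hamiltonian with Hamiltonian vector field $\hat X$. 4. For vertical $X,Y$, $\ \hat X\lrcorner(\hat Y\lrcorner\Omega_\Gamma)=[\hat X,\hat Y]\lrcorner\Theta_\Gamma$. 5. Hence $\{I(X),I(Y)\}=I([X,Y])$, so that $I$ is a momentum map for the vertical symmetries of $\mathcal E$. (With the opposite sign convention $\{F,G\}=(-1)^{n-|F|}X_F\lrcorner(X_G\lrcorner\Omega_\Gamma)=-X_F\lrcorner(X_G\lrcorner\Omega_\Gamma)$, where $|F|=n-1$ is the degree of $F$, the identity reads $\{I(X),I(Y)\}=-I([X,Y])$.) -/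

import Mathlib

open scoped Manifold ContDiff TensorProduct Topology

noncomputable section

namespace Polysymplectic

universe u v

/-- Model space of the base manifold, whose dimension is `n + 1 ≥ 1`. -/
abbrev BaseModel (n : ℕ) : Type := EuclideanSpace ℝ (Fin (n + 1))

/-- Model space of the `N`-dimensional fibres. -/
abbrev FibreModel (N : ℕ) : Type := EuclideanSpace ℝ (Fin N)

/-- Model space of the total space of the bundle: coordinates `(x^μ, v^A)`. -/
abbrev TotModel (n N : ℕ) : Type := BaseModel n × FibreModel N

/-- Model space of the polysymplectic phase space: coordinates `((x^μ, v^A), p^μ_A)`,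
the momentum `p^μ_A` being the entry `q A μ`. -/
abbrev PhaseModel (n N : ℕ) : Type := TotModel n N × (Fin N → Fin (n + 1) → ℝ)

section Bundle

variable (n N : ℕ)
variable {M : Type v} [TopologicalSpace M] [ChartedSpace (BaseModel n) M]
variable {E : Type u} [TopologicalSpace E] [ChartedSpace (TotModel n N) E]

/-- `π : E → M` is a smooth (locally trivial) fibre bundle with `N`-dimensional typical fibre. -/
class SmoothFibreBundle (π : E → M) : Prop where
  contMDiff : ContMDiff 𝓘(ℝ, TotModel n N) 𝓘(ℝ, BaseModel n) ∞ π
  exists_typicalFibre : ∃ (F : Type u) (_ : TopologicalSpace F)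
    (_ : ChartedSpace (FibreModel N) F) (_ : IsManifold 𝓘(ℝ, FibreModel N) ∞ F),
    ∀ m : M, ∃ e : Bundle.Trivialization F π, m ∈ e.baseSet ∧
      ContMDiffOn 𝓘(ℝ, TotModel n N) (𝓘(ℝ, BaseModel n).prod 𝓘(ℝ, FibreModel N)) ∞
        e.toOpenPartialHomeomorph e.source ∧
      ContMDiffOn (𝓘(ℝ, BaseModel n).prod 𝓘(ℝ, FibreModel N)) 𝓘(ℝ, TotModel n N) ∞
        e.toOpenPartialHomeomorph.symm e.target

/-- The vertical tangent space `V_e E = ker T_e π`. -/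
abbrev Vert (π : E → M) (e : E) : Submodule ℝ (TangentSpace 𝓘(ℝ, TotModel n N) e) :=
  LinearMap.ker (mfderiv 𝓘(ℝ, TotModel n N) 𝓘(ℝ, BaseModel n) π e).toLinearMap

/-- The line `Λⁿ⁺¹ T*_m M` of top degree forms at a point of the base. -/
abbrev TopForms (m : M) : Type :=
  TangentSpace 𝓘(ℝ, BaseModel n) m [⋀^Fin (n + 1)]→ₗ[ℝ] ℝ

/-- The fibre `(V_e E)* ⊗ T_{π e} M ⊗ Λⁿ⁺¹ T*_{π e} M` of the polysymplectic phase space. -/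
abbrev PhaseFibre (π : E → M) (e : E) : Type :=
  (Module.Dual ℝ (Vert n N π e) ⊗[ℝ] TangentSpace 𝓘(ℝ, BaseModel n) (π e)) ⊗[ℝ]
    TopForms n (π e)

/-- The polysymplectic phase space `P = (VE)* ⊗ TM ⊗ Λⁿ⁺¹ T*M`, a vector bundle over `E`. -/
structure Phase (π : E → M) where
  pt : E
  mom : PhaseFibre n N π pt

/-- A system `(x^μ, v^A)` of fibred coordinates: a chart of `E` and a chart of `M`. -/
structure FibredChart (π : E → M) where
  tot : OpenPartialHomeomorph E (TotModel n N)
  base : OpenPartialHomeomorph M (BaseModel n)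
  tot_mem : tot ∈ IsManifold.maximalAtlas 𝓘(ℝ, TotModel n N) ∞ E
  base_mem : base ∈ IsManifold.maximalAtlas 𝓘(ℝ, BaseModel n) ∞ M
  mapsTo : ∀ e ∈ tot.source, π e ∈ base.source
  fst_tot : ∀ e ∈ tot.source, (tot e).1 = base (π e)

theorem exists_fibredChart [IsManifold 𝓘(ℝ, BaseModel n) ∞ M]
    [IsManifold 𝓘(ℝ, TotModel n N) ∞ E] (π : E → M) [h : SmoothFibreBundle n N π] (e : E) :
    ∃ c : FibredChart n N π, e ∈ c.tot.source := by
  obtain ⟨F, _, _, _, hF⟩ := h.exists_typicalFibre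
  obtain ⟨t, hm, ht, ht'⟩ := hF (π e)
  have he : e ∈ t.source := by rw [t.source_eq]; exact hm
  let b := chartAt (BaseModel n) (t e).1
  let f := chartAt (FibreModel N) (t e).2
  have hb : b ∈ IsManifold.maximalAtlas 𝓘(ℝ, BaseModel n) ∞ M :=
    IsManifold.chart_mem_maximalAtlas _
  have hf : f ∈ IsManifold.maximalAtlas 𝓘(ℝ, FibreModel N) ∞ F :=
    IsManifold.chart_mem_maximalAtlas _
  have hbf := IsManifold.mem_maximalAtlas_prod hb hf
  let φ : OpenPartialHomeomorph E (TotModel n N) := t.toOpenPartialHomeomorph.trans (b.prod f)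
  have h1 : ContMDiffOn 𝓘(ℝ, TotModel n N) 𝓘(ℝ, TotModel n N) ∞ φ φ.source := by
    have := contMDiffOn_of_mem_maximalAtlas hbf
    rw [← modelWithCornersSelf_prod] at this ht
    have h3 := this.comp' ht
    exact h3
  have h2 : ContMDiffOn 𝓘(ℝ, TotModel n N) 𝓘(ℝ, TotModel n N) ∞ φ.symm φ.target := by
    have := contMDiffOn_symm_of_mem_maximalAtlas hbf
    rw [← modelWithCornersSelf_prod] at this ht'
    have h3 := ht'.comp' this
    exact h3
  refine ⟨⟨φ, b, φ.mem_maximalAtlas_of_contMDiffOn h1 h2, hb, ?_, ?_⟩, ?_⟩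
  · intro x hx
    have : (t x).1 = π x := t.proj_toFun x hx.1
    rw [← this]
    exact hx.2.1
  · intro x hx
    have : (t x).1 = π x := t.proj_toFun x hx.1
    rw [← this]
    rfl
  · exact ⟨he, mem_chart_source _ _, mem_chart_source _ _⟩

namespace FibredChart

variable {n N} {π : E → M} (c : FibredChart n N π)

/-- The coordinate vector `∂_A` of `V_e E`, for `e` in the chart domain. -/
def vertFrame (e : E) (A : Fin N) : Vert n N π e :=
  open Classical in
  let w : TangentSpace 𝓘(ℝ, TotModel n N) e :=
    mfderiv 𝓘(ℝ, TotModel n N) 𝓘(ℝ, TotModel n N) c.tot.symm (c.tot e)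
      (((0, EuclideanSpace.single A 1) : TotModel n N))
  if h : w ∈ Vert n N π e then ⟨w, h⟩ else 0

/-- The coordinate form `dv^A`, restricted to `V_e E`. -/
def vertCoframe (e : E) (A : Fin N) : Module.Dual ℝ (Vert n N π e) where
  toFun w := ((mfderiv 𝓘(ℝ, TotModel n N) 𝓘(ℝ, TotModel n N) c.tot e w : TotModel n N)).2 A
  map_add' _ _ := by simp only [Submodule.coe_add, map_add]; rfl
  map_smul' _ _ := by simp only [Submodule.coe_smul, map_smul]; rfl

/-- The coordinate vector `∂_μ` of `T_m M`, for `m` in the chart domain. -/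
def baseFrame (m : M) (μ : Fin (n + 1)) : TangentSpace 𝓘(ℝ, BaseModel n) m :=
  mfderiv 𝓘(ℝ, BaseModel n) 𝓘(ℝ, BaseModel n) c.base.symm (c.base m)
    ((EuclideanSpace.single μ 1 : BaseModel n))

/-- The coordinate form `dx^μ` at `m`. -/
def baseCoframe (m : M) (μ : Fin (n + 1)) : Module.Dual ℝ (TangentSpace 𝓘(ℝ, BaseModel n) m) where
  toFun w :=
    let y : BaseModel n := mfderiv 𝓘(ℝ, BaseModel n) 𝓘(ℝ, BaseModel n) c.base m w
    y μ
  map_add' _ _ := by simp only [map_add]; rfl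
  map_smul' _ _ := by simp only [map_smul]; rfl

/-- The coordinate volume form `dⁿ⁺¹x = dx^0 ∧ ⋯ ∧ dx^n` at `m`, with value `1` on
`(∂_0, …, ∂_n)`. -/
def baseVol (m : M) : TopForms n m :=
  (Matrix.detRowAlternating (R := ℝ) (n := Fin (n + 1))).compLinearMap
    (LinearMap.pi (c.baseCoframe m))

/-- The momentum coordinate `p^μ_A`: on `λ ⊗ Z ⊗ ω` it is
`λ(∂_A) · dx^μ(Z) · ω(∂_0, …, ∂_n)`. -/
def momentum (e : E) (A : Fin N) (μ : Fin (n + 1)) : PhaseFibre n N π e →ₗ[ℝ] ℝ :=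
  LinearMap.mul' ℝ ℝ ∘ₗ TensorProduct.map
    (LinearMap.mul' ℝ ℝ ∘ₗ TensorProduct.map
      (Module.Dual.eval ℝ _ (c.vertFrame e A)) (c.baseCoframe (π e) μ))
    { toFun := fun η => η (c.baseFrame (π e))
      map_add' := fun _ _ => rfl
      map_smul' := fun _ _ => rfl }

/-- The element `∑ q^μ_A dv^A ⊗ ∂_μ ⊗ dⁿ⁺¹x` of the fibre over `e`. -/
def ofMomentum (e : E) (q : Fin N → Fin (n + 1) → ℝ) : PhaseFibre n N π e :=
  ∑ A, ∑ μ, q A μ • ((c.vertCoframe e A ⊗ₜ[ℝ] c.baseFrame (π e) μ) ⊗ₜ[ℝ] c.baseVol (π e))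

section Facts

theorem mdiff_tot : c.tot.MDifferentiable 𝓘(ℝ, TotModel n N) 𝓘(ℝ, TotModel n N) :=
  ⟨(contMDiffOn_of_mem_maximalAtlas c.tot_mem).mdifferentiableOn (by simp),
    (contMDiffOn_symm_of_mem_maximalAtlas c.tot_mem).mdifferentiableOn (by simp)⟩

theorem mdiff_base : c.base.MDifferentiable 𝓘(ℝ, BaseModel n) 𝓘(ℝ, BaseModel n) :=
  ⟨(contMDiffOn_of_mem_maximalAtlas c.base_mem).mdifferentiableOn (by simp),
    (contMDiffOn_symm_of_mem_maximalAtlas c.base_mem).mdifferentiableOn (by simp)⟩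

theorem fst_mfderiv_tot [h : SmoothFibreBundle n N π] {e : E} (he : e ∈ c.tot.source)
    (w : TangentSpace 𝓘(ℝ, TotModel n N) e) :
    ((mfderiv 𝓘(ℝ, TotModel n N) 𝓘(ℝ, TotModel n N) c.tot e w : TotModel n N)).1 =
      mfderiv 𝓘(ℝ, BaseModel n) 𝓘(ℝ, BaseModel n) c.base (π e)
        (mfderiv 𝓘(ℝ, TotModel n N) 𝓘(ℝ, BaseModel n) π e w) := by
  have h1 := (c.mdiff_tot.mdifferentiableAt he).hasMFDerivAt
  have h2 : HasMFDerivAt 𝓘(ℝ, TotModel n N) 𝓘(ℝ, BaseModel n)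
      (Prod.fst : TotModel n N → BaseModel n) (c.tot e)
      (ContinuousLinearMap.fst ℝ (BaseModel n) (FibreModel N)) :=
    (ContinuousLinearMap.fst ℝ (BaseModel n) (FibreModel N)).hasFDerivAt.hasMFDerivAt
  have h3 := h2.comp e h1
  have h4 := (h.contMDiff.mdifferentiable (by simp) e).hasMFDerivAt
  have h5 := (c.mdiff_base.mdifferentiableAt (c.mapsTo e he)).hasMFDerivAt.comp e h4
  have h6 : (Prod.fst ∘ c.tot : E → BaseModel n) =ᶠ[𝓝 e] c.base ∘ π := by
    filter_upwards [c.tot.open_source.mem_nhds he] with x hx using c.fst_tot x hx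
  have h7 := hasMFDerivAt_unique h3 (h5.congr_of_eventuallyEq h6)
  exact congrArg (fun L => L w) h7

theorem tot_symm_mfderiv {e : E} (he : e ∈ c.tot.source) (w : TotModel n N) :
    mfderiv 𝓘(ℝ, TotModel n N) 𝓘(ℝ, TotModel n N) c.tot e
      (mfderiv 𝓘(ℝ, TotModel n N) 𝓘(ℝ, TotModel n N) c.tot.symm (c.tot e) w) = w := by
  have := c.mdiff_tot.comp_symm_deriv (c.tot.map_source he)
  rw [c.tot.left_inv he] at this
  exact congrArg (fun L => L w) this

theorem base_symm_mfderiv {m : M} (hm : m ∈ c.base.source) (w : BaseModel n) :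
    mfderiv 𝓘(ℝ, BaseModel n) 𝓘(ℝ, BaseModel n) c.base m
      (mfderiv 𝓘(ℝ, BaseModel n) 𝓘(ℝ, BaseModel n) c.base.symm (c.base m) w) = w := by
  have := c.mdiff_base.comp_symm_deriv (c.base.map_source hm)
  rw [c.base.left_inv hm] at this
  exact congrArg (fun L => L w) this

theorem symm_tot_mfderiv {e : E} (he : e ∈ c.tot.source)
    (w : TangentSpace 𝓘(ℝ, TotModel n N) e) :
    mfderiv 𝓘(ℝ, TotModel n N) 𝓘(ℝ, TotModel n N) c.tot.symm (c.tot e)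
      (mfderiv 𝓘(ℝ, TotModel n N) 𝓘(ℝ, TotModel n N) c.tot e w) = w :=
  congrArg (fun L => L w) (c.mdiff_tot.symm_comp_deriv he)

theorem symm_base_mfderiv {m : M} (hm : m ∈ c.base.source)
    (w : TangentSpace 𝓘(ℝ, BaseModel n) m) :
    mfderiv 𝓘(ℝ, BaseModel n) 𝓘(ℝ, BaseModel n) c.base.symm (c.base m)
      (mfderiv 𝓘(ℝ, BaseModel n) 𝓘(ℝ, BaseModel n) c.base m w) = w :=
  congrArg (fun L => L w) (c.mdiff_base.symm_comp_deriv hm)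

theorem coe_vertFrame [SmoothFibreBundle n N π] {e : E} (he : e ∈ c.tot.source) (A : Fin N) :
    (c.vertFrame e A : TangentSpace 𝓘(ℝ, TotModel n N) e) =
      mfderiv 𝓘(ℝ, TotModel n N) 𝓘(ℝ, TotModel n N) c.tot.symm (c.tot e)
        (((0, EuclideanSpace.single A 1) : TotModel n N)) := by
  unfold vertFrame
  have key : ∀ w : TangentSpace 𝓘(ℝ, TotModel n N) e,
      ((mfderiv 𝓘(ℝ, TotModel n N) 𝓘(ℝ, TotModel n N) c.tot e w : TotModel n N)).1 = 0 →
      w ∈ Vert n N π e := by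
    intro w hw
    rw [c.fst_mfderiv_tot he] at hw
    have h2 := congrArg (fun w => mfderiv 𝓘(ℝ, BaseModel n) 𝓘(ℝ, BaseModel n) c.base.symm
      (c.base (π e)) w) hw
    have h3 := (h2.symm.trans (c.symm_base_mfderiv (c.mapsTo e he) _)).symm
    exact LinearMap.mem_ker.2 (h3.trans (map_zero _))
  have hw := key (mfderiv 𝓘(ℝ, TotModel n N) 𝓘(ℝ, TotModel n N) c.tot.symm (c.tot e)
    (((0, EuclideanSpace.single A 1) : TotModel n N))) (by rw [c.tot_symm_mfderiv he])
  exact congrArg Subtype.val (dif_pos hw)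

theorem vertCoframe_vertFrame [SmoothFibreBundle n N π] {e : E} (he : e ∈ c.tot.source)
    (A B : Fin N) : c.vertCoframe e A (c.vertFrame e B) = if A = B then 1 else 0 := by
  have h := c.coe_vertFrame he B
  change ((mfderiv 𝓘(ℝ, TotModel n N) 𝓘(ℝ, TotModel n N) c.tot e
    (c.vertFrame e B : TangentSpace 𝓘(ℝ, TotModel n N) e) : TotModel n N)).2 A = _
  rw [h, c.tot_symm_mfderiv he]
  simp

theorem baseCoframe_baseFrame {m : M} (hm : m ∈ c.base.source) (μ ν : Fin (n + 1)) :
    c.baseCoframe m μ (c.baseFrame m ν) = if μ = ν then 1 else 0 := by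
  have h := c.base_symm_mfderiv hm (EuclideanSpace.single ν 1)
  have h2 := congrArg (fun y : BaseModel n => y μ) h
  refine h2.trans ?_
  simp

theorem sum_vertFrame [SmoothFibreBundle n N π] {e : E} (he : e ∈ c.tot.source)
    (w : Vert n N π e) : ∑ A, c.vertCoframe e A w • c.vertFrame e A = w := by
  apply Subtype.ext
  have h0 : ((mfderiv 𝓘(ℝ, TotModel n N) 𝓘(ℝ, TotModel n N) c.tot e
      (w : TangentSpace 𝓘(ℝ, TotModel n N) e) : TotModel n N)).1 = 0 := by
    rw [c.fst_mfderiv_tot he]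
    have : mfderiv 𝓘(ℝ, TotModel n N) 𝓘(ℝ, BaseModel n) π e
      (w : TangentSpace 𝓘(ℝ, TotModel n N) e) = 0 := w.2
    rw [this]
    exact map_zero _
  have h1 : (∑ A, c.vertCoframe e A w • (((0, EuclideanSpace.single A 1) : TotModel n N))) =
      (mfderiv 𝓘(ℝ, TotModel n N) 𝓘(ℝ, TotModel n N) c.tot e
        (w : TangentSpace 𝓘(ℝ, TotModel n N) e) : TotModel n N) := by
    refine Prod.ext ?_ ?_
    · rw [h0]; simp [Prod.fst_sum]
    · ext B
      simp [Prod.snd_sum, Pi.single_apply]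
      rfl
  have h2 := c.symm_tot_mfderiv he (w : TangentSpace 𝓘(ℝ, TotModel n N) e)
  rw [← h1] at h2
  rw [← h2, Submodule.coe_sum]
  refine Eq.trans ?_ (map_sum _ _ _).symm
  refine Finset.sum_congr rfl fun A _ => ?_
  rw [Submodule.coe_smul, c.coe_vertFrame he]
  exact (map_smul _ _ _).symm

theorem sum_baseFrame {m : M} (hm : m ∈ c.base.source) (w : TangentSpace 𝓘(ℝ, BaseModel n) m) :
    ∑ μ, c.baseCoframe m μ w • c.baseFrame m μ = w := by
  have h1 : (∑ μ, c.baseCoframe m μ w • (EuclideanSpace.single μ 1 : BaseModel n)) =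
      mfderiv 𝓘(ℝ, BaseModel n) 𝓘(ℝ, BaseModel n) c.base m w := by
    ext ν
    simp [Pi.single_apply]
    rfl
  have h2 := c.symm_base_mfderiv hm w
  rw [← h1] at h2
  refine Eq.trans ?_ h2
  refine Eq.trans ?_ (map_sum _ _ _).symm
  exact Finset.sum_congr rfl fun μ _ => (map_smul _ _ _).symm

theorem baseVol_apply (m : M) (w : Fin (n + 1) → TangentSpace 𝓘(ℝ, BaseModel n) m) :
    c.baseVol m w = Matrix.det (Matrix.of fun i μ => c.baseCoframe m μ (w i)) :=
  rfl

theorem baseVol_baseFrame {m : M} (hm : m ∈ c.base.source) :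
    c.baseVol m (c.baseFrame m) = 1 := by
  rw [baseVol_apply]
  have : (Matrix.of fun i μ => c.baseCoframe m μ (c.baseFrame m i)) =
      (1 : Matrix (Fin (n + 1)) (Fin (n + 1)) ℝ) := by
    ext i j
    simp [c.baseCoframe_baseFrame hm, Matrix.one_apply, eq_comm]
  rw [this, Matrix.det_one]

theorem smul_baseVol {m : M} (hm : m ∈ c.base.source) (η : TopForms n m) :
    η (c.baseFrame m) • c.baseVol m = η := by
  let b : Module.Basis (Fin (n + 1)) ℝ (TangentSpace 𝓘(ℝ, BaseModel n) m) :=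
    Module.Basis.ofEquivFun
      { toFun := fun w μ => c.baseCoframe m μ w
        map_add' := fun _ _ => by ext; simp
        map_smul' := fun _ _ => by ext; simp
        invFun := fun a => ∑ μ, a μ • c.baseFrame m μ
        left_inv := fun w => c.sum_baseFrame hm w
        right_inv := fun a => by
          ext μ
          simp [c.baseCoframe_baseFrame hm] }
  have hb : ⇑b = c.baseFrame m := by
    ext1 μ
    simp [b, Module.Basis.coe_ofEquivFun, Pi.single_apply]
  have h := η.eq_smul_basis_det b
  rw [hb] at h
  have h2 : b.det = c.baseVol m := by
    ext w
    rw [baseVol_apply, Module.Basis.det_apply, ← Matrix.det_transpose]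
    rfl
  rw [h2] at h
  exact h.symm

theorem momentum_tmul (e : E) (A : Fin N) (μ : Fin (n + 1)) (l : Module.Dual ℝ (Vert n N π e))
    (Z : TangentSpace 𝓘(ℝ, BaseModel n) (π e)) (η : TopForms n (π e)) :
    c.momentum e A μ ((l ⊗ₜ[ℝ] Z) ⊗ₜ[ℝ] η) =
      l (c.vertFrame e A) * c.baseCoframe (π e) μ Z * η (c.baseFrame (π e)) :=
  rfl

theorem momentum_ofMomentum' (c' : FibredChart n N π) (e : E) (A : Fin N) (μ : Fin (n + 1))
    (q : Fin N → Fin (n + 1) → ℝ) :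
    c'.momentum e A μ (c.ofMomentum e q) = ∑ B, ∑ ν, q B ν *
      (c.vertCoframe e B (c'.vertFrame e A) * c'.baseCoframe (π e) μ (c.baseFrame (π e) ν) *
        c.baseVol (π e) (c'.baseFrame (π e))) := by
  simp only [ofMomentum, map_sum, map_smul, momentum_tmul, smul_eq_mul]

theorem momentum_ofMomentum [SmoothFibreBundle n N π] {e : E} (he : e ∈ c.tot.source)
    (q : Fin N → Fin (n + 1) → ℝ) (A : Fin N) (μ : Fin (n + 1)) :
    c.momentum e A μ (c.ofMomentum e q) = q A μ := by
  have hm := c.mapsTo e he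
  simp [momentum_ofMomentum', c.vertCoframe_vertFrame he, c.baseCoframe_baseFrame hm,
    c.baseVol_baseFrame hm]

theorem ofMomentum_momentum [SmoothFibreBundle n N π] {e : E} (he : e ∈ c.tot.source)
    (p : PhaseFibre n N π e) :
    c.ofMomentum e (fun A μ => c.momentum e A μ p) = p := by
  have hm := c.mapsTo e he
  induction p using TensorProduct.induction_on with
  | zero => simp [ofMomentum]
  | add x y hx hy =>
    conv_rhs => rw [← hx, ← hy]
    simp only [ofMomentum, map_add, add_smul, Finset.sum_add_distrib]
  | tmul x η =>
    induction x using TensorProduct.induction_on with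
    | zero => simp [ofMomentum]
    | add x y hx hy =>
      rw [TensorProduct.add_tmul]
      conv_rhs => rw [← hx, ← hy]
      simp only [ofMomentum, map_add, add_smul, Finset.sum_add_distrib]
    | tmul l Z =>
      have hl : ∑ A, l (c.vertFrame e A) • c.vertCoframe e A = l := by
        ext w
        refine Eq.trans ?_ (congrArg l (c.sum_vertFrame he w))
        rw [map_sum, LinearMap.sum_apply]
        refine Finset.sum_congr rfl fun A _ => ?_
        rw [LinearMap.smul_apply, map_smul, smul_eq_mul, smul_eq_mul, mul_comm]
      have hZ := c.sum_baseFrame hm Z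
      have hη := c.smul_baseVol hm η
      refine Eq.trans ?_ (congrArg₂ (fun x y => x ⊗ₜ[ℝ] y) (congrArg₂ (fun x y => x ⊗ₜ[ℝ] y) hl hZ)
        hη)
      simp only [TensorProduct.sum_tmul, ofMomentum]
      refine Finset.sum_congr rfl fun A _ => ?_
      simp only [TensorProduct.tmul_sum, TensorProduct.sum_tmul]
      refine Finset.sum_congr rfl fun μ _ => ?_
      rw [TensorProduct.smul_tmul_smul, TensorProduct.smul_tmul_smul, momentum_tmul]

theorem contDiffOn_totTrans [IsManifold 𝓘(ℝ, TotModel n N) ∞ E] (c' : FibredChart n N π) :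
    ContDiffOn ℝ ∞ (c'.tot ∘ c.tot.symm) (c.tot.symm.trans c'.tot).source :=
  (contMDiffOn_of_mem_contDiffGroupoid
    (IsManifold.compatible_of_mem_maximalAtlas c.tot_mem c'.tot_mem)).contDiffOn

theorem contDiffOn_baseTrans [IsManifold 𝓘(ℝ, BaseModel n) ∞ M] (c' : FibredChart n N π) :
    ContDiffOn ℝ ∞ (c'.base ∘ c.base.symm) (c.base.symm.trans c'.base).source :=
  (contMDiffOn_of_mem_contDiffGroupoid
    (IsManifold.compatible_of_mem_maximalAtlas c.base_mem c'.base_mem)).contDiffOn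

theorem vertCoframe_vertFrame' [SmoothFibreBundle n N π] (c' : FibredChart n N π) {e : E}
    (he : e ∈ c.tot.source) (he' : e ∈ c'.tot.source) (A B : Fin N) :
    c.vertCoframe e B (c'.vertFrame e A) =
      (fderiv ℝ (c.tot ∘ c'.tot.symm) (c'.tot e) (0, EuclideanSpace.single A 1)).2 B := by
  change ((mfderiv 𝓘(ℝ, TotModel n N) 𝓘(ℝ, TotModel n N) c.tot e
    (c'.vertFrame e A : TangentSpace 𝓘(ℝ, TotModel n N) e) : TotModel n N)).2 B = _
  rw [c'.coe_vertFrame he']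
  have h2 := (c'.mdiff_tot.mdifferentiableAt_symm (c'.tot.map_source he')).hasMFDerivAt
  have h1 : ∀ x, x = e → HasMFDerivAt 𝓘(ℝ, TotModel n N) 𝓘(ℝ, TotModel n N) c.tot x
      (mfderiv 𝓘(ℝ, TotModel n N) 𝓘(ℝ, TotModel n N) c.tot e) := by
    rintro _ rfl
    exact (c.mdiff_tot.mdifferentiableAt he).hasMFDerivAt
  have h3 := ((h1 _ (c'.tot.left_inv he')).comp _ h2).mfderiv
  rw [mfderiv_eq_fderiv] at h3
  exact (congrArg (fun L : TotModel n N →L[ℝ] TotModel n N => (L (0, EuclideanSpace.single A 1)).2 B) h3).symm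

theorem baseCoframe_baseFrame' (c' : FibredChart n N π) {m : M}
    (hm : m ∈ c.base.source) (hm' : m ∈ c'.base.source) (μ ν : Fin (n + 1)) :
    c.baseCoframe m μ (c'.baseFrame m ν) =
      fderiv ℝ (c.base ∘ c'.base.symm) (c'.base m) (EuclideanSpace.single ν 1) μ := by
  have h2 := (c'.mdiff_base.mdifferentiableAt_symm (c'.base.map_source hm')).hasMFDerivAt
  have h1 : ∀ x, x = m → HasMFDerivAt 𝓘(ℝ, BaseModel n) 𝓘(ℝ, BaseModel n) c.base x
      (mfderiv 𝓘(ℝ, BaseModel n) 𝓘(ℝ, BaseModel n) c.base m) := by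
    rintro _ rfl
    exact (c.mdiff_base.mdifferentiableAt hm).hasMFDerivAt
  have h3 := ((h1 _ (c'.base.left_inv hm')).comp _ h2).mfderiv
  rw [mfderiv_eq_fderiv] at h3
  exact (congrArg (fun L : BaseModel n →L[ℝ] BaseModel n => (L (EuclideanSpace.single ν 1)) μ) h3).symm

/-- The chart `((x^μ, v^A), p^μ_A)` of the phase space induced by fibred coordinates. -/
def phaseEquiv [SmoothFibreBundle n N π] : PartialEquiv (Phase n N π) (PhaseModel n N) where
  toFun p := (c.tot p.pt, fun A μ => c.momentum p.pt A μ p.mom)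
  invFun z := ⟨c.tot.symm z.1, c.ofMomentum _ z.2⟩
  source := {p | p.pt ∈ c.tot.source}
  target := {z | z.1 ∈ c.tot.target}
  map_source' p hp := c.tot.map_source hp
  map_target' z hz := c.tot.map_target hz
  left_inv' p hp := by
    have key : ∀ e, e = p.pt → (⟨e, c.ofMomentum e fun A μ => c.momentum p.pt A μ p.mom⟩ :
        Phase n N π) = p := by
      rintro e rfl
      rw [c.ofMomentum_momentum hp]
    exact key _ (c.tot.left_inv hp)
  right_inv' z hz := by
    have h := c.tot.map_target hz
    refine Prod.ext (c.tot.right_inv hz) ?_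
    ext A μ
    exact c.momentum_ofMomentum h z.2 A μ

theorem phaseTrans_source [SmoothFibreBundle n N π] (c' : FibredChart n N π) :
    (c.phaseEquiv.symm.trans c'.phaseEquiv).source =
      Prod.fst ⁻¹' (c.tot.symm.trans c'.tot).source :=
  rfl

theorem isOpen_phaseTrans_source [SmoothFibreBundle n N π] (c' : FibredChart n N π) :
    IsOpen (c.phaseEquiv.symm.trans c'.phaseEquiv).source :=
  (c.tot.symm.trans c'.tot).open_source.preimage continuous_fst

theorem contDiffOn_phaseTrans [IsManifold 𝓘(ℝ, BaseModel n) ∞ M]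
    [IsManifold 𝓘(ℝ, TotModel n N) ∞ E] [SmoothFibreBundle n N π] (c' : FibredChart n N π) :
    ContDiffOn ℝ ∞ (c.phaseEquiv.symm.trans c'.phaseEquiv)
      (c.phaseEquiv.symm.trans c'.phaseEquiv).source := by
  have hU : IsOpen (c.tot.symm.trans c'.tot).source := (c.tot.symm.trans c'.tot).open_source
  have hU' : IsOpen (c'.tot.symm.trans c.tot).source := (c'.tot.symm.trans c.tot).open_source
  have hW : IsOpen (c.base.symm.trans c'.base).source := (c.base.symm.trans c'.base).open_source
  have hW' : IsOpen (c'.base.symm.trans c.base).source := (c'.base.symm.trans c.base).open_source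
  set S := (c.phaseEquiv.symm.trans c'.phaseEquiv).source with hS
  have hfst : ContDiffOn ℝ ∞ (Prod.fst : PhaseModel n N → TotModel n N) S :=
    contDiff_fst.contDiffOn
  have hτ : ContDiffOn ℝ ∞ (fun z : PhaseModel n N => c'.tot (c.tot.symm z.1)) S :=
    (c.contDiffOn_totTrans c').comp hfst fun z hz => hz
  have hmem : ∀ z ∈ S, c.tot.symm z.1 ∈ c.tot.source ∧ c.tot.symm z.1 ∈ c'.tot.source :=
    fun z hz => ⟨c.tot.map_target hz.1, hz.2⟩
  have hx : ∀ z ∈ S, c.base (π (c.tot.symm z.1)) = z.1.1 := fun z hz => by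
    rw [← c.fst_tot _ (hmem z hz).1, c.tot.right_inv hz.1]
  have hx' : ∀ z ∈ S, c'.base (π (c.tot.symm z.1)) = (c'.tot (c.tot.symm z.1)).1 := fun z hz =>
    (c'.fst_tot _ (hmem z hz).2).symm
  have hW1 : ∀ z ∈ S, z.1.1 ∈ (c.base.symm.trans c'.base).source := fun z hz => by
    have h1 := c.mapsTo _ (hmem z hz).1
    have h2 := c'.mapsTo _ (hmem z hz).2
    rw [← hx z hz]
    refine ⟨c.base.map_source h1, ?_⟩
    change c.base.symm _ ∈ c'.base.source
    rwa [c.base.left_inv h1]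
  have hW2 : ∀ z ∈ S, (c'.tot (c.tot.symm z.1)).1 ∈ (c'.base.symm.trans c.base).source :=
    fun z hz => by
    have h1 := c.mapsTo _ (hmem z hz).1
    have h2 := c'.mapsTo _ (hmem z hz).2
    rw [← hx' z hz]
    refine ⟨c'.base.map_source h2, ?_⟩
    change c'.base.symm _ ∈ c.base.source
    rwa [c'.base.left_inv h2]
  have hU2 : ∀ z ∈ S, c'.tot (c.tot.symm z.1) ∈ (c'.tot.symm.trans c.tot).source :=
    fun z hz => by
    refine ⟨c'.tot.map_source (hmem z hz).2, ?_⟩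
    change c'.tot.symm _ ∈ c.tot.source
    rw [c'.tot.left_inv (hmem z hz).2]
    exact (hmem z hz).1
  have hD1 : ContDiffOn ℝ ∞ (fun z : PhaseModel n N =>
      fderiv ℝ (c.tot ∘ c'.tot.symm) (c'.tot (c.tot.symm z.1))) S :=
    ((c'.contDiffOn_totTrans c).fderiv_of_isOpen hU' (m := ∞) (by simp)).comp hτ hU2
  have hD2 : ContDiffOn ℝ ∞ (fun z : PhaseModel n N =>
      fderiv ℝ (c'.base ∘ c.base.symm) z.1.1) S :=
    ((c.contDiffOn_baseTrans c').fderiv_of_isOpen hW (m := ∞) (by simp)).comp hfst.fst hW1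
  have hD3 : ContDiffOn ℝ ∞ (fun z : PhaseModel n N =>
      fderiv ℝ (c.base ∘ c'.base.symm) (c'.tot (c.tot.symm z.1)).1) S :=
    ((c'.contDiffOn_baseTrans c).fderiv_of_isOpen hW' (m := ∞) (by simp)).comp hτ.fst hW2
  have hcoord : ∀ (k : ℕ) (i : Fin k) (g : PhaseModel n N → EuclideanSpace ℝ (Fin k)),
      ContDiffOn ℝ ∞ g S → ContDiffOn ℝ ∞ (fun z => g z i) S := fun k i g hg =>
    (EuclideanSpace.proj (𝕜 := ℝ) i : EuclideanSpace ℝ (Fin k) →L[ℝ] ℝ).contDiff.comp_contDiffOn hg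
  refine ContDiffOn.prodMk hτ ?_
  refine contDiffOn_pi.2 fun A => contDiffOn_pi.2 fun μ => ?_
  have hmain : ContDiffOn ℝ ∞ (fun z : PhaseModel n N => ∑ B, ∑ ν, z.2 B ν *
      ((fderiv ℝ (c.tot ∘ c'.tot.symm) (c'.tot (c.tot.symm z.1))
          (0, EuclideanSpace.single A 1)).2 B *
        fderiv ℝ (c'.base ∘ c.base.symm) z.1.1 (EuclideanSpace.single ν 1) μ *
        Matrix.det (Matrix.of fun i j : Fin (n + 1) =>
          fderiv ℝ (c.base ∘ c'.base.symm) (c'.tot (c.tot.symm z.1)).1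
            (EuclideanSpace.single i 1) j))) S := by
    refine ContDiffOn.sum fun B _ => ContDiffOn.sum fun ν _ => ?_
    refine ContDiffOn.mul ?_ (ContDiffOn.mul (ContDiffOn.mul ?_ ?_) ?_)
    · exact ((contDiff_apply_apply ℝ ℝ B ν).comp contDiff_snd).contDiffOn
    · exact hcoord _ B _ (hD1.clm_apply contDiffOn_const).snd
    · exact hcoord _ μ _ (hD2.clm_apply contDiffOn_const)
    · simp only [Matrix.det_apply, Matrix.of_apply]
      refine ContDiffOn.sum fun σ _ => ContDiffOn.const_smul _ ?_
      exact contDiffOn_prod fun i _ => hcoord _ i _ (hD3.clm_apply contDiffOn_const)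
  refine hmain.congr fun z hz => ?_
  obtain ⟨h1, h2⟩ := hmem z hz
  have h3 := c.mapsTo _ h1
  have h4 := c'.mapsTo _ h2
  change c'.momentum (c.tot.symm z.1) A μ (c.ofMomentum _ z.2) = _
  rw [c.momentum_ofMomentum' c']
  refine Finset.sum_congr rfl fun B _ => Finset.sum_congr rfl fun ν _ => ?_
  rw [c.vertCoframe_vertFrame' c' h1 h2, c'.baseCoframe_baseFrame' c h4 h3, hx z hz,
    c.baseVol_apply]
  simp only [c.baseCoframe_baseFrame' c' h3 h4, hx' z hz]

end Facts

end FibredChart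

section Manifold

variable {n N}
variable [IsManifold 𝓘(ℝ, BaseModel n) ∞ M] [IsManifold 𝓘(ℝ, TotModel n N) ∞ E]
variable (π : E → M) [SmoothFibreBundle n N π]

/-- A chosen system of fibred coordinates around a point of `E`. -/
def fibredChartAt (e : E) : FibredChart n N π := (exists_fibredChart n N π e).choose

theorem mem_fibredChartAt_source (e : E) : e ∈ (fibredChartAt π e : FibredChart n N π).tot.source :=
  (exists_fibredChart n N π e).choose_spec

/-- The smooth atlas of the phase space: all charts induced by fibred coordinates. -/
def phaseCore : ChartedSpaceCore (PhaseModel n N) (Phase n N π) where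
  atlas := Set.range fun c : FibredChart n N π => c.phaseEquiv
  chartAt p := (fibredChartAt π p.pt : FibredChart n N π).phaseEquiv
  mem_chart_source p := mem_fibredChartAt_source π p.pt
  chart_mem_atlas p := ⟨_, rfl⟩
  open_source := by
    rintro _ _ ⟨c, rfl⟩ ⟨c', rfl⟩
    exact c.isOpen_phaseTrans_source c'
  continuousOn_toFun := by
    rintro _ _ ⟨c, rfl⟩ ⟨c', rfl⟩
    exact (c.contDiffOn_phaseTrans c').continuousOn

instance : TopologicalSpace (Phase n N π) := (phaseCore π).toTopologicalSpace

instance : ChartedSpace (PhaseModel n N) (Phase n N π) := (phaseCore π).toChartedSpace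

instance : IsManifold 𝓘(ℝ, PhaseModel n N) ∞ (Phase n N π) := by
  refine isManifold_of_contDiffOn _ _ _ ?_
  intro e e' he he'
  obtain ⟨_, ⟨f, rfl⟩, _, ⟨⟨c, rfl⟩, rfl⟩, hc⟩ := he
  obtain ⟨_, ⟨f', rfl⟩, _, ⟨⟨c', rfl⟩, rfl⟩, hc'⟩ := he'
  obtain rfl := hc
  obtain rfl := hc'
  have h := c.contDiffOn_phaseTrans c'
  refine ContDiffOn.congr_mono h ?_ ?_
  · intro x _; rfl
  · intro x hx; exact hx.1

end Manifold

section Fields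

variable {Zm : Type*} [NormedAddCommGroup Zm] [NormedSpace ℝ Zm]
variable {Z : Type*} [TopologicalSpace Z] [ChartedSpace Zm Z] [IsManifold 𝓘(ℝ, Zm) ∞ Z]

variable (Zm) in
/-- Smooth vector fields on a manifold modelled on `Zm`. -/
def IsSmoothField (X : ∀ z : Z, TangentSpace 𝓘(ℝ, Zm) z) : Prop :=
  ContMDiff 𝓘(ℝ, Zm) 𝓘(ℝ, Zm).tangent ∞ fun z => (⟨z, X z⟩ : TangentBundle 𝓘(ℝ, Zm) Z)

variable (Zm) in
/-- A connection on `f : Z → M`: a smooth projection of `TZ` onto the vertical subbundle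
`ker Tf`. -/
structure Connection (f : Z → M) where
  proj : ∀ z : Z, TangentSpace 𝓘(ℝ, Zm) z →L[ℝ] TangentSpace 𝓘(ℝ, Zm) z
  contMDiff_proj : ContMDiff 𝓘(ℝ, Zm).tangent 𝓘(ℝ, Zm).tangent ∞
    fun w : TangentBundle 𝓘(ℝ, Zm) Z =>
      (⟨w.proj, proj w.proj w.snd⟩ : TangentBundle 𝓘(ℝ, Zm) Z)
  mfderiv_proj : ∀ (z : Z) (w : TangentSpace 𝓘(ℝ, Zm) z),
    mfderiv 𝓘(ℝ, Zm) 𝓘(ℝ, BaseModel n) f z (proj z w) = 0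
  proj_of_mfderiv_eq_zero : ∀ (z : Z) (w : TangentSpace 𝓘(ℝ, Zm) z),
    mfderiv 𝓘(ℝ, Zm) 𝓘(ℝ, BaseModel n) f z w = 0 → proj z w = w

end Fields

section Geometry

variable {n N}
variable [IsManifold 𝓘(ℝ, BaseModel n) ∞ M] [IsManifold 𝓘(ℝ, TotModel n N) ∞ E]

/-- Smooth `π`-vertical vector fields on `E`. -/
structure IsVerticalField (π : E → M) (X : ∀ e : E, TangentSpace 𝓘(ℝ, TotModel n N) e) :
    Prop where
  smooth : IsSmoothField (TotModel n N) X
  vertical : ∀ e, X e ∈ Vert n N π e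

variable {π : E → M}

/-- The components `X^A`, as functions of the fibred coordinates `y = (x^μ, v^A)`. -/
def FibredChart.vertComp (c : FibredChart n N π) (X : ∀ e : E, TangentSpace 𝓘(ℝ, TotModel n N) e)
    (y : TotModel n N) : FibreModel N :=
  ((mfderiv 𝓘(ℝ, TotModel n N) 𝓘(ℝ, TotModel n N) c.tot (c.tot.symm y) (X (c.tot.symm y)) :
    TotModel n N)).2

/-- An element `λ ⊗ Z ⊗ η` of the phase space as the map `w ↦ λ(w) Z ⊗ η` on `V_e E`. -/
def evalVert (e : E) : PhaseFibre n N π e →ₗ[ℝ] Vert n N π e →ₗ[ℝ]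
    TangentSpace 𝓘(ℝ, BaseModel n) (π e) ⊗[ℝ] TopForms n (π e) :=
  dualTensorHom ℝ _ _ ∘ₗ (TensorProduct.assoc ℝ _ _ _).toLinearMap

/-- The contraction `Z ⊗ η ↦ η(Z, ·, …, ·)`. -/
def contractTop (m : M) : TangentSpace 𝓘(ℝ, BaseModel n) m ⊗[ℝ] TopForms n m →ₗ[ℝ]
    TangentSpace 𝓘(ℝ, BaseModel n) m [⋀^Fin n]→ₗ[ℝ] ℝ :=
  TensorProduct.lift (AlternatingMap.curryLeftLinearMap (n := n)).flip

variable [SmoothFibreBundle n N π]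

/-- The projection of the phase space onto the base manifold. -/
def Phase.toBase (p : Phase n N π) : M := π p.pt

/-- A connection on the phase space (over `M`) that projects onto the connection `Γ` of `E`. -/
def Connection.ProjectsTo
    (Γbar : Connection n (PhaseModel n N) (Phase.toBase : Phase n N π → M))
    (Γ : Connection n (TotModel n N) π) : Prop :=
  ∀ (p : Phase n N π) (w : TangentSpace 𝓘(ℝ, PhaseModel n N) p),
    mfderiv 𝓘(ℝ, PhaseModel n N) 𝓘(ℝ, TotModel n N) Phase.pt p (Γbar.proj p w) =
      Γ.proj p.pt (mfderiv 𝓘(ℝ, PhaseModel n N) 𝓘(ℝ, TotModel n N) Phase.pt p w)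

/-- The canonical lift of a vertical vector field to the phase space, in coordinates
`X̂ = X^A ∂_A - p^ν_B ∂_A X^B ∂/∂p^ν_A`. -/
def lift (X : ∀ e : E, TangentSpace 𝓘(ℝ, TotModel n N) e) (p : Phase n N π) :
    TangentSpace 𝓘(ℝ, PhaseModel n N) p :=
  let c : FibredChart n N π := fibredChartAt π p.pt
  let φ := chartAt (PhaseModel n N) p
  let z : PhaseModel n N := φ p
  mfderiv 𝓘(ℝ, PhaseModel n N) 𝓘(ℝ, PhaseModel n N) φ.symm z
    (((0, c.vertComp X z.1), fun A ν =>
      -∑ B, z.2 B ν * fderiv ℝ (c.vertComp X) z.1 (0, EuclideanSpace.single A 1) B) :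
      PhaseModel n N)

/-- `k`-forms on the phase space (not necessarily smooth). -/
abbrev PhaseForm (n N : ℕ) {M : Type v} [TopologicalSpace M] [ChartedSpace (BaseModel n) M]
    {E : Type u} [TopologicalSpace E] [ChartedSpace (TotModel n N) E]
    [IsManifold 𝓘(ℝ, BaseModel n) ∞ M] [IsManifold 𝓘(ℝ, TotModel n N) ∞ E]
    (π : E → M) [SmoothFibreBundle n N π] (k : ℕ) : Type _ :=
  ∀ p : Phase n N π, TangentSpace 𝓘(ℝ, PhaseModel n N) p [⋀^Fin k]→L[ℝ] ℝ

/-- The contraction `X ⌟ α = α(X, ·, …, ·)`. -/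
def contract {k : ℕ} (X : ∀ p : Phase n N π, TangentSpace 𝓘(ℝ, PhaseModel n N) p)
    (α : PhaseForm n N π (k + 1)) : PhaseForm n N π k :=
  fun p => ContinuousAlternatingMap.curryLeft (E := PhaseModel n N) (α p) (X p)

theorem continuous_multilinear {k : ℕ}
    (f : MultilinearMap ℝ (fun _ : Fin k => PhaseModel n N) ℝ) : Continuous f := by
  let b := Module.finBasis ℝ (PhaseModel n N)
  have h : ∀ v, f v = ∑ r : Fin k → Fin (Module.finrank ℝ (PhaseModel n N)),
      (∏ i, b.repr (v i) (r i)) • f fun i => b (r i) := by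
    intro v
    have : v = fun i => ∑ j, b.repr (v i) j • b j := by
      ext1 i
      exact (b.sum_repr (v i)).symm
    conv_lhs => rw [this]
    rw [f.map_sum]
    exact Finset.sum_congr rfl fun r _ => f.map_smul_univ _ _
  have h2 : Continuous fun v : Fin k → PhaseModel n N =>
      ∑ r : Fin k → Fin (Module.finrank ℝ (PhaseModel n N)),
        (∏ i, b.repr (v i) (r i)) * f fun i => b (r i) := by
    refine continuous_finsetSum _ fun r _ => Continuous.mul ?_ continuous_const
    refine continuous_finsetProd _ fun i _ => ?_
    exact (LinearMap.continuous_of_finiteDimensional (b.coord (r i))).comp (continuous_apply i)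
  exact h2.congr fun v => (h v).symm

/-- The vertical part `P_Γ(T pr (w)) ∈ V_e E` of a tangent vector of the phase space. -/
def vertPart (Γ : Connection n (TotModel n N) π) (p : Phase n N π) :
    TangentSpace 𝓘(ℝ, PhaseModel n N) p →ₗ[ℝ] Vert n N π p.pt :=
  LinearMap.codRestrict _
    ((Γ.proj p.pt).toLinearMap ∘ₗ
      (mfderiv 𝓘(ℝ, PhaseModel n N) 𝓘(ℝ, TotModel n N) Phase.pt p).toLinearMap)
    fun _ => LinearMap.mem_ker.2 (Γ.mfderiv_proj _ _)

/-- At `p = α ⊗ η`, the multilinear form `η(α(P_Γ T pr w_0), Tπ w_1, …, Tπ w_n)`. -/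
def thetaMultilinear (Γ : Connection n (TotModel n N) π) (p : Phase n N π) :
    MultilinearMap ℝ (fun _ : Fin (n + 1) => TangentSpace 𝓘(ℝ, PhaseModel n N) p) ℝ :=
  LinearMap.uncurryLeft (M := fun _ : Fin (n + 1) => TangentSpace 𝓘(ℝ, PhaseModel n N) p)
    { toFun := fun w =>
        ((contractTop (π p.pt) (evalVert p.pt p.mom (vertPart Γ p w))).compLinearMap
          (mfderiv 𝓘(ℝ, PhaseModel n N) 𝓘(ℝ, BaseModel n) Phase.toBase p).toLinearMap
          ).toMultilinearMap
      map_add' := fun _ _ => by simp only [map_add]; rfl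
      map_smul' := fun _ _ => by simp only [map_smul]; rfl }

/-- The canonical form `Θ_Γ`, the alternation `1/(n+1)! ∑_σ sgn σ …` of `thetaMultilinear`. -/
def theta (Γ : Connection n (TotModel n N) π) : PhaseForm n N π (n + 1) := fun p =>
  { (((n + 1).factorial : ℝ)⁻¹ • MultilinearMap.alternatization (thetaMultilinear Γ p)) with
    cont := continuous_multilinear (n := n) (N := N)
      (((n + 1).factorial : ℝ)⁻¹ •
        MultilinearMap.alternatization (thetaMultilinear Γ p)).toMultilinearMap }

/-- The projection `((x, v), q) ↦ ((0, v), q)` of the model space onto the fibre directions. -/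
def fibreDir : PhaseModel n N →L[ℝ] PhaseModel n N :=
  ((0 : BaseModel n →L[ℝ] BaseModel n).prodMap (ContinuousLinearMap.id ℝ (FibreModel N))).prodMap
    (ContinuousLinearMap.id ℝ (Fin N → Fin (n + 1) → ℝ))

/-- The representative of a form in a chart. -/
def coordForm {k : ℕ} (φ : OpenPartialHomeomorph (Phase n N π) (PhaseModel n N))
    (α : PhaseForm n N π k) (z : PhaseModel n N) : PhaseModel n N [⋀^Fin k]→L[ℝ] ℝ :=
  (α (φ.symm z)).compContinuousLinearMap
    (mfderiv 𝓘(ℝ, PhaseModel n N) 𝓘(ℝ, PhaseModel n N) φ.symm z)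

/-- Smooth forms: the chart representatives are smooth. -/
def IsSmoothForm {k : ℕ} (α : PhaseForm n N π k) : Prop :=
  ∀ p : Phase n N π, ContDiffOn ℝ ∞ (coordForm (chartAt (PhaseModel n N) p) α)
    (chartAt (PhaseModel n N) p).target

/-- Horizontal forms: they vanish as soon as one argument is vertical over the base. -/
def IsHorizontalForm {k : ℕ} (α : PhaseForm n N π k) : Prop :=
  ∀ (p : Phase n N π) (w : Fin k → TangentSpace 𝓘(ℝ, PhaseModel n N) p),
    (∃ i, mfderiv 𝓘(ℝ, PhaseModel n N) 𝓘(ℝ, BaseModel n) Phase.toBase p (w i) = 0) → α p w = 0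

/-- The representative in a chart of the vertical projection of a connection. -/
def coordProj (φ : OpenPartialHomeomorph (Phase n N π) (PhaseModel n N))
    (Γbar : Connection n (PhaseModel n N) (Phase.toBase : Phase n N π → M)) (z : PhaseModel n N) :
    PhaseModel n N →L[ℝ] PhaseModel n N :=
  (mfderiv 𝓘(ℝ, PhaseModel n N) 𝓘(ℝ, PhaseModel n N) φ (φ.symm z)) ∘L (Γbar.proj (φ.symm z)) ∘L
    (mfderiv 𝓘(ℝ, PhaseModel n N) 𝓘(ℝ, PhaseModel n N) φ.symm z)

/-- The values of the coframe `(dx^μ, 𝔢^A, 𝔢^μ_A)` adapted to the connection, at the point with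
coordinates `z`: the `dx`-components of a vector and the components of its vertical part. -/
def coframe (φ : OpenPartialHomeomorph (Phase n N π) (PhaseModel n N))
    (Γbar : Connection n (PhaseModel n N) (Phase.toBase : Phase n N π → M)) (z : PhaseModel n N) :
    PhaseModel n N →L[ℝ] PhaseModel n N :=
  (ContinuousLinearMap.id ℝ _ - fibreDir) + coordProj φ Γbar z

/-- The frame dual to `coframe`: horizontal lifts of `∂_μ`, and `∂_A`, `∂/∂p^μ_A`. -/
def frame (φ : OpenPartialHomeomorph (Phase n N π) (PhaseModel n N))
    (Γbar : Connection n (PhaseModel n N) (Phase.toBase : Phase n N π → M)) (z : PhaseModel n N) :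
    PhaseModel n N →L[ℝ] PhaseModel n N :=
  (ContinuousLinearMap.id ℝ _ - coordProj φ Γbar z) ∘L (ContinuousLinearMap.id ℝ _ - fibreDir) +
    fibreDir

/-- The vertical differential `d_Γ̄` of a connection on the phase space. For
`α = ∑ f_I θ^I`, expanded in exterior products `θ^I` of the adapted coframe
`(dx^μ, 𝔢^A, 𝔢^μ_A)`, it is `∑ (∂_A f_I 𝔢^A + ∂f_I/∂p^μ_A 𝔢^μ_A) ∧ θ^I`. -/
def dVert {k : ℕ} (Γbar : Connection n (PhaseModel n N) (Phase.toBase : Phase n N π → M))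
    (α : PhaseForm n N π k) : PhaseForm n N π (k + 1) := fun p =>
  let φ := chartAt (PhaseModel n N) p
  let coeff : PhaseModel n N → PhaseModel n N [⋀^Fin k]→L[ℝ] ℝ := fun z =>
    (coordForm φ α z).compContinuousLinearMap (frame φ Γbar z)
  let dcoeff : PhaseModel n N [⋀^Fin (k + 1)]→L[ℝ] ℝ :=
    ContinuousAlternatingMap.alternatizeUncurryFin (fderiv ℝ coeff (φ p) ∘L fibreDir)
  (dcoeff.compContinuousLinearMap (coframe φ Γbar (φ p))).compContinuousLinearMap
    (mfderiv 𝓘(ℝ, PhaseModel n N) 𝓘(ℝ, PhaseModel n N) φ p)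

/-- The polysymplectic form `Ω_Γ = -d_Γ̄ Θ_Γ`. -/
def omega (Γ : Connection n (TotModel n N) π)
    (Γbar : Connection n (PhaseModel n N) (Phase.toBase : Phase n N π → M)) :
    PhaseForm n N π (n + 2) :=
  -dVert Γbar (theta Γ)

/-- The form `I(X) = X̂ ⌟ Θ_Γ`. -/
def momentumForm (Γ : Connection n (TotModel n N) π)
    (X : ∀ e : E, TangentSpace 𝓘(ℝ, TotModel n N) e) : PhaseForm n N π n :=
  contract (lift X) (theta Γ)

/-- `X` is a Hamiltonian vector field of the form `F`: `d_Γ̄ F = X ⌟ Ω_Γ`. -/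
structure IsHamiltonianField (Γ : Connection n (TotModel n N) π)
    (Γbar : Connection n (PhaseModel n N) (Phase.toBase : Phase n N π → M))
    (F : PhaseForm n N π n) (X : ∀ p : Phase n N π, TangentSpace 𝓘(ℝ, PhaseModel n N) p) :
    Prop where
  smooth : IsSmoothField (PhaseModel n N) X
  dVert_eq : dVert Γbar F = contract X (omega Γ Γbar)

/-- Hamiltonian forms of degree `dim M - 1`. -/
structure IsHamiltonianForm (Γ : Connection n (TotModel n N) π)
    (Γbar : Connection n (PhaseModel n N) (Phase.toBase : Phase n N π → M))
    (F : PhaseForm n N π n) : Prop where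
  smooth : IsSmoothForm F
  horizontal : IsHorizontalForm F
  exists_field : ∃ X, IsHamiltonianField Γ Γbar F X

open Classical in
/-- The bracket `{F, G} = X_F ⌟ X_G ⌟ Ω_Γ` of Hamiltonian forms of degree `dim M - 1`, where
`X_F`, `X_G` are any Hamiltonian vector fields of `F`, `G`. -/
def bracket (Γ : Connection n (TotModel n N) π)
    (Γbar : Connection n (PhaseModel n N) (Phase.toBase : Phase n N π → M))
    (F G : PhaseForm n N π n) : PhaseForm n N π n :=
  if h : IsHamiltonianForm Γ Γbar F ∧ IsHamiltonianForm Γ Γbar G then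
    contract h.1.exists_field.choose (contract h.2.exists_field.choose (omega Γ Γbar))
  else 0

/-- The bracket of Hamiltonian forms of degree `|F| = dim M - 1` in the graded sign convention
`{F, G} = (-1)^(dim M - |F|) X_F ⌟ X_G ⌟ Ω_Γ`. -/
def gerstenhaberBracket (Γ : Connection n (TotModel n N) π)
    (Γbar : Connection n (PhaseModel n N) (Phase.toBase : Phase n N π → M))
    (F G : PhaseForm n N π n) : PhaseForm n N π n :=
  (-1 : ℝ) ^ ((n + 1) - n) • bracket Γ Γbar F G

/-- `φ_t` is a smooth one-parameter family of local fibre-preserving maps over the identity of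
`M`, defined near `e₀`, with `φ_0 = id` and velocity field `X` at `t = 0`. The local flow of `X`
is such a family. -/
structure GeneratesNear (π : E → M) (X : ∀ e : E, TangentSpace 𝓘(ℝ, TotModel n N) e)
    (φ : ℝ → E → E) (e₀ : E) : Prop where
  smooth : ContMDiffAt (𝓘(ℝ, ℝ).prod 𝓘(ℝ, TotModel n N)) 𝓘(ℝ, TotModel n N) ∞
    (fun q : ℝ × E => φ q.1 q.2) (0, e₀)
  zero : ∀ᶠ e in 𝓝 e₀, φ 0 e = e
  preserves : ∀ᶠ q : ℝ × E in 𝓝 (0, e₀), π (φ q.1 q.2) = π q.2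
  velocity : ∀ᶠ e in 𝓝 e₀, HasMFDerivAt 𝓘(ℝ, ℝ) 𝓘(ℝ, TotModel n N) (fun t => φ t e) 0
    (ContinuousLinearMap.toSpanSingleton ℝ (X (φ 0 e)))

/-- `q = ψ_* p` for a local fibre-preserving map `ψ` of `E` over the identity of `M`: `q` lies over
`ψ(e)` and the pull-back of `q` along the vertical tangent map `Vψ` is `p`. (The tangent spaces
at the equal points `π (ψ e)` and `π e` are identified.) -/
def IsPushforward (ψ : E → E) (p q : Phase n N π) : Prop :=
  q.pt = ψ p.pt ∧ ∀ (v : Vert n N π p.pt) (w : Vert n N π q.pt),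
    (w : TangentSpace 𝓘(ℝ, TotModel n N) q.pt) =
      mfderiv 𝓘(ℝ, TotModel n N) 𝓘(ℝ, TotModel n N) ψ p.pt
        (v : TangentSpace 𝓘(ℝ, TotModel n N) p.pt) →
    evalVert q.pt q.mom w = evalVert p.pt p.mom v

/-- `Xh` is the infinitesimal generator of the transport to the phase space of the one-parameter
families generated by `X`. -/
def IsGeneratorOfLift (X : ∀ e : E, TangentSpace 𝓘(ℝ, TotModel n N) e)
    (Xh : ∀ p : Phase n N π, TangentSpace 𝓘(ℝ, PhaseModel n N) p) : Prop :=
  ∀ (p : Phase n N π) (φ : ℝ → E → E), GeneratesNear π X φ p.pt →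
    ∀ γ : ℝ → Phase n N π, (∀ᶠ t in 𝓝 (0 : ℝ), IsPushforward (φ t) p (γ t)) →
      HasMFDerivAt 𝓘(ℝ, ℝ) 𝓘(ℝ, PhaseModel n N) γ 0
        (ContinuousLinearMap.toSpanSingleton ℝ (Xh (γ 0)))

end Geometry

end Bundle
end Polysymplectic
end

open Polysymplectic

noncomputable section

/-! ### Alternating a form that is already alternating in all arguments but the first. -/

namespace MultilinearMap

/-! Here the base has dimension $n+1$. The momenta of a point are treated as the linear map
`momMap`, $v\mapsto v^Ap_A$, from fibre directions to $\mathbb R^{n+1}$. Intrinsically this is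
$v\mapsto\alpha(v)$ with values in $TM\otimes\Lambda^{n+1}T^*M$ (`momMap_momenta`), so chart changes
and push-forwards act on momenta by composition with vertical Jacobians, up to a linear map that
depends only on the base point.

Differentiating such a composition law produces the momentum part $-p\circ\partial X$ of the lift.
Along a line in the direction of the lift it gives independence of the chart
(`eq_liftCoord_snd_of_transport`): the second derivative of the transition map cancels against the
derivative of the transformation law of $X$. Along a one-parameter family $\varphi_t$ it gives the
generator property (`isGeneratorOfLift_lift`), from the derivative of the inverse Jacobian at the
identity. Compatibility with brackets (`lieBracket_liftCoord`) is then a coordinate computation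
resting on symmetry of second derivatives.

For the forms, write $d^nx_\mu=\partial_\mu\lrcorner d^{n+1}x$. Since $\bar\Gamma$ projects onto
$\Gamma$, in the adapted coframe $(dx^\mu,e^A,e^\mu_A)$ one has
$\Theta_\Gamma=\frac1{n+1}p^\mu_A\,e^A\wedge d^nx_\mu$. Its coefficients involve neither connection
(`coordForm_theta_frame`), so $\Omega_\Gamma=-\frac1{n+1}e^\mu_A\wedge e^A\wedge d^nx_\mu$. As $\hat
X$ is vertical, $I(X)=\frac1{n+1}p^\mu_AX^A\,d^nx_\mu$. Comparing terms,
$d_{\bar\Gamma}I(X)=\frac1{n+1}(p^\mu_A\partial_BX^A\,e^B+X^Ae^\mu_A)\wedge d^nx_\mu=\hat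
X\lrcorner\Omega_\Gamma$ (`alternatize_momentumModel`, `dVert_momentumForm`).

Consequently $\hat X\lrcorner\hat Y\lrcorner\Omega_\Gamma=\hat X\lrcorner d_{\bar\Gamma}I(Y)$ has as
coefficients the derivative of $p^\mu_AY^A$ along $\hat X$, which is $p^\mu_A[X,Y]^A$
(`contract_lift_contract_lift_omega`). The bracket does not depend on the Hamiltonian fields chosen,
because each enters only through its contraction with $\Omega_\Gamma$; so the lifts may be used to
compute it. -/

theorem alternatization_uncurryLeft {V : Type*} [AddCommGroup V] [Module ℝ V] {n : ℕ}
    (f : V →ₗ[ℝ] V [⋀^Fin n]→ₗ[ℝ] ℝ) :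
    MultilinearMap.alternatization
      (LinearMap.uncurryLeft (M := fun _ : Fin (n + 1) => V)
        (AlternatingMap.toMultilinearMapLM (S := ℝ) ∘ₗ f)) =
      (n.factorial : ℝ) • AlternatingMap.alternatizeUncurryFin f := by
  set m := LinearMap.uncurryLeft (M := fun _ : Fin (n + 1) => V)
        (AlternatingMap.toMultilinearMapLM (S := ℝ) ∘ₗ f) with hm
  set g := AlternatingMap.alternatizeUncurryFin f with hg
  -- The alternatization of `g` is computed in two ways: `g` is alternating already, which gives the
  -- factor $(n+1)!$, and `g` is a signed sum of $n+1$ rearrangements of `m`, each with the same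
  -- alternatization.
  have h1 : MultilinearMap.alternatization g.toMultilinearMap = ((n + 1).factorial : ℕ) • g := by
    have := AlternatingMap.coe_alternatization g
    rwa [Fintype.card_fin] at this
  have h2 : MultilinearMap.alternatization g.toMultilinearMap =
      (n + 1) • MultilinearMap.alternatization m := by
    ext v
    rw [AlternatingMap.smul_apply, MultilinearMap.alternatization_apply,
      MultilinearMap.alternatization_apply]
    -- Bringing the argument with index `p` to the front is the cycle `p.cycleRange.symm`, whose
    -- sign is $(-1)^p$.
    have h3 : ∀ σ : Equiv.Perm (Fin (n + 1)),
        (g.toMultilinearMap.domDomCongr σ) v = ∑ p : Fin (n + 1), ((-1) ^ (p : ℕ) : ℝ) *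
          (m.domDomCongr (σ * p.cycleRange.symm)) v := by
      intro σ
      change g (fun i => v (σ i)) = _
      rw [hg, AlternatingMap.alternatizeUncurryFin_apply]
      refine Finset.sum_congr rfl fun p _ => ?_
      rw [zsmul_eq_mul]
      push_cast
      congr 1
      change _ = m (fun i => v (σ (p.cycleRange.symm i)))
      rw [hm, LinearMap.uncurryLeft_apply]
      simp only [Fin.tail_def, Fin.cycleRange_symm_zero, Fin.cycleRange_symm_succ]
      rfl
    simp only [h3, Finset.smul_sum]
    rw [Finset.sum_comm]
    -- Reindexing by right translation changes the sign of the permutation by $(-1)^p$, which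
    -- cancels the sign in front.
    have h4 : ∀ p : Fin (n + 1), ∑ σ : Equiv.Perm (Fin (n + 1)),
        Equiv.Perm.sign σ • (((-1) ^ (p : ℕ) : ℝ) *
          (m.domDomCongr (σ * p.cycleRange.symm)) v) =
        ∑ σ : Equiv.Perm (Fin (n + 1)), Equiv.Perm.sign σ • (m.domDomCongr σ) v := by
      intro p
      refine Fintype.sum_equiv (Equiv.mulRight p.cycleRange.symm) _ _ fun σ => ?_
      simp only [Equiv.coe_mulRight, map_mul, Equiv.Perm.sign_symm, Fin.sign_cycleRange,
        Units.smul_def, zsmul_eq_mul]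
      push_cast
      ring
    simp only [h4, Finset.sum_const, Finset.card_univ, Fintype.card_fin, Finset.smul_sum]
  ext v
  have h5 := congrArg (fun F => F v) (h1.symm.trans h2)
  simp only [AlternatingMap.smul_apply, nsmul_eq_mul, Nat.factorial_succ] at h5
  push_cast at h5
  have h6 : (n : ℝ) + 1 ≠ 0 := by positivity
  rw [AlternatingMap.smul_apply, smul_eq_mul]
  have h7 : ((n : ℝ) + 1) * (n.factorial * g v) = ((n : ℝ) + 1) * alternatization m v := by
    rw [← h5]; ring
  exact (mul_left_cancel₀ h6 h7).symm

end MultilinearMap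

/-! ### Linear algebra on the model space: momenta and the contracted volume form. -/

namespace Polysymplectic

/-- The momenta `q^μ_A` as the linear map `v ↦ v^A q_A` on the model fibre. -/
def momMap (n N : ℕ) :
    (Fin N → Fin (n + 1) → ℝ) →L[ℝ] FibreModel N →L[ℝ] (Fin (n + 1) → ℝ) :=
  ∑ A, (ContinuousLinearMap.smulRightL ℝ (FibreModel N) (Fin (n + 1) → ℝ)
    (EuclideanSpace.proj A)) ∘L (ContinuousLinearMap.proj A)

theorem momMap_apply {n N : ℕ} (q : Fin N → Fin (n + 1) → ℝ) (v : FibreModel N) :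
    momMap n N q v = ∑ A, v A • q A := by
  simp [momMap]

theorem momMap_single {n N : ℕ} (q : Fin N → Fin (n + 1) → ℝ) (A : Fin N) :
    momMap n N q (EuclideanSpace.single A 1) = q A := by
  simp [momMap_apply, ite_smul]

/-- The momenta of a linear map on the model fibre. -/
def momOf {n N : ℕ} (L : FibreModel N →L[ℝ] (Fin (n + 1) → ℝ)) : Fin N → Fin (n + 1) → ℝ :=
  fun A => L (EuclideanSpace.single A 1)

theorem momMap_momOf {n N : ℕ} (L : FibreModel N →L[ℝ] (Fin (n + 1) → ℝ)) :
    momMap n N (momOf L) = L := by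
  ext v : 1
  have hv : v = ∑ A, v A • (EuclideanSpace.single A 1 : FibreModel N) := by
    ext B; simp [Pi.single_apply]
  conv_rhs => rw [hv]
  rw [momMap_apply, map_sum]
  exact Finset.sum_congr rfl fun A _ => (map_smul _ _ _).symm

theorem momMap_injective {n N : ℕ} : Function.Injective (momMap n N) := fun q q' h => by
  ext1 A
  rw [← momMap_single q, h, momMap_single]

/-- The base coordinates of a vector of the model phase space. -/
def baseCoord (n N : ℕ) : PhaseModel n N →L[ℝ] (Fin (n + 1) → ℝ) :=
  (EuclideanSpace.equiv (Fin (n + 1)) ℝ).toContinuousLinearMap ∘L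
    (ContinuousLinearMap.fst ℝ (BaseModel n) (FibreModel N)) ∘L (ContinuousLinearMap.fst ℝ _ _)

theorem baseCoord_apply {n N : ℕ} (w : PhaseModel n N) (μ : Fin (n + 1)) :
    baseCoord n N w μ = w.1.1 μ := rfl

/-- The contraction `a ⌟ dⁿ⁺¹x` of the coordinate volume form, as a form on the model phase
space. -/
def volContractAux {n N : ℕ} (a : Fin (n + 1) → ℝ) : PhaseModel n N [⋀^Fin n]→ₗ[ℝ] ℝ :=
  ((Matrix.detRowAlternating (R := ℝ) (n := Fin (n + 1))).curryLeft a).compLinearMap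
    (baseCoord n N).toLinearMap

/-- The contraction `a ⌟ dⁿ⁺¹x` of the coordinate volume form, depending linearly on `a`. -/
def volContract (n N : ℕ) : (Fin (n + 1) → ℝ) →L[ℝ] PhaseModel n N [⋀^Fin n]→L[ℝ] ℝ :=
  LinearMap.toContinuousLinearMap
    { toFun := fun a =>
        { volContractAux a with
          cont := continuous_multilinear (n := n) (N := N) (volContractAux a).toMultilinearMap }
      map_add' := fun a b => by
        ext w
        exact congrArg (fun F => F (fun i => baseCoord n N (w i)))
          ((Matrix.detRowAlternating (R := ℝ) (n := Fin (n + 1))).curryLeft.map_add a b)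
      map_smul' := fun t a => by
        ext w
        exact congrArg (fun F => F (fun i => baseCoord n N (w i)))
          ((Matrix.detRowAlternating (R := ℝ) (n := Fin (n + 1))).curryLeft.map_smul t a) }

theorem volContract_apply {n N : ℕ} (a : Fin (n + 1) → ℝ) (w : Fin n → PhaseModel n N) :
    volContract n N a w = Matrix.det (Matrix.of (Matrix.vecCons a fun i => baseCoord n N (w i))) :=
  rfl

theorem volContract_eq_zero {n N : ℕ} (a : Fin (n + 1) → ℝ) (w : Fin n → PhaseModel n N)
    (i : Fin n) (h : (w i).1.1 = 0) : volContract n N a w = 0 := by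
  have h0 : baseCoord n N (w i) = 0 := by
    ext μ
    rw [baseCoord_apply, h]
    rfl
  rw [volContract_apply]
  refine Matrix.det_eq_zero_of_row_eq_zero i.succ fun μ => ?_
  exact congrFun h0 μ

/-- Only the $dx$-components of the arguments enter. This is why neither the adapted frame nor its
coframe alters a horizontal form. -/
theorem volContract_congr {n N : ℕ} (a : Fin (n + 1) → ℝ) {w w' : Fin n → PhaseModel n N}
    (h : ∀ i, (w i).1.1 = (w' i).1.1) : volContract n N a w = volContract n N a w' := by
  have h0 : ∀ i, baseCoord n N (w i) = baseCoord n N (w' i) := fun i => by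
    ext μ
    rw [baseCoord_apply, h]
    rfl
  simp only [volContract_apply, h0]

/-- Of the alternating sum only the term that feeds `v` to `B` survives: in the others `v` remains
an argument of a horizontal form, which kills vectors without base component. -/
theorem alternatize_volContract_cons {n N : ℕ} (B : PhaseModel n N →L[ℝ] (Fin (n + 1) → ℝ))
    {v : PhaseModel n N} (hv : v.1.1 = 0) (w : Fin n → PhaseModel n N) :
    ContinuousAlternatingMap.alternatizeUncurryFin (volContract n N ∘L B) (Matrix.vecCons v w) =
      volContract n N (B v) w := by
  rw [ContinuousAlternatingMap.alternatizeUncurryFin_apply, Fin.sum_univ_succ]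
  rw [Finset.sum_eq_zero, add_zero]
  · simp
  · intro i _
    have : volContract n N (B (Matrix.vecCons v w i.succ))
        (i.succ.removeNth (Matrix.vecCons v w)) = 0 := by
      have hn : 0 < n := i.pos
      -- Removing an entry of index `i.succ` leaves `v` in position $0$.
      refine volContract_eq_zero _ _ ⟨0, hn⟩ ?_
      have : i.succ.succAbove ⟨0, hn⟩ = 0 := by
        rw [Fin.succAbove_of_castSucc_lt]
        · rfl
        · exact Fin.succ_pos i
      rw [Fin.removeNth_apply, this]
      exact hv
    change _ • volContract n N (B (Matrix.vecCons v w i.succ))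
        (i.succ.removeNth (Matrix.vecCons v w)) = 0
    rw [this, smul_zero]

end Polysymplectic

/-! ### Vector fields and their chart representatives. -/

namespace Polysymplectic

section FieldRep

variable {Zm : Type*} [NormedAddCommGroup Zm] [NormedSpace ℝ Zm]

theorem mlieBracket_vectorSpace (V W : ∀ z : Zm, TangentSpace 𝓘(ℝ, Zm) z) :
    VectorField.mlieBracket 𝓘(ℝ, Zm) V W = VectorField.lieBracket ℝ (E := Zm) V W := by
  ext1 z
  have h := VectorField.mlieBracketWithin_eq_lieBracketWithin (V := V) (W := W) (s := Set.univ)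
  rw [VectorField.mlieBracketWithin_univ] at h
  exact (congrFun h z).trans
    (congrFun (VectorField.lieBracketWithin_univ (𝕜 := ℝ) (E := Zm) (V := V) (W := W)) z)

variable {Z : Type*} [TopologicalSpace Z] [ChartedSpace Zm Z]

theorem mdifferentiable_of_mem_maximalAtlas {φ : OpenPartialHomeomorph Z Zm}
    (hφ : φ ∈ IsManifold.maximalAtlas 𝓘(ℝ, Zm) ∞ Z) : φ.MDifferentiable 𝓘(ℝ, Zm) 𝓘(ℝ, Zm) :=
  ⟨(contMDiffOn_of_mem_maximalAtlas hφ).mdifferentiableOn (by simp),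
    (contMDiffOn_symm_of_mem_maximalAtlas hφ).mdifferentiableOn (by simp)⟩

variable {φ : OpenPartialHomeomorph Z Zm}
  (hφ : φ ∈ IsManifold.maximalAtlas 𝓘(ℝ, Zm) ∞ Z)

/-- The components of a vector field in a chart. -/
def fieldRep (φ : OpenPartialHomeomorph Z Zm) (X : ∀ z : Z, TangentSpace 𝓘(ℝ, Zm) z) (z : Zm) :
    Zm :=
  mfderiv 𝓘(ℝ, Zm) 𝓘(ℝ, Zm) φ (φ.symm z) (X (φ.symm z))

include hφ

theorem mfderiv_chart_symm {z : Zm} (hz : z ∈ φ.target) (w : Zm) :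
    mfderiv 𝓘(ℝ, Zm) 𝓘(ℝ, Zm) φ (φ.symm z) (mfderiv 𝓘(ℝ, Zm) 𝓘(ℝ, Zm) φ.symm z w) = w :=
  congrArg (fun L => L w) ((mdifferentiable_of_mem_maximalAtlas hφ).comp_symm_deriv hz)

theorem mfderiv_symm_chart' {x : Z} (hx : x ∈ φ.source) (w : TangentSpace 𝓘(ℝ, Zm) x) :
    mfderiv 𝓘(ℝ, Zm) 𝓘(ℝ, Zm) φ.symm (φ x) (mfderiv 𝓘(ℝ, Zm) 𝓘(ℝ, Zm) φ x w) = w :=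
  congrArg (fun L => L w) ((mdifferentiable_of_mem_maximalAtlas hφ).symm_comp_deriv hx)

theorem mfderiv_symm_chart {z : Zm} (hz : z ∈ φ.target)
    (w : TangentSpace 𝓘(ℝ, Zm) (φ.symm z)) :
    mfderiv 𝓘(ℝ, Zm) 𝓘(ℝ, Zm) φ.symm z (mfderiv 𝓘(ℝ, Zm) 𝓘(ℝ, Zm) φ (φ.symm z) w) = w := by
  have h := mfderiv_symm_chart' hφ (φ.map_target hz) w
  -- The points `φ (φ.symm z)` and `z` are equal only propositionally, while the derivative's type
  -- depends on the point. Quantifying over a point equal to `z` lets the equation be substituted;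
  -- the same device recurs below.
  have key : ∀ z', z' = z → mfderiv 𝓘(ℝ, Zm) 𝓘(ℝ, Zm) φ.symm z'
      (mfderiv 𝓘(ℝ, Zm) 𝓘(ℝ, Zm) φ (φ.symm z) w : Zm) = (w : Zm) →
      mfderiv 𝓘(ℝ, Zm) 𝓘(ℝ, Zm) φ.symm z
      (mfderiv 𝓘(ℝ, Zm) 𝓘(ℝ, Zm) φ (φ.symm z) w : Zm) = (w : Zm) := by
    rintro _ rfl h
    exact h
  exact key _ (φ.right_inv hz) h

theorem isInvertible_mfderiv_symm {z : Zm} (hz : z ∈ φ.target) :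
    (mfderiv 𝓘(ℝ, Zm) 𝓘(ℝ, Zm) φ.symm z).IsInvertible :=
  ⟨(mdifferentiable_of_mem_maximalAtlas hφ).symm.mfderiv hz, rfl⟩

theorem isInvertible_mfderiv_chart {x : Z} (hx : x ∈ φ.source) :
    (mfderiv 𝓘(ℝ, Zm) 𝓘(ℝ, Zm) φ x).IsInvertible :=
  ⟨(mdifferentiable_of_mem_maximalAtlas hφ).mfderiv hx, rfl⟩

/-- The inverse of the derivative of `φ.symm` is the derivative of `φ`. Identifying the
representative with a pullback makes smoothness and naturality of the Lie bracket available from the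
theory of pulled-back fields. -/
theorem mpullback_symm_eq_fieldRep (X : ∀ z : Z, TangentSpace 𝓘(ℝ, Zm) z) {z : Zm}
    (hz : z ∈ φ.target) :
    VectorField.mpullback 𝓘(ℝ, Zm) 𝓘(ℝ, Zm) φ.symm X z = fieldRep φ X z := by
  rw [VectorField.mpullback_apply]
  have h := mfderiv_symm_chart hφ hz (X (φ.symm z))
  conv_lhs => rw [← h]
  exact (isInvertible_mfderiv_symm hφ hz).inverse_apply_self _

variable [IsManifold 𝓘(ℝ, Zm) ∞ Z]

theorem contDiffOn_fieldRep {X : ∀ z : Z, TangentSpace 𝓘(ℝ, Zm) z} (hX : IsSmoothField Zm X)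
    [CompleteSpace Zm] : ContDiffOn ℝ ∞ (fieldRep φ X) φ.target := by
  intro z hz
  have h := ContMDiffAt.mpullback_vectorField_preimage (f := φ.symm) (x₀ := z) (m := ∞) (n := ∞)
    (hX (φ.symm z))
    ((contMDiffOn_symm_of_mem_maximalAtlas hφ).contMDiffAt (φ.open_target.mem_nhds hz))
    (isInvertible_mfderiv_symm hφ hz) (by simp)
  have h2 := contMDiffAt_vectorSpace_iff_contDiffAt.1 h
  refine (h2.congr_of_eventuallyEq ?_).contDiffWithinAt
  filter_upwards [φ.open_target.mem_nhds hz] with y hy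
  exact (mpullback_symm_eq_fieldRep hφ X hy).symm

/-- Near `x` the field is the pullback along `φ` of its own representative, and pullback along a
chart preserves smoothness. -/
theorem contMDiffAt_of_fieldRep {X : ∀ z : Z, TangentSpace 𝓘(ℝ, Zm) z} [CompleteSpace Zm]
    {x : Z} (hx : x ∈ φ.source) (h : ContDiffOn ℝ ∞ (fieldRep φ X) φ.target) :
    ContMDiffAt 𝓘(ℝ, Zm) 𝓘(ℝ, Zm).tangent ∞
      (fun z => (⟨z, X z⟩ : TangentBundle 𝓘(ℝ, Zm) Z)) x := by
  have h1 : ContDiffAt ℝ ∞ (fieldRep φ X) (φ x) :=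
    h.contDiffAt (φ.open_target.mem_nhds (φ.map_source hx))
  have h2 := ContMDiffAt.mpullback_vectorField_preimage (f := φ) (x₀ := x) (m := ∞) (n := ∞)
    (contMDiffAt_vectorSpace_iff_contDiffAt.2 h1)
    ((contMDiffOn_of_mem_maximalAtlas hφ).contMDiffAt (φ.open_source.mem_nhds hx))
    (isInvertible_mfderiv_chart hφ hx) (by simp)
  refine h2.congr_of_eventuallyEq ?_
  filter_upwards [φ.open_source.mem_nhds hx] with y hy
  have h3 : VectorField.mpullback 𝓘(ℝ, Zm) 𝓘(ℝ, Zm) φ (fieldRep φ X) y = X y := by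
    have h4 : ∀ y', y' = y → (mfderiv 𝓘(ℝ, Zm) 𝓘(ℝ, Zm) φ y' (X y') : Zm) =
        mfderiv 𝓘(ℝ, Zm) 𝓘(ℝ, Zm) φ y (X y) := by
      rintro _ rfl
      rfl
    have h5 : fieldRep φ X (φ y) = mfderiv 𝓘(ℝ, Zm) 𝓘(ℝ, Zm) φ y (X y) := h4 _ (φ.left_inv hy)
    refine Eq.trans (congrArg (mfderiv 𝓘(ℝ, Zm) 𝓘(ℝ, Zm) φ y).inverse h5) ?_
    exact (isInvertible_mfderiv_chart hφ hy).inverse_apply_self _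
  simp only [h3]

/-- Naturality of the Lie bracket under the pullback along `φ.symm`, combined with locality of the
bracket: the representatives agree with the pullbacks only on the chart's target. -/
theorem fieldRep_mlieBracket [CompleteSpace Zm] {X Y : ∀ z : Z, TangentSpace 𝓘(ℝ, Zm) z}
    (hX : IsSmoothField Zm X) (hY : IsSmoothField Zm Y) {z : Zm} (hz : z ∈ φ.target) :
    fieldRep φ (VectorField.mlieBracket 𝓘(ℝ, Zm) X Y) z =
      VectorField.lieBracket ℝ (fieldRep φ X) (fieldRep φ Y) z := by
  have : IsManifold 𝓘(ℝ, Zm) (minSmoothness ℝ 3) Z :=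
    IsManifold.of_le (n := ∞) (by
      rw [minSmoothness_of_isRCLikeNormedField]
      exact WithTop.coe_le_coe.2 (le_top (a := (3 : ℕ∞))))
  have h := VectorField.mpullback_mlieBracket (n := ∞) ((hX _).mdifferentiableAt (by simp))
      ((hY _).mdifferentiableAt (by simp))
      ((contMDiffOn_symm_of_mem_maximalAtlas hφ).contMDiffAt (φ.open_target.mem_nhds hz))
      (by
        rw [minSmoothness_of_isRCLikeNormedField]
        exact WithTop.coe_le_coe.2 (le_top (a := (2 : ℕ∞))))
  refine (mpullback_symm_eq_fieldRep hφ _ hz).symm.trans (h.trans ?_)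
  refine Eq.trans ?_ (congrFun (mlieBracket_vectorSpace (fieldRep φ X) (fieldRep φ Y)) z)
  refine Filter.EventuallyEq.mlieBracket_vectorField_eq ?_ ?_ <;>
  · filter_upwards [φ.open_target.mem_nhds hz] with y hy
    exact mpullback_symm_eq_fieldRep hφ _ hy

end FieldRep

end Polysymplectic

/-! ### Phase space charts, and momenta as linear maps on vertical vectors. -/

namespace Polysymplectic

universe u v

variable {n N : ℕ}
variable {M : Type v} [TopologicalSpace M] [ChartedSpace (BaseModel n) M]
variable {E : Type u} [TopologicalSpace E] [ChartedSpace (TotModel n N) E]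

/-- The model fibre direction `v^A` of a vector of the model phase space. -/
def fibCoord (n N : ℕ) : PhaseModel n N →L[ℝ] FibreModel N :=
  (ContinuousLinearMap.snd ℝ (BaseModel n) (FibreModel N)) ∘L (ContinuousLinearMap.fst ℝ _ _)

theorem fibCoord_apply (w : PhaseModel n N) : fibCoord n N w = w.1.2 := rfl

namespace FibredChart

variable {π : E → M} (c : FibredChart n N π)

/-- The coordinates `Z^μ η(∂_0, …, ∂_n)` of `Z ⊗ η`. -/
def baseVal (m : M) : TangentSpace 𝓘(ℝ, BaseModel n) m ⊗[ℝ] TopForms n m →ₗ[ℝ]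
    (Fin (n + 1) → ℝ) :=
  LinearMap.pi fun μ => LinearMap.mul' ℝ ℝ ∘ₗ TensorProduct.map (c.baseCoframe m μ)
    { toFun := fun η => η (c.baseFrame m)
      map_add' := fun _ _ => rfl
      map_smul' := fun _ _ => rfl }

theorem baseVal_tmul (m : M) (Z : TangentSpace 𝓘(ℝ, BaseModel n) m) (η : TopForms n m)
    (μ : Fin (n + 1)) :
    c.baseVal m (Z ⊗ₜ[ℝ] η) μ = c.baseCoframe m μ Z * η (c.baseFrame m) := rfl

/-- The element `a^μ ∂_μ ⊗ dⁿ⁺¹x`. -/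
def ofBaseVal (m : M) : (Fin (n + 1) → ℝ) →ₗ[ℝ]
    TangentSpace 𝓘(ℝ, BaseModel n) m ⊗[ℝ] TopForms n m :=
  ∑ μ, (LinearMap.toSpanSingleton ℝ _ (c.baseFrame m μ ⊗ₜ[ℝ] c.baseVol m)) ∘ₗ LinearMap.proj μ

theorem ofBaseVal_baseVal {m : M} (hm : m ∈ c.base.source)
    (t : TangentSpace 𝓘(ℝ, BaseModel n) m ⊗[ℝ] TopForms n m) :
    c.ofBaseVal m (c.baseVal m t) = t := by
  induction t using TensorProduct.induction_on with
  | zero => simp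
  | add x y hx hy => rw [map_add, map_add, hx, hy]
  | tmul Z η =>
    have hZ := c.sum_baseFrame hm Z
    have hη := c.smul_baseVol hm η
    refine Eq.trans ?_ (congrArg₂ (fun x y => x ⊗ₜ[ℝ] y) hZ hη)
    rw [TensorProduct.sum_tmul, ofBaseVal, LinearMap.sum_apply]
    refine Finset.sum_congr rfl fun μ _ => ?_
    rw [TensorProduct.smul_tmul_smul]
    rfl

/-- The momentum coordinates `p^μ_A` of an element of the fibre over `e`. -/
def momenta (e : E) (p : PhaseFibre n N π e) : Fin N → Fin (n + 1) → ℝ :=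
  fun A μ => c.momentum e A μ p

/-- Both sides are linear in `p`, so pure tensors suffice. -/
theorem momentum_eq_baseVal (e : E) (A : Fin N) (μ : Fin (n + 1)) (p : PhaseFibre n N π e) :
    c.momentum e A μ p = c.baseVal (π e) (evalVert e p (c.vertFrame e A)) μ := by
  have h : c.momentum e A μ = LinearMap.proj μ ∘ₗ c.baseVal (π e) ∘ₗ
      (LinearMap.applyₗ (c.vertFrame e A)) ∘ₗ evalVert e := by
    refine TensorProduct.ext_threefold fun l Z η => ?_
    rw [momentum_tmul]
    change _ = c.baseVal (π e) (l (c.vertFrame e A) • (Z ⊗ₜ[ℝ] η)) μ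
    rw [map_smul, Pi.smul_apply, baseVal_tmul, smul_eq_mul, mul_assoc]
  exact congrArg (fun L => L p) h

/-- The fibre components of a vertical vector. -/
def vertCoord (e : E) (v : Vert n N π e) : FibreModel N :=
  ((mfderiv 𝓘(ℝ, TotModel n N) 𝓘(ℝ, TotModel n N) c.tot e
    (v : TangentSpace 𝓘(ℝ, TotModel n N) e) : TotModel n N)).2

variable [SmoothFibreBundle n N π]

/-- This characterises the momenta without indices: they are the matrix of the intrinsic map
$w\mapsto\lambda(w)\,Z\otimes\eta$. Transformation laws of momenta follow by comparing the
right-hand side in two charts or at two points. -/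
theorem momMap_momenta {e : E} (he : e ∈ c.tot.source) (p : PhaseFibre n N π e)
    (v : Vert n N π e) :
    momMap n N (c.momenta e p) (c.vertCoord e v) = c.baseVal (π e) (evalVert e p v) := by
  conv_rhs => rw [← c.sum_vertFrame he v]
  rw [momMap_apply, map_sum, map_sum]
  refine Finset.sum_congr rfl fun A _ => ?_
  rw [map_smul, map_smul]
  congr 1
  ext μ
  exact c.momentum_eq_baseVal e A μ p

omit [SmoothFibreBundle n N π] in
-- On a pure tensor $Z\otimes\eta$ the top form is $\eta(\partial_0,\dots,\partial_n)\,d^{n+1}x$, so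
-- the contraction is a determinant with the components of $Z$ as first row; the scalar factor is
-- absorbed in that row.
theorem contractTop_apply {m : M} (hm : m ∈ c.base.source)
    (t : TangentSpace 𝓘(ℝ, BaseModel n) m ⊗[ℝ] TopForms n m)
    (w : Fin n → TangentSpace 𝓘(ℝ, BaseModel n) m) :
    contractTop m t w = Matrix.det (Matrix.of (Matrix.vecCons (c.baseVal m t)
      fun i μ => c.baseCoframe m μ (w i))) := by
  change _ = Matrix.detRowAlternating.curryLeft (c.baseVal m t)
    (fun i μ => c.baseCoframe m μ (w i))
  induction t using TensorProduct.induction_on with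
  | zero => simp
  | add x y hx hy =>
    rw [map_add, map_add, map_add, AlternatingMap.add_apply, AlternatingMap.add_apply, hx, hy]
  | tmul Z η =>
    have h1 : contractTop m (Z ⊗ₜ[ℝ] η) w = η (Matrix.vecCons Z w) := rfl
    have h2 : c.baseVal m (Z ⊗ₜ[ℝ] η) =
        η (c.baseFrame m) • (fun μ => c.baseCoframe m μ Z) := by
      ext μ
      rw [baseVal_tmul, Pi.smul_apply, smul_eq_mul, mul_comm]
    rw [h1, h2, map_smul, AlternatingMap.smul_apply]
    conv_lhs => rw [← c.smul_baseVol hm η]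
    rw [AlternatingMap.smul_apply, baseVol_apply]
    congr 1
    change _ = Matrix.det (Matrix.of (Matrix.vecCons (fun μ => c.baseCoframe m μ Z)
      fun i μ => c.baseCoframe m μ (w i)))
    congr 1
    ext i μ
    refine Fin.cases ?_ (fun i => ?_) i <;> rfl

section Charts

variable [IsManifold 𝓘(ℝ, BaseModel n) ∞ M] [IsManifold 𝓘(ℝ, TotModel n N) ∞ E]

/-- The chart of the phase space induced by fibred coordinates. -/
def phaseChart : OpenPartialHomeomorph (Phase n N π) (PhaseModel n N) :=
  (phaseCore π).openPartialHomeomorph c.phaseEquiv ⟨c, rfl⟩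

theorem mem_phaseChart_source {p : Phase n N π} :
    p ∈ c.phaseChart.source ↔ p.pt ∈ c.tot.source := Iff.rfl

theorem phaseChart_mem_maximalAtlas :
    c.phaseChart ∈ IsManifold.maximalAtlas 𝓘(ℝ, PhaseModel n N) ∞ (Phase n N π) :=
  IsManifold.subset_maximalAtlas ⟨_, ⟨c.phaseEquiv, rfl⟩, _, ⟨⟨c, rfl⟩, rfl⟩, rfl⟩

theorem mdiff_phaseChart :
    c.phaseChart.MDifferentiable 𝓘(ℝ, PhaseModel n N) 𝓘(ℝ, PhaseModel n N) :=
  mdifferentiable_of_mem_maximalAtlas c.phaseChart_mem_maximalAtlas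

/-- In the induced charts the projection to the total space is the first projection of a product. -/
theorem hasMFDerivAt_pt {p : Phase n N π} (hp : p.pt ∈ c.tot.source) :
    HasMFDerivAt 𝓘(ℝ, PhaseModel n N) 𝓘(ℝ, TotModel n N) Phase.pt p
      ((mfderiv 𝓘(ℝ, TotModel n N) 𝓘(ℝ, TotModel n N) c.tot.symm (c.tot p.pt)) ∘L
        (ContinuousLinearMap.fst ℝ (TotModel n N) (Fin N → Fin (n + 1) → ℝ)) ∘L
        (mfderiv 𝓘(ℝ, PhaseModel n N) 𝓘(ℝ, PhaseModel n N) c.phaseChart p)) := by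
  have h1 := (c.mdiff_phaseChart.mdifferentiableAt (x := p) hp).hasMFDerivAt
  have h2 : HasMFDerivAt 𝓘(ℝ, PhaseModel n N) 𝓘(ℝ, TotModel n N)
      (Prod.fst : PhaseModel n N → TotModel n N) (c.phaseChart p)
      (ContinuousLinearMap.fst ℝ (TotModel n N) (Fin N → Fin (n + 1) → ℝ)) :=
    (ContinuousLinearMap.fst ℝ (TotModel n N)
      (Fin N → Fin (n + 1) → ℝ)).hasFDerivAt.hasMFDerivAt
  have h3 := (c.mdiff_tot.mdifferentiableAt_symm (c.tot.map_source hp)).hasMFDerivAt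
  have h4 := HasMFDerivAt.comp p (HasMFDerivAt.comp (c.phaseChart p) h3 h2) h1
  refine h4.congr_of_eventuallyEq ?_
  filter_upwards [c.phaseChart.open_source.mem_nhds hp] with q hq
  exact (c.tot.left_inv hq).symm

theorem tot_mfderiv_pt {p : Phase n N π} (hp : p.pt ∈ c.tot.source)
    (w : TangentSpace 𝓘(ℝ, PhaseModel n N) p) :
    mfderiv 𝓘(ℝ, TotModel n N) 𝓘(ℝ, TotModel n N) c.tot p.pt
      (mfderiv 𝓘(ℝ, PhaseModel n N) 𝓘(ℝ, TotModel n N) Phase.pt p w) =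
    (mfderiv 𝓘(ℝ, PhaseModel n N) 𝓘(ℝ, PhaseModel n N) c.phaseChart p w : PhaseModel n N).1 := by
  rw [(c.hasMFDerivAt_pt hp).mfderiv]
  exact c.tot_symm_mfderiv hp _

theorem mfderiv_toBase (p : Phase n N π) (w : TangentSpace 𝓘(ℝ, PhaseModel n N) p) :
    mfderiv 𝓘(ℝ, PhaseModel n N) 𝓘(ℝ, BaseModel n) Phase.toBase p w =
      mfderiv 𝓘(ℝ, TotModel n N) 𝓘(ℝ, BaseModel n) π p.pt
        (mfderiv 𝓘(ℝ, PhaseModel n N) 𝓘(ℝ, TotModel n N) Phase.pt p w) := by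
  have hc := ((fibredChartAt π p.pt : FibredChart n N π).hasMFDerivAt_pt
    (mem_fibredChartAt_source π p.pt)).mdifferentiableAt
  have hπ := SmoothFibreBundle.contMDiff (n := n) (N := N) (π := π)
  have h := mfderiv_comp p (hπ.mdifferentiable (by simp) p.pt) hc
  exact congrArg (fun L => L w) h

theorem base_mfderiv_toBase {p : Phase n N π} (hp : p.pt ∈ c.tot.source)
    (w : TangentSpace 𝓘(ℝ, PhaseModel n N) p) :
    mfderiv 𝓘(ℝ, BaseModel n) 𝓘(ℝ, BaseModel n) c.base (π p.pt)
      (mfderiv 𝓘(ℝ, PhaseModel n N) 𝓘(ℝ, BaseModel n) Phase.toBase p w) =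
    (mfderiv 𝓘(ℝ, PhaseModel n N) 𝓘(ℝ, PhaseModel n N) c.phaseChart p w : PhaseModel n N).1.1 := by
  rw [← c.tot_mfderiv_pt hp w, c.fst_mfderiv_tot hp]
  exact congrArg _ (mfderiv_toBase p w)

end Charts

end FibredChart

end Polysymplectic

/-! ### The canonical lift does not depend on the chart. -/

namespace Polysymplectic

universe u v

section Transition

variable {Zm : Type*} [NormedAddCommGroup Zm] [NormedSpace ℝ Zm]
variable {Z : Type*} [TopologicalSpace Z] [ChartedSpace Zm Z]
variable {φ ψ : OpenPartialHomeomorph Z Zm}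
  (hφ : φ ∈ IsManifold.maximalAtlas 𝓘(ℝ, Zm) ∞ Z)
  (hψ : ψ ∈ IsManifold.maximalAtlas 𝓘(ℝ, Zm) ∞ Z)

include hφ hψ

theorem mfderiv_transition {x : Z} (hx : x ∈ φ.source) (hx' : x ∈ ψ.source)
    (w : TangentSpace 𝓘(ℝ, Zm) x) :
    mfderiv 𝓘(ℝ, Zm) 𝓘(ℝ, Zm) ψ x w =
      fderiv ℝ (ψ ∘ φ.symm) (φ x) (mfderiv 𝓘(ℝ, Zm) 𝓘(ℝ, Zm) φ x w) := by
  have h2 := ((mdifferentiable_of_mem_maximalAtlas hφ).mdifferentiableAt_symm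
    (φ.map_source hx)).hasMFDerivAt
  have h1 : ∀ y, y = x → HasMFDerivAt 𝓘(ℝ, Zm) 𝓘(ℝ, Zm) ψ y
      (mfderiv 𝓘(ℝ, Zm) 𝓘(ℝ, Zm) ψ x) := by
    rintro _ rfl
    exact ((mdifferentiable_of_mem_maximalAtlas hψ).mdifferentiableAt hx').hasMFDerivAt
  have h3 := ((h1 _ (φ.left_inv hx)).comp _ h2).mfderiv
  rw [mfderiv_eq_fderiv] at h3
  have h4 := congrArg (fun L : Zm →L[ℝ] Zm => L (mfderiv 𝓘(ℝ, Zm) 𝓘(ℝ, Zm) φ x w)) h3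
  refine Eq.trans ?_ h4.symm
  exact congrArg (mfderiv 𝓘(ℝ, Zm) 𝓘(ℝ, Zm) ψ x) (mfderiv_symm_chart' hφ hx w).symm

theorem contDiffAt_transition {x : Z} (hx : x ∈ φ.source) (hx' : x ∈ ψ.source) :
    ContDiffAt ℝ ∞ (ψ ∘ φ.symm) (φ x) := by
  have h := (contMDiffOn_of_mem_contDiffGroupoid
    (IsManifold.compatible_of_mem_maximalAtlas hφ hψ)).contDiffOn
  refine h.contDiffAt ((φ.symm.trans ψ).open_source.mem_nhds ?_)
  refine ⟨φ.map_source hx, ?_⟩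
  change φ.symm (φ x) ∈ ψ.source
  rwa [φ.left_inv hx]

end Transition

theorem hasDerivAt_line {F : Type*} [NormedAddCommGroup F] [NormedSpace ℝ F] (a b : F) :
    HasDerivAt (fun s : ℝ => a + s • b) b 0 := by
  simpa using ((hasDerivAt_id (0 : ℝ)).smul_const b).const_add a

variable {n N : ℕ}

/-- The coordinate expression `X^A ∂_A - p^ν_B ∂_A X^B ∂/∂p^ν_A` of a lifted vector field. -/
def liftCoord (ξ : TotModel n N → FibreModel N) (z : PhaseModel n N) : PhaseModel n N :=
  ((0, ξ z.1), momOf (-(momMap n N z.2 ∘L fderiv ℝ ξ z.1 ∘L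
    ContinuousLinearMap.inr ℝ (BaseModel n) (FibreModel N))))

theorem momMap_liftCoord (ξ : TotModel n N → FibreModel N) (z : PhaseModel n N)
    (v : FibreModel N) :
    momMap n N (liftCoord ξ z).2 v = -momMap n N z.2 (fderiv ℝ ξ z.1 (0, v)) := by
  rw [liftCoord, momMap_momOf]
  rfl

/-- Differentiate the transport law of momenta at $s=0$ and solve for $W$. The result contains
$D^2\tau$ in the direction of $\xi$ and $D\tau$ applied to $D\xi$; by the derivative of
$\xi'\circ\tau=D\tau\,\xi$ these combine into $D\xi'$, which is what the lift of $\xi'$ requires. It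
suffices to test on images of vertical vectors, since `hvert` says that these are all of them. -/
theorem eq_liftCoord_snd_of_transport {τ : TotModel n N → TotModel n N}
    {ξ ξ' : TotModel n N → FibreModel N} {z : PhaseModel n N} (hτ : ContDiffAt ℝ ∞ τ z.1)
    (hξ : DifferentiableAt ℝ ξ z.1) (hξ' : DifferentiableAt ℝ ξ' (τ z.1))
    (hvert : ∀ u : FibreModel N, ∃ v : FibreModel N, fderiv ℝ τ z.1 (0, v) = (0, u))
    (hrel : ∀ᶠ y in 𝓝 z.1, ξ' (τ y) = (fderiv ℝ τ y (0, ξ y)).2)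
    (K : (Fin (n + 1) → ℝ) →ₗ[ℝ] (Fin (n + 1) → ℝ))
    {Q : ℝ → Fin N → Fin (n + 1) → ℝ} {W : Fin N → Fin (n + 1) → ℝ} (hQ : HasDerivAt Q W 0)
    (hmom : ∀ᶠ s : ℝ in 𝓝 0, ∀ v : FibreModel N,
      momMap n N (Q s) ((fderiv ℝ τ (z.1 + s • (0, ξ z.1)) (0, v)).2) =
        K (momMap n N (z.2 + s • (liftCoord ξ z).2) v)) :
    W = (liftCoord ξ' (τ z.1, Q 0)).2 := by
  apply momMap_injective
  ext1 u
  rw [momMap_liftCoord]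
  obtain ⟨v, hv⟩ := hvert u
  let K' : (Fin (n + 1) → ℝ) →L[ℝ] (Fin (n + 1) → ℝ) := LinearMap.toContinuousLinearMap K
  have hdτ : DifferentiableAt ℝ (fderiv ℝ τ) z.1 :=
    (hτ.fderiv_right (m := ∞) (by simp)).differentiableAt (by simp)
  have hline : HasDerivAt (fun s : ℝ => z.1 + s • ((0, ξ z.1) : TotModel n N)) (0, ξ z.1) 0 :=
    hasDerivAt_line _ _
  have h1 : HasDerivAt (fun s : ℝ => fderiv ℝ τ (z.1 + s • ((0, ξ z.1) : TotModel n N)))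
      (fderiv ℝ (fderiv ℝ τ) z.1 (0, ξ z.1)) 0 :=
    hdτ.hasFDerivAt.comp_hasDerivAt_of_eq (0 : ℝ) hline (by simp)
  have h2 : HasDerivAt
      (fun s : ℝ => (fderiv ℝ τ (z.1 + s • ((0, ξ z.1) : TotModel n N)) (0, v)).2)
      (fderiv ℝ (fderiv ℝ τ) z.1 (0, ξ z.1) (0, v)).2 0 := by
    have := (((ContinuousLinearMap.snd ℝ (BaseModel n) (FibreModel N)) ∘L
      (ContinuousLinearMap.apply ℝ (TotModel n N)
        ((0, v) : TotModel n N))).hasFDerivAt).comp_hasDerivAt (0 : ℝ) h1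
    exact this
  have h3 : HasDerivAt (fun s => momMap n N (Q s)) (momMap n N W) 0 :=
    (momMap n N).hasFDerivAt.comp_hasDerivAt (0 : ℝ) hQ
  have h4 := h3.clm_apply h2
  have h5 : HasDerivAt (fun s : ℝ => K (momMap n N (z.2 + s • (liftCoord ξ z).2) v))
      (K (momMap n N (liftCoord ξ z).2 v)) 0 := by
    have h6 : HasDerivAt (fun s : ℝ => z.2 + s • (liftCoord ξ z).2) (liftCoord ξ z).2 0 :=
      hasDerivAt_line _ _
    have := ((K' ∘L (ContinuousLinearMap.apply ℝ (Fin (n + 1) → ℝ) v) ∘L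
      momMap n N).hasFDerivAt).comp_hasDerivAt (0 : ℝ) h6
    exact this
  -- The two derivatives at $s=0$ of the transport law; `h8` below is the law itself at $s=0$, used
  -- to eliminate `K`.
  have h7 := h4.unique (h5.congr_of_eventuallyEq (by
    filter_upwards [hmom] with s hs using hs v))
  have h8 := hmom.self_of_nhds
  simp only [zero_smul, add_zero] at h7 h8
  rw [momMap_liftCoord, map_neg, ← h8, hv] at h7
  have h9 : fderiv ℝ ξ' (τ z.1) (0, u) =
      (fderiv ℝ (fderiv ℝ τ) z.1 (0, v) (0, ξ z.1)).2 +
        (fderiv ℝ τ z.1 (0, fderiv ℝ ξ z.1 (0, v))).2 := by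
    have h10 : HasFDerivAt (fun y => ξ' (τ y))
        (fderiv ℝ ξ' (τ z.1) ∘L fderiv ℝ τ z.1) z.1 :=
      hξ'.hasFDerivAt.comp z.1 (hτ.differentiableAt (by simp)).hasFDerivAt
    have h11 := hdτ.hasFDerivAt.clm_apply
      (((ContinuousLinearMap.inr ℝ (BaseModel n) (FibreModel N)).hasFDerivAt).comp z.1
        hξ.hasFDerivAt)
    have h12 := (ContinuousLinearMap.snd ℝ (BaseModel n) (FibreModel N)).hasFDerivAt.comp z.1 h11
    have h13 := h10.unique (h12.congr_of_eventuallyEq hrel)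
    have h14 := congrArg (fun L : TotModel n N →L[ℝ] FibreModel N => L (0, v)) h13
    rw [ContinuousLinearMap.comp_apply, hv] at h14
    refine h14.trans ?_
    exact add_comm (fderiv ℝ τ z.1 (0, fderiv ℝ ξ z.1 (0, v))).2
      (fderiv ℝ (fderiv ℝ τ) z.1 (0, v) (0, ξ z.1)).2
  -- The transport law is differentiated along $\xi$, the law for $\xi'$ along $v$; symmetry of
  -- $D^2\tau$ reconciles the two orders.
  have hsymm : fderiv ℝ (fderiv ℝ τ) z.1 (0, v) (0, ξ z.1) =
      fderiv ℝ (fderiv ℝ τ) z.1 (0, ξ z.1) (0, v) :=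
    (hτ.isSymmSndFDerivAt (by
      rw [minSmoothness_of_isRCLikeNormedField]
      exact WithTop.coe_le_coe.2 (le_top (a := (2 : ℕ∞))))).eq _ _
  rw [h9, hsymm, map_add, neg_add, ← h7]
  abel

variable {M : Type v} [TopologicalSpace M] [ChartedSpace (BaseModel n) M]
variable {E : Type u} [TopologicalSpace E] [ChartedSpace (TotModel n N) E]
variable {π : E → M} [SmoothFibreBundle n N π]

namespace FibredChart

variable (c : FibredChart n N π)

theorem mem_vert_iff {e : E} (he : e ∈ c.tot.source) (w : TangentSpace 𝓘(ℝ, TotModel n N) e) :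
    w ∈ Vert n N π e ↔
      ((mfderiv 𝓘(ℝ, TotModel n N) 𝓘(ℝ, TotModel n N) c.tot e w : TotModel n N)).1 = 0 := by
  rw [c.fst_mfderiv_tot he]
  constructor
  · intro h
    exact (congrArg (mfderiv 𝓘(ℝ, BaseModel n) 𝓘(ℝ, BaseModel n) c.base (π e))
      (LinearMap.mem_ker.1 h)).trans (map_zero _)
  · intro h
    have h2 := congrArg (fun w => mfderiv 𝓘(ℝ, BaseModel n) 𝓘(ℝ, BaseModel n) c.base.symm
      (c.base (π e)) w) h
    have h3 := (h2.symm.trans (c.symm_base_mfderiv (c.mapsTo e he) _)).symm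
    exact LinearMap.mem_ker.2 (h3.trans (map_zero _))

theorem tot_mfderiv_eq_vertCoord {e : E} (he : e ∈ c.tot.source) (w : Vert n N π e) :
    (mfderiv 𝓘(ℝ, TotModel n N) 𝓘(ℝ, TotModel n N) c.tot e
      (w : TangentSpace 𝓘(ℝ, TotModel n N) e) : TotModel n N) = (0, c.vertCoord e w) :=
  Prod.ext ((c.mem_vert_iff he _).1 w.2) rfl

theorem exists_vertCoord_eq {e : E} (he : e ∈ c.tot.source) (v : FibreModel N) :
    ∃ w : Vert n N π e, c.vertCoord e w = v := by
  have h := c.tot_symm_mfderiv he ((0, v) : TotModel n N)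
  exact ⟨⟨_, (c.mem_vert_iff he _).2 (congrArg Prod.fst h)⟩, congrArg Prod.snd h⟩

theorem fderiv_transition_vertCoord (c' : FibredChart n N π) {e : E} (he : e ∈ c.tot.source)
    (he' : e ∈ c'.tot.source) (w : Vert n N π e) :
    fderiv ℝ (c'.tot ∘ c.tot.symm) (c.tot e) (0, c.vertCoord e w) = (0, c'.vertCoord e w) := by
  rw [← c.tot_mfderiv_eq_vertCoord he, ← c'.tot_mfderiv_eq_vertCoord he']
  exact (mfderiv_transition c.tot_mem c'.tot_mem he he' _).symm

/-- The intrinsic map is the same in both charts: its arguments change by the vertical Jacobian, its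
values by a linear map that depends on the base point alone. -/
theorem momMap_momenta_transition (c' : FibredChart n N π) {e : E} (he : e ∈ c.tot.source)
    (he' : e ∈ c'.tot.source) (p : PhaseFibre n N π e) (v : FibreModel N) :
    momMap n N (c'.momenta e p)
      ((fderiv ℝ (c'.tot ∘ c.tot.symm) (c.tot e) (0, v)).2) =
      (c'.baseVal (π e) ∘ₗ c.ofBaseVal (π e)) (momMap n N (c.momenta e p) v) := by
  obtain ⟨w, rfl⟩ := c.exists_vertCoord_eq he v
  rw [c.fderiv_transition_vertCoord c' he he', c.momMap_momenta he, LinearMap.comp_apply,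
    c.ofBaseVal_baseVal (c.mapsTo e he)]
  exact c'.momMap_momenta he' p w

variable [IsManifold 𝓘(ℝ, BaseModel n) ∞ M] [IsManifold 𝓘(ℝ, TotModel n N) ∞ E]

variable {X : ∀ e : E, TangentSpace 𝓘(ℝ, TotModel n N) e}

omit [IsManifold 𝓘(ℝ, BaseModel n) ∞ M] in
theorem fieldRep_tot (hX : IsVerticalField π X) {y : TotModel n N} (hy : y ∈ c.tot.target) :
    fieldRep c.tot X y = (0, c.vertComp X y) :=
  Prod.ext ((c.mem_vert_iff (c.tot.map_target hy) _).1 (hX.vertical _)) rfl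

omit [IsManifold 𝓘(ℝ, BaseModel n) ∞ M] [SmoothFibreBundle n N π] in
theorem contDiffOn_vertComp (hX : IsVerticalField π X) :
    ContDiffOn ℝ ∞ (c.vertComp X) c.tot.target :=
  (contDiffOn_fieldRep c.tot_mem hX.smooth).snd

omit [IsManifold 𝓘(ℝ, BaseModel n) ∞ M] in
theorem vertComp_transition (hX : IsVerticalField π X) (c' : FibredChart n N π)
    {y : TotModel n N} (hy : y ∈ c.tot.target) (hy' : c.tot.symm y ∈ c'.tot.source) :
    c'.vertComp X ((c'.tot ∘ c.tot.symm) y) =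
      (fderiv ℝ (c'.tot ∘ c.tot.symm) y (0, c.vertComp X y)).2 := by
  have he := c.tot.map_target hy
  let w : Vert n N π (c.tot.symm y) := ⟨X (c.tot.symm y), hX.vertical _⟩
  have h := c.fderiv_transition_vertCoord c' he hy' w
  rw [c.tot.right_inv hy] at h
  have h2 : c'.vertComp X ((c'.tot ∘ c.tot.symm) y) = c'.vertCoord _ w := by
    have key : ∀ e, e = c.tot.symm y → ((mfderiv 𝓘(ℝ, TotModel n N) 𝓘(ℝ, TotModel n N) c'.tot e
        (X e) : TotModel n N)).2 = c'.vertCoord _ w := by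
      rintro _ rfl
      rfl
    exact key _ (c'.tot.left_inv hy')
  rw [h2]
  exact (congrArg Prod.snd h).symm

/-- The transition map is differentiated along the straight line $z+sV$, with $V$ the lift in the
first chart. As $V$ has no base component, the line stays over one base point, so the change of
values in the momentum law is constant in $s$ and `eq_liftCoord_snd_of_transport` applies. -/
theorem fderiv_phase_transition_liftCoord (hX : IsVerticalField π X) (c' : FibredChart n N π)
    {p : Phase n N π} (hp : p.pt ∈ c.tot.source) (hp' : p.pt ∈ c'.tot.source) :
    fderiv ℝ (c'.phaseChart ∘ c.phaseChart.symm) (c.phaseChart p)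
      (liftCoord (c.vertComp X) (c.phaseChart p)) =
      liftCoord (c'.vertComp X) (c'.phaseChart p) := by
  set z := c.phaseChart p with hz
  set ξ := c.vertComp X with hξ
  set T := c'.phaseChart ∘ c.phaseChart.symm with hT
  set τ := c'.tot ∘ c.tot.symm with hτ
  set V := liftCoord ξ z with hV
  have hzt : z ∈ c.phaseChart.target := c.phaseChart.map_source hp
  have hpz : c.phaseChart.symm z = p := c.phaseChart.left_inv hp
  have hTd : ContDiffAt ℝ ∞ T z :=
    contDiffAt_transition c.phaseChart_mem_maximalAtlas c'.phaseChart_mem_maximalAtlas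
      (x := p) hp hp'
  have hτd : ContDiffAt ℝ ∞ τ z.1 :=
    contDiffAt_transition c.tot_mem c'.tot_mem hp hp'
  have hez : c.tot.symm z.1 = p.pt := c.tot.left_inv hp
  have hS : (c.tot.symm.trans c'.tot).source ∈ 𝓝 z.1 := by
    refine (c.tot.symm.trans c'.tot).open_source.mem_nhds ⟨hzt, ?_⟩
    change c.tot.symm z.1 ∈ c'.tot.source
    rwa [hez]
  have hτz : τ z.1 = (c'.phaseChart p).1 := congrArg c'.tot hez
  have hT0 : T z = c'.phaseChart p := congrArg c'.phaseChart hpz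
  have hline : HasDerivAt (fun s : ℝ => z + s • V) V 0 := hasDerivAt_line _ _
  have hcurve : HasDerivAt (fun s : ℝ => T (z + s • V)) (fderiv ℝ T z V) 0 :=
    (hTd.differentiableAt (by simp)).hasFDerivAt.comp_hasDerivAt_of_eq (0 : ℝ) hline (by simp)
  have hcont : Filter.Tendsto (fun s : ℝ => (z + s • V).1) (𝓝 0) (𝓝 z.1) := by
    have h : Continuous fun s : ℝ => (z + s • V).1 := by fun_prop
    simpa using h.tendsto 0
  have hvert : ∀ u : FibreModel N, ∃ v : FibreModel N, fderiv ℝ τ z.1 (0, v) = (0, u) := by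
    intro u
    obtain ⟨w, rfl⟩ := c'.exists_vertCoord_eq hp' u
    exact ⟨c.vertCoord _ w, c.fderiv_transition_vertCoord c' hp hp' w⟩
  have hξd : DifferentiableAt ℝ ξ z.1 :=
    ((c.contDiffOn_vertComp hX).contDiffAt (c.tot.open_target.mem_nhds hzt)).differentiableAt
      (by simp)
  have hξd' : DifferentiableAt ℝ (c'.vertComp X) (τ z.1) := by
    rw [hτz]
    exact ((c'.contDiffOn_vertComp hX).contDiffAt
      (c'.tot.open_target.mem_nhds (c'.tot.map_source hp'))).differentiableAt (by simp)
  have hrel : ∀ᶠ y in 𝓝 z.1, c'.vertComp X (τ y) = (fderiv ℝ τ y (0, ξ y)).2 := by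
    filter_upwards [hS] with y hy
    exact c.vertComp_transition hX c' hy.1 hy.2
  have hfst : (fderiv ℝ T z V).1 = (0, c'.vertComp X (c'.phaseChart p).1) := by
    have h1 : HasDerivAt (fun s : ℝ => (T (z + s • V)).1) (fderiv ℝ T z V).1 0 :=
      (ContinuousLinearMap.fst ℝ (TotModel n N)
        (Fin N → Fin (n + 1) → ℝ)).hasFDerivAt.comp_hasDerivAt (0 : ℝ) hcurve
    have h2 : HasDerivAt (fun s : ℝ => (z + s • V).1) V.1 0 :=
      (ContinuousLinearMap.fst ℝ (TotModel n N)
        (Fin N → Fin (n + 1) → ℝ)).hasFDerivAt.comp_hasDerivAt (0 : ℝ) hline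
    have h3 : HasDerivAt (fun s : ℝ => τ (z + s • V).1) (fderiv ℝ τ z.1 V.1) 0 :=
      (hτd.differentiableAt (by simp)).hasFDerivAt.comp_hasDerivAt_of_eq (0 : ℝ) h2 (by simp)
    have h4 : (fderiv ℝ T z V).1 = fderiv ℝ τ z.1 V.1 := h1.unique h3
    let w : Vert n N π p.pt := ⟨X p.pt, hX.vertical _⟩
    have key : ∀ (c : FibredChart n N π), p.pt ∈ c.tot.source →
        c.vertComp X (c.tot p.pt) = c.vertCoord _ w := by
      intro c hp
      have key : ∀ e, e = p.pt → ((mfderiv 𝓘(ℝ, TotModel n N) 𝓘(ℝ, TotModel n N) c.tot e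
          (X e) : TotModel n N)).2 = c.vertCoord _ w := by
        rintro _ rfl
        rfl
      exact key _ (c.tot.left_inv hp)
    have h5 := c.fderiv_transition_vertCoord c' hp hp' w
    rw [← key c hp, ← key c' hp'] at h5
    rw [h4]
    exact h5
  have hsnd : HasDerivAt (fun s : ℝ => (T (z + s • V)).2) (fderiv ℝ T z V).2 0 :=
    (ContinuousLinearMap.snd ℝ (TotModel n N)
      (Fin N → Fin (n + 1) → ℝ)).hasFDerivAt.comp_hasDerivAt (0 : ℝ) hcurve
  have hmain := eq_liftCoord_snd_of_transport hτd hξd hξd' hvert hrel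
    (c'.baseVal (π p.pt) ∘ₗ c.ofBaseVal (π p.pt)) hsnd (by
      filter_upwards [hcont hS] with s hs v
      have hs' : z + s • V ∈ c.phaseChart.target := hs.1
      have he : (c.phaseChart.symm (z + s • V)).pt ∈ c.tot.source := c.tot.map_target hs.1
      have h1 := c.momMap_momenta_transition c' he hs.2
        (c.phaseChart.symm (z + s • V)).mom v
      have h2 : c.tot (c.phaseChart.symm (z + s • V)).pt = (z + s • V).1 :=
        congrArg Prod.fst (c.phaseChart.right_inv hs')
      have h2' : c.momenta _ (c.phaseChart.symm (z + s • V)).mom = (z + s • V).2 :=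
        congrArg Prod.snd (c.phaseChart.right_inv hs')
      -- Equal base coordinates, by injectivity of the base chart: this fixes `K` along the line.
      have hbase : π (c.phaseChart.symm (z + s • V)).pt = π p.pt := by
        have h3 := c.fst_tot _ he
        have h4 := c.fst_tot _ hp
        rw [h2] at h3
        have h5 : (z + s • V).1.1 = z.1.1 := by
          simp [hV, liftCoord]
        apply c.base.injOn (c.mapsTo _ he) (c.mapsTo _ hp)
        rw [← h3, ← h4, h5]
        rfl
      rw [h2, h2', hbase] at h1
      exact h1)
  refine Prod.ext hfst ?_
  rw [hmain]
  simp only [zero_smul, add_zero, hT0, hτz]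

end FibredChart

variable [IsManifold 𝓘(ℝ, BaseModel n) ∞ M] [IsManifold 𝓘(ℝ, TotModel n N) ∞ E]

theorem lift_apply (X : ∀ e : E, TangentSpace 𝓘(ℝ, TotModel n N) e) (p : Phase n N π) :
    lift X p = mfderiv 𝓘(ℝ, PhaseModel n N) 𝓘(ℝ, PhaseModel n N)
      (chartAt (PhaseModel n N) p).symm (chartAt (PhaseModel n N) p p)
      (liftCoord ((fibredChartAt π p.pt : FibredChart n N π).vertComp X)
        (chartAt (PhaseModel n N) p p)) := by
  refine congrArg (mfderiv 𝓘(ℝ, PhaseModel n N) 𝓘(ℝ, PhaseModel n N)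
      (chartAt (PhaseModel n N) p).symm (chartAt (PhaseModel n N) p p)) ?_
  refine Prod.ext rfl ?_
  ext A ν
  simp [liftCoord, momOf, momMap_apply, Finset.sum_apply, mul_comm]

variable {X : ∀ e : E, TangentSpace 𝓘(ℝ, TotModel n N) e}

/-- The lift is defined through a chart chosen at each point. Chart independence frees it from that
choice, so a single chart can be used on a whole neighbourhood, as differentiation requires. -/
theorem FibredChart.mfderiv_phaseChart_lift (c : FibredChart n N π) (hX : IsVerticalField π X)
    {p : Phase n N π} (hp : p.pt ∈ c.tot.source) :
    mfderiv 𝓘(ℝ, PhaseModel n N) 𝓘(ℝ, PhaseModel n N) c.phaseChart p (lift X p) =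
      liftCoord (c.vertComp X) (c.phaseChart p) := by
  set c' : FibredChart n N π := fibredChartAt π p.pt with hc'
  have hp' : p.pt ∈ c'.tot.source := mem_fibredChartAt_source π p.pt
  refine (mfderiv_transition c'.phaseChart_mem_maximalAtlas c.phaseChart_mem_maximalAtlas
    (x := p) hp' hp _).trans ?_
  refine Eq.trans ?_ (c'.fderiv_phase_transition_liftCoord hX c hp' hp)
  refine congrArg (fderiv ℝ (c.phaseChart ∘ c'.phaseChart.symm) (c'.phaseChart p)) ?_
  have h := congrArg (fun L => L (liftCoord (c'.vertComp X) (c'.phaseChart p)))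
    (c'.mdiff_phaseChart.comp_symm_deriv (c'.phaseChart.map_source (x := p) hp'))
  rw [c'.phaseChart.left_inv (x := p) hp'] at h
  rw [lift_apply]
  exact h

theorem FibredChart.fieldRep_lift (c : FibredChart n N π) (hX : IsVerticalField π X)
    {z : PhaseModel n N} (hz : z ∈ c.phaseChart.target) :
    fieldRep c.phaseChart (lift (π := π) X) z = liftCoord (c.vertComp X) z := by
  have h := c.mfderiv_phaseChart_lift hX (p := c.phaseChart.symm z) (c.phaseChart.map_target hz)
  rw [c.phaseChart.right_inv hz] at h
  exact h

end Polysymplectic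

/-! ### Smoothness, Lie brackets and linearity of the lift. -/

namespace Polysymplectic

universe u v

theorem fieldRep_apply {Zm : Type*} [NormedAddCommGroup Zm] [NormedSpace ℝ Zm]
    {Z : Type*} [TopologicalSpace Z] [ChartedSpace Zm Z] (φ : OpenPartialHomeomorph Z Zm)
    (X : ∀ z : Z, TangentSpace 𝓘(ℝ, Zm) z) {x : Z} (hx : x ∈ φ.source) :
    fieldRep φ X (φ x) = mfderiv 𝓘(ℝ, Zm) 𝓘(ℝ, Zm) φ x (X x) := by
  have key : ∀ y, y = x → (mfderiv 𝓘(ℝ, Zm) 𝓘(ℝ, Zm) φ y (X y) : Zm) =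
      mfderiv 𝓘(ℝ, Zm) 𝓘(ℝ, Zm) φ x (X x) := by
    rintro _ rfl
    rfl
  exact key _ (φ.left_inv hx)

variable {n N : ℕ}

theorem contDiffOn_liftCoord {ξ : TotModel n N → FibreModel N} {U : Set (TotModel n N)}
    (hU : IsOpen U) (hξ : ContDiffOn ℝ ∞ ξ U) :
    ContDiffOn ℝ ∞ (liftCoord ξ : PhaseModel n N → PhaseModel n N) (Prod.fst ⁻¹' U) := by
  have h1 : ContDiffOn ℝ ∞ (fun z : PhaseModel n N => ξ z.1) (Prod.fst ⁻¹' U) :=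
    hξ.comp contDiff_fst.contDiffOn fun _ h => h
  have h2 : ContDiffOn ℝ ∞ (fun z : PhaseModel n N => fderiv ℝ ξ z.1) (Prod.fst ⁻¹' U) :=
    (hξ.fderiv_of_isOpen hU (m := ∞) (by simp)).comp contDiff_fst.contDiffOn fun _ h => h
  refine (contDiffOn_const.prodMk h1).prodMk (contDiffOn_pi.2 fun A => ?_)
  have h3 : ContDiffOn ℝ ∞ (fun z : PhaseModel n N => momMap n N z.2) (Prod.fst ⁻¹' U) :=
    ((momMap n N).contDiff.comp contDiff_snd).contDiffOn
  exact (h3.clm_apply (h2.clm_apply contDiffOn_const)).neg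

theorem contDiffAt_liftCoord {ξ : TotModel n N → FibreModel N} {z : PhaseModel n N}
    (hξ : ContDiffAt ℝ ∞ ξ z.1) : ContDiffAt ℝ ∞ (liftCoord ξ) z := by
  have h1 : ContDiffAt ℝ ∞ (fun z : PhaseModel n N => ξ z.1) z := hξ.comp z contDiffAt_fst
  have h2 : ContDiffAt ℝ ∞ (fun z : PhaseModel n N => fderiv ℝ ξ z.1) z :=
    (hξ.fderiv_right (m := ∞) (by simp)).comp z contDiffAt_fst
  refine (contDiffAt_const.prodMk h1).prodMk (contDiffAt_pi.2 fun A => ?_)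
  have h3 : ContDiffAt ℝ ∞ (fun z : PhaseModel n N => momMap n N z.2) z :=
    ((momMap n N).contDiff.comp contDiff_snd).contDiffAt
  exact (h3.clm_apply (h2.clm_apply contDiffAt_const)).neg

theorem fderiv_liftCoord_fst {ξ : TotModel n N → FibreModel N} {z : PhaseModel n N}
    (hξ : ContDiffAt ℝ ∞ ξ z.1) (V : PhaseModel n N) :
    (fderiv ℝ (liftCoord ξ) z V).1 = (0, fderiv ℝ ξ z.1 V.1) := by
  have h1 := (ContinuousLinearMap.fst ℝ (TotModel n N)
    (Fin N → Fin (n + 1) → ℝ)).hasFDerivAt.comp z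
    ((contDiffAt_liftCoord hξ).differentiableAt (by simp)).hasFDerivAt
  have h2 : HasFDerivAt (fun z : PhaseModel n N => (((0 : BaseModel n), ξ z.1) : TotModel n N))
      ((ContinuousLinearMap.inr ℝ (BaseModel n) (FibreModel N)) ∘L (fderiv ℝ ξ z.1) ∘L
        ContinuousLinearMap.fst ℝ (TotModel n N) (Fin N → Fin (n + 1) → ℝ)) z :=
    (ContinuousLinearMap.inr ℝ (BaseModel n) (FibreModel N)).hasFDerivAt.comp z
      ((hξ.differentiableAt (by simp)).hasFDerivAt.comp z
        (ContinuousLinearMap.fst ℝ (TotModel n N) (Fin N → Fin (n + 1) → ℝ)).hasFDerivAt)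
  exact congrArg (fun L : PhaseModel n N →L[ℝ] TotModel n N => L V) (h1.unique h2)

theorem momMap_fderiv_liftCoord_snd {ξ : TotModel n N → FibreModel N} {z : PhaseModel n N}
    (hξ : ContDiffAt ℝ ∞ ξ z.1) (V : PhaseModel n N) (u : FibreModel N) :
    momMap n N (fderiv ℝ (liftCoord ξ) z V).2 u =
      -(momMap n N z.2 (fderiv ℝ (fderiv ℝ ξ) z.1 V.1 (0, u)) +
        momMap n N V.2 (fderiv ℝ ξ z.1 (0, u))) := by
  have h1 := ((ContinuousLinearMap.apply ℝ (Fin (n + 1) → ℝ) u) ∘L momMap n N ∘L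
    (ContinuousLinearMap.snd ℝ (TotModel n N) (Fin N → Fin (n + 1) → ℝ))).hasFDerivAt.comp z
    ((contDiffAt_liftCoord hξ).differentiableAt (by simp)).hasFDerivAt
  have h2 : HasFDerivAt (fun z : PhaseModel n N => momMap n N z.2)
      (momMap n N ∘L
        ContinuousLinearMap.snd ℝ (TotModel n N) (Fin N → Fin (n + 1) → ℝ)) z :=
    (momMap n N ∘L
      ContinuousLinearMap.snd ℝ (TotModel n N) (Fin N → Fin (n + 1) → ℝ)).hasFDerivAt
  have h3 : HasFDerivAt (fun z : PhaseModel n N => fderiv ℝ ξ z.1 (0, u))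
      ((ContinuousLinearMap.apply ℝ (FibreModel N) ((0, u) : TotModel n N)) ∘L
        fderiv ℝ (fderiv ℝ ξ) z.1 ∘L
        ContinuousLinearMap.fst ℝ (TotModel n N) (Fin N → Fin (n + 1) → ℝ)) z :=
    (ContinuousLinearMap.apply ℝ (FibreModel N) ((0, u) : TotModel n N)).hasFDerivAt.comp z
      ((((hξ.fderiv_right (m := ∞) (by simp)).differentiableAt (by simp)).hasFDerivAt).comp z
        (ContinuousLinearMap.fst ℝ (TotModel n N) (Fin N → Fin (n + 1) → ℝ)).hasFDerivAt)
  have h4 := (h2.clm_apply h3).neg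
  have h5 := h1.unique (h4.congr_of_eventuallyEq
    (Filter.Eventually.of_forall fun z => momMap_liftCoord ξ z u))
  exact congrArg (fun L : PhaseModel n N →L[ℝ] (Fin (n + 1) → ℝ) => L V) h5

theorem isSymmSndFDerivAt_of_contDiffAt {F G : Type*} [NormedAddCommGroup F] [NormedSpace ℝ F]
    [NormedAddCommGroup G] [NormedSpace ℝ G] {f : F → G} {x : F} (hf : ContDiffAt ℝ ∞ f x) :
    IsSymmSndFDerivAt ℝ f x :=
  hf.isSymmSndFDerivAt (by
    rw [minSmoothness_of_isRCLikeNormedField]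
    exact WithTop.coe_le_coe.2 (le_top (a := (2 : ℕ∞))))

/-- The components `X^B ∂_B Y^A - Y^B ∂_B X^A` of the bracket of two vertical fields. -/
def vertBracket (ξ η : TotModel n N → FibreModel N) (y : TotModel n N) : FibreModel N :=
  fderiv ℝ η y (0, ξ y) - fderiv ℝ ξ y (0, η y)

theorem fderiv_vertBracket {ξ η : TotModel n N → FibreModel N} {y : TotModel n N}
    (hξ : ContDiffAt ℝ ∞ ξ y) (hη : ContDiffAt ℝ ∞ η y) (w : TotModel n N) :
    fderiv ℝ (vertBracket ξ η) y w =
      (fderiv ℝ η y (0, fderiv ℝ ξ y w) + fderiv ℝ (fderiv ℝ η) y w (0, ξ y)) -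
        (fderiv ℝ ξ y (0, fderiv ℝ η y w) + fderiv ℝ (fderiv ℝ ξ) y w (0, η y)) := by
  have key : ∀ {ξ η : TotModel n N → FibreModel N}, ContDiffAt ℝ ∞ ξ y → ContDiffAt ℝ ∞ η y →
      HasFDerivAt (fun y => fderiv ℝ η y (0, ξ y))
        (fderiv ℝ η y ∘L ((ContinuousLinearMap.inr ℝ (BaseModel n) (FibreModel N)) ∘L
          fderiv ℝ ξ y) + (fderiv ℝ (fderiv ℝ η) y).flip (0, ξ y)) y := fun hξ hη =>
    ((hη.fderiv_right (m := ∞) (by simp)).differentiableAt (by simp)).hasFDerivAt.clm_apply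
      ((ContinuousLinearMap.inr ℝ (BaseModel n) (FibreModel N)).hasFDerivAt.comp y
        (hξ.differentiableAt (by simp)).hasFDerivAt)
  have h := ((key hξ hη).sub (key hη hξ)).fderiv
  exact congrArg (fun L : TotModel n N →L[ℝ] FibreModel N => L w) h

/-- In the momentum component, each lift differentiated along the other gives a second-derivative
term and a product of first derivatives. These are the terms of $-p\circ\partial[\xi,\eta]$ given by
the product rule, once the second derivatives are symmetrised. -/
theorem lieBracket_liftCoord {ξ η : TotModel n N → FibreModel N} {z : PhaseModel n N}
    (hξ : ContDiffAt ℝ ∞ ξ z.1) (hη : ContDiffAt ℝ ∞ η z.1) :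
    VectorField.lieBracket ℝ (liftCoord ξ) (liftCoord η) z = liftCoord (vertBracket ξ η) z := by
  rw [VectorField.lieBracket]
  refine Prod.ext ?_ (momMap_injective ?_)
  · rw [Prod.fst_sub, fderiv_liftCoord_fst hξ, fderiv_liftCoord_fst hη]
    simp [liftCoord, vertBracket]
  · ext1 u
    rw [Prod.snd_sub, map_sub, sub_apply, momMap_fderiv_liftCoord_snd hξ,
      momMap_fderiv_liftCoord_snd hη, momMap_liftCoord, momMap_liftCoord, momMap_liftCoord,
      fderiv_vertBracket hξ hη]
    have h1 := (isSymmSndFDerivAt_of_contDiffAt hξ).eq (0, u) (0, η z.1)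
    have h2 := (isSymmSndFDerivAt_of_contDiffAt hη).eq (0, u) (0, ξ z.1)
    rw [h1, h2]
    simp only [map_sub, map_add, liftCoord]
    abel

theorem lieBracket_vertical {ξ η : TotModel n N → FibreModel N} {y : TotModel n N}
    (hξ : DifferentiableAt ℝ ξ y) (hη : DifferentiableAt ℝ η y) :
    VectorField.lieBracket ℝ (fun y => ((0, ξ y) : TotModel n N)) (fun y => (0, η y)) y =
      (0, vertBracket ξ η y) := by
  have key : ∀ {ξ : TotModel n N → FibreModel N}, DifferentiableAt ℝ ξ y →
      fderiv ℝ (fun y => ((0, ξ y) : TotModel n N)) y =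
        (ContinuousLinearMap.inr ℝ (BaseModel n) (FibreModel N)) ∘L fderiv ℝ ξ y := fun hξ =>
    ((ContinuousLinearMap.inr ℝ (BaseModel n) (FibreModel N)).hasFDerivAt.comp y
      hξ.hasFDerivAt).fderiv
  rw [VectorField.lieBracket, key hξ, key hη]
  simp [vertBracket]

variable {M : Type v} [TopologicalSpace M] [ChartedSpace (BaseModel n) M]
variable {E : Type u} [TopologicalSpace E] [ChartedSpace (TotModel n N) E]
variable {π : E → M} [SmoothFibreBundle n N π]
variable [IsManifold 𝓘(ℝ, TotModel n N) ∞ E]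
variable {X Y : ∀ e : E, TangentSpace 𝓘(ℝ, TotModel n N) e}

namespace FibredChart

variable (c : FibredChart n N π)

omit [SmoothFibreBundle n N π] in
theorem contDiffAt_vertComp (hX : IsVerticalField π X) {y : TotModel n N}
    (hy : y ∈ c.tot.target) : ContDiffAt ℝ ∞ (c.vertComp X) y :=
  (c.contDiffOn_vertComp hX).contDiffAt (c.tot.open_target.mem_nhds hy)

theorem fieldRep_tot_mlieBracket (hX : IsVerticalField π X) (hY : IsVerticalField π Y)
    {y : TotModel n N} (hy : y ∈ c.tot.target) :
    fieldRep c.tot (VectorField.mlieBracket 𝓘(ℝ, TotModel n N) X Y) y =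
      (0, vertBracket (c.vertComp X) (c.vertComp Y) y) := by
  rw [fieldRep_mlieBracket c.tot_mem hX.smooth hY.smooth hy,
    ← lieBracket_vertical ((c.contDiffAt_vertComp hX hy).differentiableAt (by simp))
      ((c.contDiffAt_vertComp hY hy).differentiableAt (by simp))]
  refine Filter.EventuallyEq.lieBracket_vectorField_eq ?_ ?_ <;>
  filter_upwards [c.tot.open_target.mem_nhds hy] with y hy
  · exact c.fieldRep_tot hX hy
  · exact c.fieldRep_tot hY hy

theorem vertComp_mlieBracket (hX : IsVerticalField π X) (hY : IsVerticalField π Y)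
    {y : TotModel n N} (hy : y ∈ c.tot.target) :
    c.vertComp (VectorField.mlieBracket 𝓘(ℝ, TotModel n N) X Y) y =
      vertBracket (c.vertComp X) (c.vertComp Y) y :=
  congrArg Prod.snd (c.fieldRep_tot_mlieBracket hX hY hy)

end FibredChart

variable [IsManifold 𝓘(ℝ, BaseModel n) ∞ M]

theorem IsVerticalField.mlieBracket (hX : IsVerticalField π X) (hY : IsVerticalField π Y) :
    IsVerticalField π (VectorField.mlieBracket 𝓘(ℝ, TotModel n N) X Y) where
  smooth := by
    intro e
    let c : FibredChart n N π := fibredChartAt π e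
    refine contMDiffAt_of_fieldRep c.tot_mem (mem_fibredChartAt_source π e) ?_
    have h : ∀ {X Y : ∀ e : E, TangentSpace 𝓘(ℝ, TotModel n N) e}, IsVerticalField π X →
        IsVerticalField π Y → ContDiffOn ℝ ∞
          (fun y => fderiv ℝ (c.vertComp Y) y (0, c.vertComp X y)) c.tot.target := fun hX hY =>
      ((c.contDiffOn_vertComp hY).fderiv_of_isOpen c.tot.open_target (m := ∞) (by simp)).clm_apply
        (contDiffOn_const.prodMk (c.contDiffOn_vertComp hX))
    exact (contDiffOn_const.prodMk ((h hX hY).sub (h hY hX))).congr fun y hy =>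
      c.fieldRep_tot_mlieBracket hX hY hy
  vertical e := by
    let c : FibredChart n N π := fibredChartAt π e
    have he : e ∈ c.tot.source := mem_fibredChartAt_source π e
    rw [c.mem_vert_iff he]
    have h := c.fieldRep_tot_mlieBracket hX hY (c.tot.map_source he)
    rw [fieldRep_apply _ _ he] at h
    exact congrArg Prod.fst h

theorem isSmoothField_lift (hX : IsVerticalField π X) :
    IsSmoothField (PhaseModel n N) (lift (π := π) X) := by
  intro p
  let c : FibredChart n N π := fibredChartAt π p.pt
  refine contMDiffAt_of_fieldRep c.phaseChart_mem_maximalAtlas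
    (x := p) (mem_fibredChartAt_source π p.pt) ?_
  exact (contDiffOn_liftCoord c.tot.open_target (c.contDiffOn_vertComp hX)).congr
    fun z hz => c.fieldRep_lift hX hz

theorem eq_of_mfderiv_phaseChart_eq (c : FibredChart n N π) {p : Phase n N π}
    (hp : p.pt ∈ c.tot.source) {v w : TangentSpace 𝓘(ℝ, PhaseModel n N) p}
    (h : mfderiv 𝓘(ℝ, PhaseModel n N) 𝓘(ℝ, PhaseModel n N) c.phaseChart p v =
      mfderiv 𝓘(ℝ, PhaseModel n N) 𝓘(ℝ, PhaseModel n N) c.phaseChart p w) : v = w := by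
  rw [← mfderiv_symm_chart' c.phaseChart_mem_maximalAtlas (x := p) hp v, h,
    mfderiv_symm_chart' c.phaseChart_mem_maximalAtlas (x := p) hp w]

/-- Both sides are read in one phase chart, where the claim is `lieBracket_liftCoord` for the
component functions. -/
theorem lift_mlieBracket (hX : IsVerticalField π X) (hY : IsVerticalField π Y) :
    lift (π := π) (VectorField.mlieBracket 𝓘(ℝ, TotModel n N) X Y) =
      VectorField.mlieBracket 𝓘(ℝ, PhaseModel n N) (lift X) (lift Y) := by
  ext1 p
  let c : FibredChart n N π := fibredChartAt π p.pt
  have hp : p.pt ∈ c.tot.source := mem_fibredChartAt_source π p.pt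
  have hz : c.phaseChart p ∈ c.phaseChart.target := c.phaseChart.map_source hp
  refine eq_of_mfderiv_phaseChart_eq c hp ?_
  refine (c.mfderiv_phaseChart_lift (hX.mlieBracket hY) hp).trans ?_
  refine Eq.trans ?_ (fieldRep_apply c.phaseChart _ (x := p) hp)
  rw [fieldRep_mlieBracket c.phaseChart_mem_maximalAtlas (isSmoothField_lift hX)
    (isSmoothField_lift hY) hz]
  have h1 : VectorField.lieBracket ℝ (fieldRep c.phaseChart (lift (π := π) X))
      (fieldRep c.phaseChart (lift (π := π) Y)) (c.phaseChart p) =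
      VectorField.lieBracket ℝ (liftCoord (c.vertComp X)) (liftCoord (c.vertComp Y))
        (c.phaseChart p) := by
    refine Filter.EventuallyEq.lieBracket_vectorField_eq ?_ ?_ <;>
    filter_upwards [c.phaseChart.open_target.mem_nhds hz] with z hz
    · exact c.fieldRep_lift hX hz
    · exact c.fieldRep_lift hY hz
  rw [h1, lieBracket_liftCoord (c.contDiffAt_vertComp hX hz) (c.contDiffAt_vertComp hY hz)]
  -- Equality near the point is needed, not just at it: the lift involves a first derivative of the
  -- components.
  have h2 : c.vertComp (VectorField.mlieBracket 𝓘(ℝ, TotModel n N) X Y) =ᶠ[𝓝 (c.phaseChart p).1]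
      vertBracket (c.vertComp X) (c.vertComp Y) := by
    filter_upwards [c.tot.open_target.mem_nhds hz] with y hy
    exact c.vertComp_mlieBracket hX hY hy
  rw [liftCoord, liftCoord, h2.fderiv_eq, h2.self_of_nhds]

theorem lift_add_smul (a b : ℝ) (hX : IsVerticalField π X) (hY : IsVerticalField π Y) :
    lift (π := π) (a • X + b • Y) = a • lift X + b • lift Y := by
  ext1 p
  let c : FibredChart n N π := fibredChartAt π p.pt
  have hp : p.pt ∈ c.tot.source := mem_fibredChartAt_source π p.pt
  have hz : c.phaseChart p ∈ c.phaseChart.target := c.phaseChart.map_source hp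
  have h1 : c.vertComp (a • X + b • Y) = a • c.vertComp X + b • c.vertComp Y := by
    ext1 y
    have := map_add (mfderiv 𝓘(ℝ, TotModel n N) 𝓘(ℝ, TotModel n N) c.tot (c.tot.symm y))
      (a • X (c.tot.symm y)) (b • Y (c.tot.symm y))
    rw [map_smul, map_smul] at this
    exact congrArg Prod.snd this
  have h2 : liftCoord (c.vertComp (a • X + b • Y)) (c.phaseChart p) =
      a • liftCoord (c.vertComp X) (c.phaseChart p) +
        b • liftCoord (c.vertComp Y) (c.phaseChart p) := by
    rw [h1]
    refine Prod.ext ?_ (momMap_injective ?_)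
    · simp [liftCoord]
    · ext1 u
      have hX' := (c.contDiffAt_vertComp hX hz).differentiableAt (by simp)
      have hY' := (c.contDiffAt_vertComp hY hz).differentiableAt (by simp)
      rw [Prod.snd_add, Prod.smul_snd, Prod.smul_snd, map_add, map_smul, map_smul,
        add_apply, smul_apply,
        smul_apply, momMap_liftCoord, momMap_liftCoord, momMap_liftCoord,
        fderiv_add (hX'.const_smul a) (hY'.const_smul b), fderiv_const_smul hX',
        fderiv_const_smul hY']
      simp only [add_apply, smul_apply, map_add, map_smul,
        smul_neg, neg_add]
  rw [lift_apply, Pi.add_apply, Pi.smul_apply, Pi.smul_apply, lift_apply X, lift_apply Y]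
  refine (congrArg _ h2).trans ?_
  refine (map_add _ _ _).trans ?_
  exact congrArg₂ (· + ·) (map_smul _ _ _) (map_smul _ _ _)

end Polysymplectic

/-! ### The lift as infinitesimal generator of the transported families. -/

namespace Polysymplectic

universe u v

/-- Near $t=0$ the Jacobian is invertible, so $Q=P\circ J^{-1}$ as linear maps, and inversion has
derivative $-J'$ at the identity. This is the origin of the minus sign in the momentum part of the
lift. -/
theorem hasDerivAt_of_momMap_comp_eq {n N : ℕ} {J : ℝ → FibreModel N →L[ℝ] FibreModel N}
    {J' : FibreModel N →L[ℝ] FibreModel N} (hJ : HasDerivAt J J' 0) (hJ0 : J 0 = 1)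
    {P : FibreModel N →L[ℝ] (Fin (n + 1) → ℝ)} {Q : ℝ → Fin N → Fin (n + 1) → ℝ}
    (hQ : ∀ᶠ t in 𝓝 0, momMap n N (Q t) ∘L J t = P) :
    HasDerivAt Q (momOf (-(P ∘L J'))) 0 := by
  have h1 : HasDerivAt (fun t => Ring.inverse (J t)) (-J') 0 := by
    have h := (hasFDerivAt_ringInverse (𝕜 := ℝ)
      (1 : (FibreModel N →L[ℝ] FibreModel N)ˣ)).comp_hasDerivAt_of_eq (0 : ℝ) hJ (by simp [hJ0])
    exact h.congr_deriv (by simp)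
  have h2 : HasDerivAt (fun t => P ∘L Ring.inverse (J t)) (P ∘L (-J')) 0 :=
    (ContinuousLinearMap.compL ℝ (FibreModel N) (FibreModel N) (Fin (n + 1) → ℝ)
      P).hasFDerivAt.comp_hasDerivAt (0 : ℝ) h1
  rw [ContinuousLinearMap.comp_neg] at h2
  have h3 : HasDerivAt (fun t => momOf (P ∘L Ring.inverse (J t))) (momOf (-(P ∘L J'))) 0 := by
    refine hasDerivAt_pi.2 fun A => ?_
    exact (ContinuousLinearMap.apply ℝ (Fin (n + 1) → ℝ)
      (EuclideanSpace.single A 1 : FibreModel N)).hasFDerivAt.comp_hasDerivAt (0 : ℝ) h2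
  refine h3.congr_of_eventuallyEq ?_
  -- `Ring.inverse` is a true inverse only at units; these form an open set containing $J(0)=1$.
  have h4 : ∀ᶠ t in 𝓝 (0 : ℝ), IsUnit (J t) := by
    refine hJ.continuousAt.eventually (Units.isOpen.mem_nhds ?_)
    rw [hJ0]
    exact isUnit_one
  filter_upwards [h4, hQ] with t ht hQt
  apply momMap_injective
  rw [momMap_momOf, ← hQt, ContinuousLinearMap.comp_assoc]
  change _ = momMap n N (Q t) ∘L (J t * Ring.inverse (J t))
  rw [Ring.mul_inverse_cancel _ ht]
  rfl

/-- Exchange of $\partial_t$ and $\partial_x$: both sides are the second derivative of $f$ at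
$(0,y)$ on $(1,0)$ and $(0,w)$, taken in opposite orders. -/
theorem hasDerivAt_fderiv_of_flow {F : Type*} [NormedAddCommGroup F] [NormedSpace ℝ F]
    {f : ℝ × F → F} {y : F} (hf : ContDiffAt ℝ ∞ f (0, y)) {Ξ : F → F}
    (hvel : ∀ᶠ x in 𝓝 y, HasDerivAt (fun t => f (t, x)) (Ξ x) 0) :
    HasDerivAt (fun t : ℝ => fderiv ℝ (fun x => f (t, x)) y) (fderiv ℝ Ξ y) 0 := by
  -- Smoothness of order `∞` at a point need not hold on one neighbourhood for all orders; order $1$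
  -- does spread to a neighbourhood and suffices here.
  have hev : ∀ᶠ q in 𝓝 ((0 : ℝ), y), DifferentiableAt ℝ f q := by
    filter_upwards [(hf.of_le (m := 1) (by simp)).eventually (by simp)] with q hq
    exact hq.differentiableAt (by simp)
  have hd : HasFDerivAt (fderiv ℝ f) (fderiv ℝ (fderiv ℝ f) (0, y)) (0, y) :=
    ((hf.fderiv_right (m := ∞) (by simp)).differentiableAt (by simp)).hasFDerivAt
  have hpart : ∀ t, DifferentiableAt ℝ f (t, y) →
      fderiv ℝ (fun x => f (t, x)) y = fderiv ℝ f (t, y) ∘L ContinuousLinearMap.inr ℝ ℝ F := by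
    intro t ht
    exact (ht.hasFDerivAt.comp y (hasFDerivAt_prodMk_right t y)).fderiv
  have hline : HasDerivAt (fun t : ℝ => (t, y)) ((1 : ℝ), (0 : F)) 0 :=
    (hasDerivAt_id (0 : ℝ)).prodMk (hasDerivAt_const (0 : ℝ) y)
  have h1 : HasDerivAt (fun t : ℝ => fderiv ℝ f (t, y) ∘L ContinuousLinearMap.inr ℝ ℝ F)
      (fderiv ℝ (fderiv ℝ f) (0, y) (1, 0) ∘L ContinuousLinearMap.inr ℝ ℝ F) 0 :=
    ((ContinuousLinearMap.compL ℝ F (ℝ × F) F).flip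
      (ContinuousLinearMap.inr ℝ ℝ F)).hasFDerivAt.comp_hasDerivAt (0 : ℝ)
      (hd.comp_hasDerivAt (0 : ℝ) hline)
  have h2 : fderiv ℝ (fderiv ℝ f) (0, y) (1, 0) ∘L ContinuousLinearMap.inr ℝ ℝ F =
      fderiv ℝ Ξ y := by
    have h3 : HasFDerivAt (fun x => fderiv ℝ f (0, x) (1, 0))
        ((ContinuousLinearMap.apply ℝ F ((1 : ℝ), (0 : F))) ∘L
          (fderiv ℝ (fderiv ℝ f) (0, y)) ∘L ContinuousLinearMap.inr ℝ ℝ F) y :=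
      (ContinuousLinearMap.apply ℝ F ((1 : ℝ), (0 : F))).hasFDerivAt.comp y
        (hd.comp y (hasFDerivAt_prodMk_right (0 : ℝ) y))
    have hcont : Filter.Tendsto (fun x : F => ((0 : ℝ), x)) (𝓝 y) (𝓝 (0, y)) :=
      (continuous_const.prodMk continuous_id).tendsto y
    have h4 : Ξ =ᶠ[𝓝 y] fun x => fderiv ℝ f (0, x) (1, 0) := by
      filter_upwards [hvel, hcont hev] with x hx hx'
      have h5 : HasDerivAt (fun t : ℝ => f (t, x)) (fderiv ℝ f (0, x) (1, 0)) 0 :=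
        (DifferentiableAt.hasFDerivAt hx').comp_hasDerivAt (0 : ℝ)
          ((hasDerivAt_id (0 : ℝ)).prodMk (hasDerivAt_const (0 : ℝ) x))
      exact hx.unique h5
    rw [(h3.congr_of_eventuallyEq h4).fderiv]
    ext1 w
    exact (isSymmSndFDerivAt_of_contDiffAt hf).eq (1, 0) (0, w)
  rw [← h2]
  refine h1.congr_of_eventuallyEq ?_
  filter_upwards [hline.continuousAt.eventually hev] with t ht
  exact hpart t ht

variable {n N : ℕ}
variable {M : Type v} [TopologicalSpace M] [ChartedSpace (BaseModel n) M]
variable {E : Type u} [TopologicalSpace E] [ChartedSpace (TotModel n N) E]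
variable {π : E → M} [SmoothFibreBundle n N π]

namespace FibredChart

variable (c : FibredChart n N π)

/-- As $\psi$ covers the identity near the point, $T\psi$ maps vertical vectors to vertical vectors,
and the intrinsic maps of $p$ and $q$ agree on corresponding vectors. In coordinates this
correspondence is the vertical Jacobian of $\psi$. -/
theorem momMap_momenta_of_isPushforward {ψ : E → E} {p q : Phase n N π}
    (hp : p.pt ∈ c.tot.source) (hq : q.pt ∈ c.tot.source) (h : IsPushforward ψ p q)
    (hψ : MDifferentiableAt 𝓘(ℝ, TotModel n N) 𝓘(ℝ, TotModel n N) ψ p.pt)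
    (hπ : ∀ᶠ e in 𝓝 p.pt, π (ψ e) = π e) (v : FibreModel N) :
    momMap n N (c.momenta q.pt q.mom)
      (fderiv ℝ (fun y => c.tot (ψ (c.tot.symm y))) (c.tot p.pt) (0, v)).2 =
      momMap n N (c.momenta p.pt p.mom) v := by
  obtain ⟨e, m⟩ := q
  obtain ⟨he, h⟩ := h
  dsimp only at he hq h ⊢
  subst he
  obtain ⟨w, rfl⟩ := c.exists_vertCoord_eq hp v
  have hπd := SmoothFibreBundle.contMDiff (n := n) (N := N) (π := π)
  let w' : TangentSpace 𝓘(ℝ, TotModel n N) (ψ p.pt) :=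
    mfderiv 𝓘(ℝ, TotModel n N) 𝓘(ℝ, TotModel n N) ψ p.pt
      (w : TangentSpace 𝓘(ℝ, TotModel n N) p.pt)
  have hw' : w' ∈ Vert n N π (ψ p.pt) := by
    have h1 := ((hπd.mdifferentiable (by simp) (ψ p.pt)).hasMFDerivAt).comp p.pt hψ.hasMFDerivAt
    have h2 := (hπd.mdifferentiable (by simp) p.pt).hasMFDerivAt
    have h3 := hasMFDerivAt_unique h1 (h2.congr_of_eventuallyEq hπ)
    have h4 := congrArg (fun L : TotModel n N →L[ℝ] BaseModel n =>
      L (w : TangentSpace 𝓘(ℝ, TotModel n N) p.pt)) h3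
    exact LinearMap.mem_ker.2 (h4.trans (LinearMap.mem_ker.1 w.2))
  have h1 := h w ⟨w', hw'⟩ rfl
  have h2 : fderiv ℝ (fun y => c.tot (ψ (c.tot.symm y))) (c.tot p.pt) (0, c.vertCoord _ w) =
      mfderiv 𝓘(ℝ, TotModel n N) 𝓘(ℝ, TotModel n N) c.tot (ψ p.pt) w' := by
    have h3 := (c.mdiff_tot.mdifferentiableAt_symm (c.tot.map_source hp)).hasMFDerivAt
    have h4 := (c.mdiff_tot.mdifferentiableAt hq).hasMFDerivAt.comp p.pt hψ.hasMFDerivAt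
    have h5 : ∀ x, x = p.pt → HasMFDerivAt 𝓘(ℝ, TotModel n N) 𝓘(ℝ, TotModel n N) (c.tot ∘ ψ) x
        ((mfderiv 𝓘(ℝ, TotModel n N) 𝓘(ℝ, TotModel n N) c.tot (ψ p.pt)).comp
          (mfderiv 𝓘(ℝ, TotModel n N) 𝓘(ℝ, TotModel n N) ψ p.pt)) := by
      rintro _ rfl
      exact h4
    have h6 := ((h5 _ (c.tot.left_inv hp)).comp _ h3).mfderiv
    rw [mfderiv_eq_fderiv] at h6
    rw [← c.tot_mfderiv_eq_vertCoord hp]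
    refine (congrArg (fun L : TotModel n N →L[ℝ] TotModel n N =>
      L (mfderiv 𝓘(ℝ, TotModel n N) 𝓘(ℝ, TotModel n N) c.tot p.pt
        (w : TangentSpace 𝓘(ℝ, TotModel n N) p.pt))) h6).trans ?_
    exact congrArg (fun x => mfderiv 𝓘(ℝ, TotModel n N) 𝓘(ℝ, TotModel n N) c.tot (ψ p.pt)
      (mfderiv 𝓘(ℝ, TotModel n N) 𝓘(ℝ, TotModel n N) ψ p.pt x)) (c.symm_tot_mfderiv hp _)
  rw [h2, c.momMap_momenta hp]
  refine (c.momMap_momenta hq m ⟨w', hw'⟩).trans ?_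
  rw [h1]
  -- The values of the two intrinsic maps lie over `π (ψ p.pt)` and `π p.pt`, which are equal by
  -- fibre preservation.
  have key : ∀ b, b = π p.pt → ∀ t : TangentSpace 𝓘(ℝ, BaseModel n) (π p.pt) ⊗[ℝ]
      TopForms n (π p.pt), c.baseVal b t = c.baseVal (π p.pt) t := by
    rintro _ rfl t
    rfl
  exact key _ hπ.self_of_nhds _

end FibredChart

variable [IsManifold 𝓘(ℝ, TotModel n N) ∞ E] [IsManifold 𝓘(ℝ, BaseModel n) ∞ M]
variable {X : ∀ e : E, TangentSpace 𝓘(ℝ, TotModel n N) e}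

/-- In a chart, the momenta along $\gamma$ composed with the fibre Jacobian $J(t)$ of $\varphi_t$
are constant, $J(0)=1$ and $J'(0)$ is the fibre derivative of $X$. The momentum velocity is
therefore $-p\circ\partial X$, and the point moves with velocity $X$. -/
theorem isGeneratorOfLift_lift (hX : IsVerticalField π X) :
    IsGeneratorOfLift X (lift (π := π) X) := by
  intro p φ hφ γ hγ
  let c : FibredChart n N π := fibredChartAt π p.pt
  have hp : p.pt ∈ c.tot.source := mem_fibredChartAt_source π p.pt
  set y := c.tot p.pt with hy
  have hyt : y ∈ c.tot.target := c.tot.map_source hp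
  have hsy : c.tot.symm y = p.pt := c.tot.left_inv hp
  have hφ0 : φ 0 p.pt = p.pt := hφ.zero.self_of_nhds
  let f : ℝ × TotModel n N → TotModel n N := fun q => c.tot (φ q.1 (c.tot.symm q.2))
  have hf : ContDiffAt ℝ ∞ f (0, y) := by
    have h1 : ContMDiffAt (𝓘(ℝ, ℝ).prod 𝓘(ℝ, TotModel n N)) (𝓘(ℝ, ℝ).prod 𝓘(ℝ, TotModel n N)) ∞
        (fun q : ℝ × TotModel n N => (q.1, c.tot.symm q.2)) (0, y) :=
      contMDiffAt_fst.prodMk (((contMDiffOn_symm_of_mem_maximalAtlas c.tot_mem).contMDiffAt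
        (c.tot.open_target.mem_nhds hyt)).comp ((0 : ℝ), y) contMDiffAt_snd)
    have h2 := ContMDiffAt.comp_of_eq (x := ((0 : ℝ), y)) hφ.smooth h1 (by rw [hsy])
    have h3 := ContMDiffAt.comp_of_eq (x := ((0 : ℝ), y))
      ((contMDiffOn_of_mem_maximalAtlas c.tot_mem).contMDiffAt
        (c.tot.open_source.mem_nhds hp)) h2 (by simp [hsy, hφ0])
    rw [← modelWithCornersSelf_prod, chartedSpaceSelf_prod] at h3
    exact h3.contDiffAt
  have hξ := c.contDiffAt_vertComp hX hyt
  have hsymm : Filter.Tendsto c.tot.symm (𝓝 y) (𝓝 p.pt) := by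
    have := (c.tot.continuousAt_symm hyt).tendsto
    rwa [hsy] at this
  have hvel : ∀ᶠ x in 𝓝 y, HasDerivAt (fun t => f (t, x))
      (((0, c.vertComp X x) : TotModel n N)) 0 := by
    filter_upwards [c.tot.open_target.mem_nhds hyt, hsymm hφ.velocity, hsymm hφ.zero]
      with x hx hx1 hx2
    have hx2 : φ 0 (c.tot.symm x) = c.tot.symm x := hx2
    have hs : φ 0 (c.tot.symm x) ∈ c.tot.source := by
      rw [hx2]; exact c.tot.map_target hx
    let L : TotModel n N →L[ℝ] TotModel n N :=
      mfderiv 𝓘(ℝ, TotModel n N) 𝓘(ℝ, TotModel n N) c.tot (φ 0 (c.tot.symm x))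
    let a : TotModel n N := X (φ 0 (c.tot.symm x))
    have h1 : HasFDerivAt (fun t => f (t, x)) (L ∘L ContinuousLinearMap.toSpanSingleton ℝ a) 0 :=
      hasMFDerivAt_iff_hasFDerivAt.1
        ((c.mdiff_tot.mdifferentiableAt hs).hasMFDerivAt.comp (0 : ℝ) hx1)
    refine h1.hasDerivAt.congr_deriv ?_
    have key : ∀ e, e = c.tot.symm x → (mfderiv 𝓘(ℝ, TotModel n N) 𝓘(ℝ, TotModel n N) c.tot e
        (X e) : TotModel n N) = (0, c.vertComp X x) := by
      rintro _ rfl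
      exact c.fieldRep_tot hX hx
    refine Eq.trans ?_ (key _ hx2)
    change L ((1 : ℝ) • a) = L a
    rw [one_smul]
  have hΞ : HasFDerivAt (fun x => ((0, c.vertComp X x) : TotModel n N))
      ((ContinuousLinearMap.inr ℝ (BaseModel n) (FibreModel N)) ∘L
        fderiv ℝ (c.vertComp X) y) y :=
    (ContinuousLinearMap.inr ℝ (BaseModel n) (FibreModel N)).hasFDerivAt.comp y
      (hξ.differentiableAt (by simp)).hasFDerivAt
  have hflow := hasDerivAt_fderiv_of_flow hf hvel
  rw [hΞ.fderiv] at hflow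
  let J : ℝ → FibreModel N →L[ℝ] FibreModel N := fun t =>
    (ContinuousLinearMap.snd ℝ (BaseModel n) (FibreModel N)) ∘L
      (fderiv ℝ (fun x => f (t, x)) y) ∘L ContinuousLinearMap.inr ℝ (BaseModel n) (FibreModel N)
  have hJ : HasDerivAt J (fderiv ℝ (c.vertComp X) y ∘L
      ContinuousLinearMap.inr ℝ (BaseModel n) (FibreModel N)) 0 :=
    ((ContinuousLinearMap.compL ℝ (FibreModel N) (TotModel n N) (FibreModel N)
      (ContinuousLinearMap.snd ℝ (BaseModel n) (FibreModel N))) ∘L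
      ((ContinuousLinearMap.compL ℝ (FibreModel N) (TotModel n N) (TotModel n N)).flip
        (ContinuousLinearMap.inr ℝ (BaseModel n) (FibreModel N)))).hasFDerivAt.comp_hasDerivAt
      (0 : ℝ) hflow
  have hJ0 : J 0 = 1 := by
    have h1 : (fun x => f (0, x)) =ᶠ[𝓝 y] id := by
      filter_upwards [c.tot.open_target.mem_nhds hyt, hsymm hφ.zero] with x hx hx2
      have hx2 : φ 0 (c.tot.symm x) = c.tot.symm x := hx2
      change c.tot (φ 0 (c.tot.symm x)) = x
      rw [hx2, c.tot.right_inv hx]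
    ext1 v
    change (fderiv ℝ (fun x => f (0, x)) y (0, v)).2 = v
    rw [h1.fderiv_eq, fderiv_id]
    rfl
  have hcont : Filter.Tendsto (fun t : ℝ => (t, p.pt)) (𝓝 0) (𝓝 (0, p.pt)) :=
    (Continuous.prodMk continuous_id continuous_const).tendsto (0 : ℝ)
  have hsrc : ∀ᶠ t in 𝓝 (0 : ℝ), φ t p.pt ∈ c.tot.source := by
    have h1 := hφ.smooth.continuousAt.tendsto.comp hcont
    refine h1.eventually (c.tot.open_source.mem_nhds ?_)
    rw [hφ0]
    exact hp
  have hdiff : ∀ᶠ t in 𝓝 (0 : ℝ),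
      MDifferentiableAt 𝓘(ℝ, TotModel n N) 𝓘(ℝ, TotModel n N) (φ t) p.pt := by
    have h1 := (contMDiffAt_iff_contMDiffAt_nhds (n := 1) (by simp)).1
      (hφ.smooth.of_le (by simp))
    filter_upwards [hcont h1] with t ht
    have h2 : ContMDiffAt 𝓘(ℝ, TotModel n N) (𝓘(ℝ, ℝ).prod 𝓘(ℝ, TotModel n N)) 1
        (fun e : E => (t, e)) p.pt := contMDiffAt_const.prodMk contMDiffAt_id
    exact (ContMDiffAt.comp p.pt ht h2).mdifferentiableAt (by simp)
  have hpres : ∀ᶠ t in 𝓝 (0 : ℝ), ∀ᶠ e in 𝓝 p.pt, π (φ t e) = π e := by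
    have h1 := hφ.preserves
    rw [nhds_prod_eq] at h1
    exact h1.curry
  have hmem : ∀ᶠ t in 𝓝 (0 : ℝ), (γ t).pt ∈ c.tot.source := by
    filter_upwards [hsrc, hγ] with t h1 h2
    rw [h2.1]
    exact h1
  let Q : ℝ → Fin N → Fin (n + 1) → ℝ := fun t => c.momenta (γ t).pt (γ t).mom
  have hQJ : ∀ᶠ t in 𝓝 (0 : ℝ), momMap n N (Q t) ∘L J t =
      momMap n N (c.momenta p.pt p.mom) := by
    filter_upwards [hmem, hγ, hdiff, hpres] with t h1 h2 h3 h4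
    ext1 v
    exact c.momMap_momenta_of_isPushforward hp h1 h2 h3 h4 v
  have hQ := hasDerivAt_of_momMap_comp_eq hJ hJ0 hQJ
  -- The curve is not assumed to start at `p`; this follows because $\varphi_0$ is the identity near
  -- the point, so its Jacobian is $1$.
  have hγ0 : γ 0 = p := by
    have h1 := hmem.self_of_nhds
    refine c.phaseChart.injOn (c.mem_phaseChart_source.2 h1) (c.mem_phaseChart_source.2 hp) ?_
    refine Prod.ext ?_ (momMap_injective ?_)
    · exact congrArg c.tot (hγ.self_of_nhds.1.trans hφ0)
    · have h2 := hQJ.self_of_nhds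
      rw [hJ0] at h2
      exact h2
  have hcurve : HasDerivAt (fun t => c.phaseChart (γ t))
      (liftCoord (c.vertComp X) (c.phaseChart p)) 0 := by
    refine HasDerivAt.prodMk (f₁ := fun t => c.tot (γ t).pt) ?_ hQ
    refine (hvel.self_of_nhds).congr_of_eventuallyEq ?_
    filter_upwards [hγ] with t ht
    change c.tot (γ t).pt = c.tot (φ t (c.tot.symm y))
    rw [ht.1, hsy]
  have hz : c.phaseChart p ∈ c.phaseChart.target := c.phaseChart.map_source hp
  have h1 : ∀ z, z = c.phaseChart p → HasMFDerivAt 𝓘(ℝ, PhaseModel n N) 𝓘(ℝ, PhaseModel n N)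
      c.phaseChart.symm z
      (mfderiv 𝓘(ℝ, PhaseModel n N) 𝓘(ℝ, PhaseModel n N) c.phaseChart.symm (c.phaseChart p)) := by
    rintro _ rfl
    exact (c.mdiff_phaseChart.mdifferentiableAt_symm hz).hasMFDerivAt
  have h2 := (h1 (c.phaseChart (γ 0)) (by rw [hγ0])).comp (0 : ℝ) hcurve.hasFDerivAt.hasMFDerivAt
  have h3 : γ =ᶠ[𝓝 0] c.phaseChart.symm ∘ fun t => c.phaseChart (γ t) := by
    filter_upwards [hmem] with t ht
    exact (c.phaseChart.left_inv (c.mem_phaseChart_source.2 ht)).symm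
  have h4 := h2.congr_of_eventuallyEq h3
  have key : ∀ q, q = p → (lift X q : PhaseModel n N) = lift X p := by
    rintro _ rfl
    rfl
  have h5 : (ContinuousLinearMap.toSpanSingleton ℝ (lift X (γ 0)) :
      TangentSpace 𝓘(ℝ, ℝ) (0 : ℝ) →L[ℝ] TangentSpace 𝓘(ℝ, PhaseModel n N) (γ 0)) =
      (mfderiv 𝓘(ℝ, PhaseModel n N) 𝓘(ℝ, PhaseModel n N) c.phaseChart.symm
        (c.phaseChart p)).comp (ContinuousLinearMap.toSpanSingleton ℝ
          (liftCoord (c.vertComp X) (c.phaseChart p))) := by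
    ext1
    change (1 : ℝ) • lift X (γ 0) = mfderiv 𝓘(ℝ, PhaseModel n N) 𝓘(ℝ, PhaseModel n N)
      c.phaseChart.symm (c.phaseChart p) ((1 : ℝ) • liftCoord (c.vertComp X) (c.phaseChart p))
    rw [one_smul, one_smul]
    exact (key _ hγ0).trans (lift_apply X p)
  rw [h5]
  exact h4

end Polysymplectic

/-! ### The canonical form and the momentum forms in adapted frames. -/

namespace Polysymplectic

universe u v

variable {n N : ℕ}

theorem fibreDir_apply (w : PhaseModel n N) : (fibreDir w : PhaseModel n N) = ((0, w.1.2), w.2) :=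
  rfl

/-- The coordinate expression of the canonical form in an adapted frame. -/
def thetaModel (n N : ℕ) :
    (Fin N → Fin (n + 1) → ℝ) →L[ℝ] PhaseModel n N [⋀^Fin (n + 1)]→L[ℝ] ℝ :=
  ((n : ℝ) + 1)⁻¹ • (ContinuousAlternatingMap.alternatizeUncurryFinCLM ℝ (PhaseModel n N) ℝ ∘L
    (ContinuousLinearMap.compL ℝ (PhaseModel n N) (Fin (n + 1) → ℝ)
      (PhaseModel n N [⋀^Fin n]→L[ℝ] ℝ) (volContract n N)) ∘L
    ((ContinuousLinearMap.compL ℝ (PhaseModel n N) (FibreModel N) (Fin (n + 1) → ℝ)).flip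
      (fibCoord n N)) ∘L momMap n N)

theorem thetaModel_apply (q : Fin N → Fin (n + 1) → ℝ) :
    thetaModel n N q = ((n : ℝ) + 1)⁻¹ • ContinuousAlternatingMap.alternatizeUncurryFin
      (volContract n N ∘L momMap n N q ∘L fibCoord n N) := rfl

variable {M : Type v} [TopologicalSpace M] [ChartedSpace (BaseModel n) M]
variable {E : Type u} [TopologicalSpace E] [ChartedSpace (TotModel n N) E]
variable {π : E → M} [SmoothFibreBundle n N π]
variable [IsManifold 𝓘(ℝ, TotModel n N) ∞ E] [IsManifold 𝓘(ℝ, BaseModel n) ∞ M]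
variable {X Y : ∀ e : E, TangentSpace 𝓘(ℝ, TotModel n N) e}
variable {Γ : Connection n (TotModel n N) π}
variable {Γbar : Connection n (PhaseModel n N) (Phase.toBase : Phase n N π → M)}

theorem coordForm_chart {k : ℕ} (c : FibredChart n N π) (α : PhaseForm n N π k) {p : Phase n N π}
    (hp : p.pt ∈ c.tot.source) (v : Fin k → TangentSpace 𝓘(ℝ, PhaseModel n N) p) :
    coordForm c.phaseChart α (c.phaseChart p)
      (fun i => mfderiv 𝓘(ℝ, PhaseModel n N) 𝓘(ℝ, PhaseModel n N) c.phaseChart p (v i)) =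
      α p v := by
  have key : ∀ q, q = p → ∀ u : Fin k → PhaseModel n N,
      (α q : PhaseModel n N [⋀^Fin k]→L[ℝ] ℝ) u = (α p : PhaseModel n N [⋀^Fin k]→L[ℝ] ℝ) u := by
    rintro _ rfl u
    rfl
  refine (key _ (c.phaseChart.left_inv (x := p) hp) _).trans ?_
  refine congrArg (α p) ?_
  ext1 i
  exact mfderiv_symm_chart' c.phaseChart_mem_maximalAtlas (x := p) hp (v i)

namespace FibredChart

variable (c : FibredChart n N π)

theorem coordProj_base {z : PhaseModel n N} (hz : z ∈ c.phaseChart.target) (w : PhaseModel n N) :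
    (coordProj c.phaseChart Γbar z w).1.1 = 0 := by
  have h1 := c.base_mfderiv_toBase (p := c.phaseChart.symm z) (c.phaseChart.map_target hz)
    (Γbar.proj (c.phaseChart.symm z)
      (mfderiv 𝓘(ℝ, PhaseModel n N) 𝓘(ℝ, PhaseModel n N) c.phaseChart.symm z w))
  rw [Γbar.mfderiv_proj] at h1
  exact h1.symm.trans (map_zero _)

theorem coordProj_eq_self {z : PhaseModel n N} (hz : z ∈ c.phaseChart.target)
    {w : PhaseModel n N} (hw : w.1.1 = 0) : coordProj c.phaseChart Γbar z w = w := by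
  set D := mfderiv 𝓘(ℝ, PhaseModel n N) 𝓘(ℝ, PhaseModel n N) c.phaseChart.symm z w with hD
  have hs := c.phaseChart.map_target hz
  have h0 := mfderiv_chart_symm c.phaseChart_mem_maximalAtlas hz w
  have h1 := c.base_mfderiv_toBase (p := c.phaseChart.symm z) hs D
  rw [h0, hw] at h1
  have h2 : mfderiv 𝓘(ℝ, PhaseModel n N) 𝓘(ℝ, BaseModel n) Phase.toBase
      (c.phaseChart.symm z) D = 0 := by
    have h3 := c.symm_base_mfderiv (c.mapsTo _ hs)
      (mfderiv 𝓘(ℝ, PhaseModel n N) 𝓘(ℝ, BaseModel n) Phase.toBase (c.phaseChart.symm z) D)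
    rw [h1] at h3
    exact h3.symm.trans (map_zero _)
  have h4 := Γbar.proj_of_mfderiv_eq_zero _ _ h2
  exact (congrArg (mfderiv 𝓘(ℝ, PhaseModel n N) 𝓘(ℝ, PhaseModel n N) c.phaseChart
    (c.phaseChart.symm z)) h4).trans h0

theorem frame_base {z : PhaseModel n N} (hz : z ∈ c.phaseChart.target) (w : PhaseModel n N) :
    (frame c.phaseChart Γbar z w).1.1 = w.1.1 := by
  have h : frame c.phaseChart Γbar z w =
      (w - fibreDir w) - coordProj c.phaseChart Γbar z (w - fibreDir w) + fibreDir w := rfl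
  rw [h]
  simp only [Prod.fst_add, Prod.fst_sub, c.coordProj_base hz, fibreDir_apply]
  simp

/-- The frame sends base directions to horizontal vectors, which the projection kills by
idempotence, and leaves fibre directions unchanged. -/
theorem coordProj_frame {z : PhaseModel n N} (hz : z ∈ c.phaseChart.target) (w : PhaseModel n N) :
    coordProj c.phaseChart Γbar z (frame c.phaseChart Γbar z w) = fibreDir w := by
  have h : frame c.phaseChart Γbar z w =
      (w - fibreDir w) - coordProj c.phaseChart Γbar z (w - fibreDir w) + fibreDir w := rfl
  rw [h, map_add, map_sub, c.coordProj_eq_self hz (c.coordProj_base hz _), sub_self, zero_add,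
    c.coordProj_eq_self hz rfl]

theorem coframe_base {z : PhaseModel n N} (hz : z ∈ c.phaseChart.target) (w : PhaseModel n N) :
    (coframe c.phaseChart Γbar z w).1.1 = w.1.1 := by
  have h : coframe c.phaseChart Γbar z w = (w - fibreDir w) + coordProj c.phaseChart Γbar z w :=
    rfl
  rw [h]
  simp only [Prod.fst_add, Prod.fst_sub, c.coordProj_base hz, fibreDir_apply]
  simp

theorem coframe_eq_self {z : PhaseModel n N} (hz : z ∈ c.phaseChart.target)
    {w : PhaseModel n N} (hw : w.1.1 = 0) : coframe c.phaseChart Γbar z w = w := by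
  have h : coframe c.phaseChart Γbar z w = (w - fibreDir w) + coordProj c.phaseChart Γbar z w :=
    rfl
  have h2 : fibreDir w = w := Prod.ext (Prod.ext hw.symm rfl) rfl
  rw [h, c.coordProj_eq_self hz hw, h2, sub_self, zero_add]

theorem thetaMultilinear_symm (hΓ : Γbar.ProjectsTo Γ) {z : PhaseModel n N}
    (hz : z ∈ c.phaseChart.target) (w : Fin (n + 1) → PhaseModel n N) :
    thetaMultilinear Γ (c.phaseChart.symm z) (fun i =>
      mfderiv 𝓘(ℝ, PhaseModel n N) 𝓘(ℝ, PhaseModel n N) c.phaseChart.symm z (w i)) =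
    volContract n N (momMap n N z.2 (fibCoord n N (coordProj c.phaseChart Γbar z (w 0))))
      (Fin.tail w) := by
  set p := c.phaseChart.symm z with hpdef
  have hs : p.pt ∈ c.tot.source := c.phaseChart.map_target hz
  set D : PhaseModel n N → TangentSpace 𝓘(ℝ, PhaseModel n N) p := fun u =>
    mfderiv 𝓘(ℝ, PhaseModel n N) 𝓘(ℝ, PhaseModel n N) c.phaseChart.symm z u with hD
  refine (c.contractTop_apply (c.mapsTo _ hs) (evalVert p.pt p.mom (vertPart Γ p (D (w 0))))
    (fun i => mfderiv 𝓘(ℝ, PhaseModel n N) 𝓘(ℝ, BaseModel n) Phase.toBase p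
      (D (w i.succ)))).trans ?_
  rw [← c.momMap_momenta hs, volContract_apply]
  have h1 : c.vertCoord p.pt (vertPart Γ p (D (w 0))) =
      fibCoord n N (coordProj c.phaseChart Γbar z (w 0)) := by
    change ((mfderiv 𝓘(ℝ, TotModel n N) 𝓘(ℝ, TotModel n N) c.tot p.pt
      (Γ.proj p.pt (mfderiv 𝓘(ℝ, PhaseModel n N) 𝓘(ℝ, TotModel n N) Phase.pt p (D (w 0)))) :
      TotModel n N)).2 = _
    -- The only place where compatibility of the connections is needed: it replaces $P_\Gamma\circ
    -- T\mathrm{pr}$ by $T\mathrm{pr}\circ P_{\bar\Gamma}$.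
    rw [← hΓ p (D (w 0)), c.tot_mfderiv_pt hs]
    rfl
  have h2 : c.momenta p.pt p.mom = z.2 := congrArg Prod.snd (c.phaseChart.right_inv hz)
  have h3 : ∀ i : Fin n, (fun μ => c.baseCoframe (π p.pt) μ
      (mfderiv 𝓘(ℝ, PhaseModel n N) 𝓘(ℝ, BaseModel n) Phase.toBase p (D (w i.succ)))) =
      baseCoord n N (w i.succ) := by
    intro i
    ext μ
    have h4 := c.base_mfderiv_toBase hs (D (w i.succ))
    have h5 := mfderiv_chart_symm c.phaseChart_mem_maximalAtlas hz (w i.succ)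
    rw [h5] at h4
    exact congrArg (fun y : BaseModel n => y μ) h4
  rw [h1, h2]
  refine congrArg Matrix.det ?_
  ext i μ
  refine Fin.cases ?_ (fun i => ?_) i
  · rfl
  · exact congrFun (h3 i) μ

theorem coordForm_theta (hΓ : Γbar.ProjectsTo Γ) {z : PhaseModel n N}
    (hz : z ∈ c.phaseChart.target) :
    coordForm c.phaseChart (theta Γ) z =
      ((n : ℝ) + 1)⁻¹ • ContinuousAlternatingMap.alternatizeUncurryFin
        (volContract n N ∘L momMap n N z.2 ∘L fibCoord n N ∘L coordProj c.phaseChart Γbar z) := by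
  ext w
  set B := volContract n N ∘L momMap n N z.2 ∘L fibCoord n N ∘L coordProj c.phaseChart Γbar z
    with hB
  let g : PhaseModel n N →ₗ[ℝ] PhaseModel n N [⋀^Fin n]→ₗ[ℝ] ℝ :=
    ContinuousAlternatingMap.toAlternatingMapLinear ∘ₗ
      (B : PhaseModel n N →ₗ[ℝ] PhaseModel n N [⋀^Fin n]→L[ℝ] ℝ)
  have h1 : coordForm c.phaseChart (theta Γ) z w = (((n + 1).factorial : ℝ)⁻¹ •
      MultilinearMap.alternatization (thetaMultilinear Γ (c.phaseChart.symm z))) (fun i =>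
        mfderiv 𝓘(ℝ, PhaseModel n N) 𝓘(ℝ, PhaseModel n N) c.phaseChart.symm z (w i)) := rfl
  have h2 : MultilinearMap.alternatization (thetaMultilinear Γ (c.phaseChart.symm z)) (fun i =>
        mfderiv 𝓘(ℝ, PhaseModel n N) 𝓘(ℝ, PhaseModel n N) c.phaseChart.symm z (w i)) =
      MultilinearMap.alternatization
        (LinearMap.uncurryLeft (M := fun _ : Fin (n + 1) => PhaseModel n N)
          (AlternatingMap.toMultilinearMapLM (S := ℝ) ∘ₗ g)) w := by
    rw [MultilinearMap.alternatization_apply, MultilinearMap.alternatization_apply]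
    refine Finset.sum_congr rfl fun σ _ => ?_
    congr 1
    exact c.thetaMultilinear_symm hΓ hz (fun i => w (σ i))
  rw [h1, AlternatingMap.smul_apply, h2, MultilinearMap.alternatization_uncurryLeft,
    AlternatingMap.smul_apply, smul_smul, Nat.factorial_succ]
  -- The $n!$ permutations of the already alternating arguments turn the normalisation $1/(n+1)!$
  -- into $1/(n+1)$.
  have h3 : (((n + 1) * n.factorial : ℕ) : ℝ)⁻¹ * (n.factorial : ℝ) = ((n : ℝ) + 1)⁻¹ := by
    have : (n.factorial : ℝ) ≠ 0 := by positivity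
    push_cast
    field_simp
  rw [h3, AlternatingMap.alternatizeUncurryFin_apply, ContinuousAlternatingMap.smul_apply,
    ContinuousAlternatingMap.alternatizeUncurryFin_apply]
  rfl

/-- The connections drop out in the adapted frame: the vertical projection becomes the fixed
projection to fibre directions, and base components are unchanged. What remains is linear in the
momenta, so its derivative is constant. -/
theorem coordForm_theta_frame (hΓ : Γbar.ProjectsTo Γ) {z : PhaseModel n N}
    (hz : z ∈ c.phaseChart.target) :
    (coordForm c.phaseChart (theta Γ) z).compContinuousLinearMap (frame c.phaseChart Γbar z) =
      thetaModel n N z.2 := by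
  rw [c.coordForm_theta hΓ hz, thetaModel_apply]
  ext w
  rw [ContinuousAlternatingMap.compContinuousLinearMap_apply,
    ContinuousAlternatingMap.smul_apply, ContinuousAlternatingMap.smul_apply,
    ContinuousAlternatingMap.alternatizeUncurryFin_apply,
    ContinuousAlternatingMap.alternatizeUncurryFin_apply]
  congr 1
  refine Finset.sum_congr rfl fun i _ => ?_
  congr 1
  simp only [ContinuousLinearMap.comp_apply, Function.comp_apply, c.coordProj_frame hz]
  exact volContract_congr _ fun j => c.frame_base hz _

/-- The lift is vertical, so one term of the alternating sum survives, and the vertical projection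
fixes the lift. -/
theorem coordForm_momentumForm (hX : IsVerticalField π X) {z : PhaseModel n N}
    (hΓ : Γbar.ProjectsTo Γ) (hz : z ∈ c.phaseChart.target) :
    coordForm c.phaseChart (momentumForm Γ X) z =
      ((n : ℝ) + 1)⁻¹ • volContract n N (momMap n N z.2 (c.vertComp X z.1)) := by
  ext w
  have h1 : coordForm c.phaseChart (momentumForm Γ X) z w =
      coordForm c.phaseChart (theta Γ) z (Matrix.vecCons (liftCoord (c.vertComp X) z) w) := by
    refine congrArg (theta Γ (c.phaseChart.symm z)) ?_
    ext1 i
    refine Fin.cases ?_ (fun i => ?_) i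
    · have h2 := mfderiv_symm_chart c.phaseChart_mem_maximalAtlas hz
        (lift X (c.phaseChart.symm z))
      have h3 : (mfderiv 𝓘(ℝ, PhaseModel n N) 𝓘(ℝ, PhaseModel n N) c.phaseChart
          (c.phaseChart.symm z) (lift X (c.phaseChart.symm z)) : PhaseModel n N) =
          liftCoord (c.vertComp X) z := c.fieldRep_lift hX hz
      rw [h3] at h2
      exact h2.symm
    · rfl
  rw [h1, c.coordForm_theta hΓ hz, ContinuousAlternatingMap.smul_apply,
    ContinuousAlternatingMap.smul_apply]
  congr 1
  have h2 := alternatize_volContract_cons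
    (momMap n N z.2 ∘L fibCoord n N ∘L coordProj c.phaseChart Γbar z)
    (v := liftCoord (c.vertComp X) z) rfl w
  refine h2.trans ?_
  simp only [ContinuousLinearMap.comp_apply]
  rw [c.coordProj_eq_self hz rfl]
  rfl

theorem coordForm_momentumForm_frame (hX : IsVerticalField π X) {z : PhaseModel n N}
    (hΓ : Γbar.ProjectsTo Γ) (hz : z ∈ c.phaseChart.target) :
    (coordForm c.phaseChart (momentumForm Γ X) z).compContinuousLinearMap
      (frame c.phaseChart Γbar z) =
      ((n : ℝ) + 1)⁻¹ • volContract n N (momMap n N z.2 (c.vertComp X z.1)) := by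
  rw [c.coordForm_momentumForm hX hΓ hz]
  ext w
  rw [ContinuousAlternatingMap.compContinuousLinearMap_apply,
    ContinuousAlternatingMap.smul_apply, ContinuousAlternatingMap.smul_apply]
  congr 1
  exact volContract_congr _ fun j => c.frame_base hz _

theorem fderiv_coordForm_theta (hΓ : Γbar.ProjectsTo Γ) {z : PhaseModel n N}
    (hz : z ∈ c.phaseChart.target) :
    fderiv ℝ (fun z => (coordForm c.phaseChart (theta Γ) z).compContinuousLinearMap
      (frame c.phaseChart Γbar z)) z =
      thetaModel n N ∘L ContinuousLinearMap.snd ℝ (TotModel n N) (Fin N → Fin (n + 1) → ℝ) := by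
  refine HasFDerivAt.fderiv ((thetaModel n N ∘L ContinuousLinearMap.snd ℝ (TotModel n N)
    (Fin N → Fin (n + 1) → ℝ)).hasFDerivAt.congr_of_eventuallyEq ?_)
  filter_upwards [c.phaseChart.open_target.mem_nhds hz] with z hz
  exact c.coordForm_theta_frame hΓ hz

theorem fderiv_coordForm_momentumForm (hX : IsVerticalField π X) {z : PhaseModel n N}
    (hΓ : Γbar.ProjectsTo Γ) (hz : z ∈ c.phaseChart.target) :
    fderiv ℝ (fun z => (coordForm c.phaseChart (momentumForm Γ X) z).compContinuousLinearMap
      (frame c.phaseChart Γbar z)) z =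
      volContract n N ∘L (((n : ℝ) + 1)⁻¹ •
        (momMap n N z.2 ∘L fderiv ℝ (c.vertComp X) z.1 ∘L
            ContinuousLinearMap.fst ℝ (TotModel n N) (Fin N → Fin (n + 1) → ℝ) +
          (momMap n N ∘L ContinuousLinearMap.snd ℝ (TotModel n N)
            (Fin N → Fin (n + 1) → ℝ)).flip (c.vertComp X z.1))) := by
  have h1 : HasFDerivAt (fun z : PhaseModel n N => momMap n N z.2)
      (momMap n N ∘L ContinuousLinearMap.snd ℝ (TotModel n N) (Fin N → Fin (n + 1) → ℝ)) z :=
    (momMap n N ∘L ContinuousLinearMap.snd ℝ (TotModel n N)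
      (Fin N → Fin (n + 1) → ℝ)).hasFDerivAt
  have h2 : HasFDerivAt (fun z : PhaseModel n N => c.vertComp X z.1)
      (fderiv ℝ (c.vertComp X) z.1 ∘L
        ContinuousLinearMap.fst ℝ (TotModel n N) (Fin N → Fin (n + 1) → ℝ)) z :=
    ((c.contDiffAt_vertComp hX hz).differentiableAt (by simp)).hasFDerivAt.comp z
      (ContinuousLinearMap.fst ℝ (TotModel n N) (Fin N → Fin (n + 1) → ℝ)).hasFDerivAt
  have h3 := (volContract n N).hasFDerivAt.comp z
    ((h1.clm_apply h2).const_smul ((n : ℝ) + 1)⁻¹)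
  refine HasFDerivAt.fderiv (h3.congr_of_eventuallyEq ?_)
  filter_upwards [c.phaseChart.open_target.mem_nhds hz] with z hz
  rw [c.coordForm_momentumForm_frame hX hΓ hz]
  exact (map_smul (volContract n N) _ _).symm

end FibredChart

theorem dVert_apply {k : ℕ} (α : PhaseForm n N π k) (p : Phase n N π)
    (v : Fin (k + 1) → TangentSpace 𝓘(ℝ, PhaseModel n N) p) :
    dVert Γbar α p v = ContinuousAlternatingMap.alternatizeUncurryFin
      (fderiv ℝ (fun z => (coordForm (fibredChartAt π p.pt : FibredChart n N π).phaseChart α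
        z).compContinuousLinearMap (frame (fibredChartAt π p.pt : FibredChart n N π).phaseChart
          Γbar z)) ((fibredChartAt π p.pt : FibredChart n N π).phaseChart p) ∘L fibreDir)
      (fun i => coframe (fibredChartAt π p.pt : FibredChart n N π).phaseChart Γbar
        ((fibredChartAt π p.pt : FibredChart n N π).phaseChart p)
        (mfderiv 𝓘(ℝ, PhaseModel n N) 𝓘(ℝ, PhaseModel n N)
          (fibredChartAt π p.pt : FibredChart n N π).phaseChart p (v i))) := rfl

end Polysymplectic

/-! ### Hamilton's equation for the momentum forms, and their bracket. -/

namespace Polysymplectic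

universe u v

theorem removeNth_succ_vecCons {V : Type*} {k : ℕ} (x : V) (w : Fin (k + 1) → V)
    (i : Fin (k + 1)) :
    i.succ.removeNth (Matrix.vecCons x w) = Matrix.vecCons x (i.removeNth w) := by
  ext1 j
  refine Fin.cases ?_ (fun j => ?_) j
  · simp [Fin.removeNth_apply]
  · simp [Fin.removeNth_apply]

variable {n N : ℕ}

/-- A vertical vector inserted in $dp\wedge e\wedge d^nx$ meets either the first factor or the
second; it cannot meet $d^nx_\mu$. The second case passes one factor, hence the minus sign. -/
theorem alternatize_thetaModel_cons (B : PhaseModel n N →L[ℝ] (Fin N → Fin (n + 1) → ℝ))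
    {v : PhaseModel n N} (hv : v.1.1 = 0) (w : Fin (n + 1) → PhaseModel n N) :
    ContinuousAlternatingMap.alternatizeUncurryFin (thetaModel n N ∘L B) (Matrix.vecCons v w) =
      thetaModel n N (B v) w - ((n : ℝ) + 1)⁻¹ •
        ∑ i : Fin (n + 1), (-1) ^ (i : ℕ) •
          volContract n N (momMap n N (B (w i)) v.1.2) (i.removeNth w) := by
  rw [ContinuousAlternatingMap.alternatizeUncurryFin_apply, Fin.sum_univ_succ, Finset.smul_sum,
    sub_eq_add_neg, ← Finset.sum_neg_distrib]
  congr 1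
  · simp
  · refine Finset.sum_congr rfl fun i _ => ?_
    rw [removeNth_succ_vecCons, Matrix.cons_val_succ, ContinuousLinearMap.comp_apply,
      thetaModel_apply, ContinuousAlternatingMap.smul_apply]
    rw [show ContinuousAlternatingMap.alternatizeUncurryFin
      (volContract n N ∘L momMap n N (B (w i)) ∘L fibCoord n N)
      (Matrix.vecCons v (i.removeNth w)) = _ from alternatize_volContract_cons
        (momMap n N (B (w i)) ∘L fibCoord n N) hv (i.removeNth w)]
    rw [ContinuousLinearMap.comp_apply, fibCoord_apply, Fin.val_succ, pow_succ]
    simp only [zsmul_eq_mul, smul_eq_mul]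
    push_cast
    ring

/-- Hamilton's equation in the model. The momentum part $-p\circ\partial\xi$ of the lift yields the
derivative of $\xi$, its fibre part $\xi$ yields the derivative of the momenta: together the product
rule for $p\,\xi$. -/
theorem alternatize_momentumModel (ξ : TotModel n N → FibreModel N) (z : PhaseModel n N)
    (w : Fin (n + 1) → PhaseModel n N) :
    ContinuousAlternatingMap.alternatizeUncurryFin ((volContract n N ∘L (((n : ℝ) + 1)⁻¹ •
        (momMap n N z.2 ∘L fderiv ℝ ξ z.1 ∘L
            ContinuousLinearMap.fst ℝ (TotModel n N) (Fin N → Fin (n + 1) → ℝ) +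
          (momMap n N ∘L ContinuousLinearMap.snd ℝ (TotModel n N)
            (Fin N → Fin (n + 1) → ℝ)).flip (ξ z.1)))) ∘L fibreDir) w =
      -ContinuousAlternatingMap.alternatizeUncurryFin ((thetaModel n N ∘L
          ContinuousLinearMap.snd ℝ (TotModel n N) (Fin N → Fin (n + 1) → ℝ)) ∘L fibreDir)
        (Matrix.vecCons (liftCoord ξ z) w) := by
  rw [ContinuousLinearMap.comp_assoc (thetaModel n N),
    alternatize_thetaModel_cons _ (v := liftCoord ξ z) rfl w, neg_sub, thetaModel_apply,
    ContinuousAlternatingMap.smul_apply, ContinuousAlternatingMap.alternatizeUncurryFin_apply,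
    ContinuousAlternatingMap.alternatizeUncurryFin_apply, ← smul_sub,
    ← Finset.sum_sub_distrib, Finset.smul_sum]
  refine Finset.sum_congr rfl fun i _ => ?_
  have h2 : momMap n N (liftCoord ξ z).2 (fibCoord n N (w i)) =
      -momMap n N z.2 (fderiv ℝ ξ z.1 (0, (w i).1.2)) :=
    momMap_liftCoord _ _ _
  have h3 : (volContract n N ∘L (((n : ℝ) + 1)⁻¹ •
        (momMap n N z.2 ∘L fderiv ℝ ξ z.1 ∘L
            ContinuousLinearMap.fst ℝ (TotModel n N) (Fin N → Fin (n + 1) → ℝ) +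
          (momMap n N ∘L ContinuousLinearMap.snd ℝ (TotModel n N)
            (Fin N → Fin (n + 1) → ℝ)).flip (ξ z.1)))) (fibreDir (w i)) =
      ((n : ℝ) + 1)⁻¹ • (volContract n N (momMap n N z.2 (fderiv ℝ ξ z.1 (0, (w i).1.2))) +
        volContract n N (momMap n N (w i).2 (ξ z.1))) := by
    rw [ContinuousLinearMap.comp_apply, smul_apply, map_smul, add_apply, map_add]
    rfl
  have h4 : (volContract n N ∘L momMap n N (liftCoord ξ z).2 ∘L fibCoord n N) (w i) =
      -volContract n N (momMap n N z.2 (fderiv ℝ ξ z.1 (0, (w i).1.2))) := by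
    rw [ContinuousLinearMap.comp_apply, ContinuousLinearMap.comp_apply, h2, map_neg]
  rw [ContinuousLinearMap.comp_apply _ fibreDir, h3]
  change _ = _ • (_ • volContract n N (momMap n N (w i).2 (ξ z.1)) (i.removeNth w) -
    _ • (volContract n N ∘L momMap n N (liftCoord ξ z).2 ∘L fibCoord n N) (w i) (i.removeNth w))
  rw [h4, ContinuousAlternatingMap.smul_apply, ContinuousAlternatingMap.add_apply,
    ContinuousAlternatingMap.neg_apply]
  simp only [zsmul_eq_mul, smul_eq_mul]
  ring

variable {M : Type v} [TopologicalSpace M] [ChartedSpace (BaseModel n) M]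
variable {E : Type u} [TopologicalSpace E] [ChartedSpace (TotModel n N) E]
variable {π : E → M} [SmoothFibreBundle n N π]
variable [IsManifold 𝓘(ℝ, TotModel n N) ∞ E] [IsManifold 𝓘(ℝ, BaseModel n) ∞ M]
variable {X Y : ∀ e : E, TangentSpace 𝓘(ℝ, TotModel n N) e}
variable {Γ : Connection n (TotModel n N) π}
variable {Γbar : Connection n (PhaseModel n N) (Phase.toBase : Phase n N π → M)}

theorem contract_apply {k : ℕ} (Z : ∀ p : Phase n N π, TangentSpace 𝓘(ℝ, PhaseModel n N) p)
    (α : PhaseForm n N π (k + 1)) (p : Phase n N π)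
    (v : Fin k → TangentSpace 𝓘(ℝ, PhaseModel n N) p) :
    contract Z α p v = α p (Matrix.vecCons (Z p) v) := rfl

theorem contract_contract_swap {k : ℕ}
    (Z W : ∀ p : Phase n N π, TangentSpace 𝓘(ℝ, PhaseModel n N) p)
    (α : PhaseForm n N π (k + 2)) :
    contract Z (contract W α) = -contract W (contract Z α) := by
  ext p v
  change α p (Matrix.vecCons (W p) (Matrix.vecCons (Z p) v)) =
    -α p (Matrix.vecCons (Z p) (Matrix.vecCons (W p) v))
  have h := (α p).toAlternatingMap.map_swap (Matrix.vecCons (Z p) (Matrix.vecCons (W p) v))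
    (i := 0) (j := 1) (by simp)
  refine Eq.trans (congrArg (α p) ?_) h
  ext1 i
  refine Fin.cases ?_ (fun i => Fin.cases ?_ (fun i => ?_) i) i
  · simp
  · simp
  · have h1 : (Equiv.swap (0 : Fin (k + 2)) 1) i.succ.succ = i.succ.succ :=
      Equiv.swap_apply_of_ne_of_ne (Fin.succ_ne_zero _)
        (fun h => Fin.succ_ne_zero i (Fin.succ_injective _ h))
    rw [Function.comp_apply, h1]
    rfl

theorem momentumForm_apply (hΓ : Γbar.ProjectsTo Γ) (hX : IsVerticalField π X)
    (c : FibredChart n N π) {p : Phase n N π} (hp : p.pt ∈ c.tot.source)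
    (v : Fin n → TangentSpace 𝓘(ℝ, PhaseModel n N) p) :
    momentumForm Γ X p v = ((n : ℝ) + 1)⁻¹ * volContract n N
      (momMap n N (c.phaseChart p).2 (c.vertComp X (c.phaseChart p).1))
      (fun i => mfderiv 𝓘(ℝ, PhaseModel n N) 𝓘(ℝ, PhaseModel n N) c.phaseChart p (v i)) := by
  rw [← coordForm_chart c (momentumForm Γ X) hp v,
    c.coordForm_momentumForm hX hΓ (c.phaseChart.map_source hp)]
  rfl

theorem momentumForm_add_smul (Γ : Connection n (TotModel n N) π) (a b : ℝ)
    (hX : IsVerticalField π X) (hY : IsVerticalField π Y) :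
    momentumForm Γ (a • X + b • Y) = a • momentumForm Γ X + b • momentumForm Γ Y := by
  ext1 p
  rw [momentumForm, lift_add_smul a b hX hY]
  let L : PhaseModel n N →L[ℝ] PhaseModel n N [⋀^Fin n]→L[ℝ] ℝ :=
    ContinuousAlternatingMap.curryLeft (E := PhaseModel n N) (theta Γ p)
  change L (a • lift X p + b • lift Y p) = a • L (lift X p) + b • L (lift Y p)
  exact (map_add L _ _).trans (congrArg₂ (· + ·) (map_smul L _ _) (map_smul L _ _))

theorem isSmoothForm_momentumForm (hΓ : Γbar.ProjectsTo Γ) (hX : IsVerticalField π X) :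
    IsSmoothForm (momentumForm Γ X) := by
  intro p
  let c : FibredChart n N π := fibredChartAt π p.pt
  have h1 : ContDiffOn ℝ ∞ (fun z : PhaseModel n N => momMap n N z.2) c.phaseChart.target :=
    ((momMap n N).contDiff.comp contDiff_snd).contDiffOn
  have h2 : ContDiffOn ℝ ∞ (fun z : PhaseModel n N => c.vertComp X z.1) c.phaseChart.target :=
    (c.contDiffOn_vertComp hX).comp contDiff_fst.contDiffOn fun _ h => h
  exact (((volContract n N).contDiff.comp_contDiffOn (h1.clm_apply h2)).const_smul
    ((n : ℝ) + 1)⁻¹).congr fun z hz => c.coordForm_momentumForm hX hΓ hz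

theorem isHorizontalForm_momentumForm (hΓ : Γbar.ProjectsTo Γ) (hX : IsVerticalField π X) :
    IsHorizontalForm (momentumForm Γ X) := by
  rintro p w ⟨i, hi⟩
  let c : FibredChart n N π := fibredChartAt π p.pt
  have hp : p.pt ∈ c.tot.source := mem_fibredChartAt_source π p.pt
  refine (momentumForm_apply hΓ hX c hp w).trans
    ((congrArg (_ * ·) (volContract_eq_zero _ _ i ?_)).trans (mul_zero _))
  refine (c.base_mfderiv_toBase hp (w i)).symm.trans ?_
  rw [hi]
  exact map_zero _

/-- The vertical derivatives of both forms are given by constant or explicit coefficients in one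
adapted frame, which reduces the claim to `alternatize_momentumModel`. -/
theorem dVert_momentumForm (hΓ : Γbar.ProjectsTo Γ) (hX : IsVerticalField π X) :
    dVert Γbar (momentumForm Γ X) = contract (lift X) (omega Γ Γbar) := by
  ext p v
  let c : FibredChart n N π := fibredChartAt π p.pt
  have hp : p.pt ∈ c.tot.source := mem_fibredChartAt_source π p.pt
  have hz : c.phaseChart p ∈ c.phaseChart.target := c.phaseChart.map_source hp
  set z := c.phaseChart p with hzdef
  set w : Fin (n + 1) → PhaseModel n N := fun i => coframe c.phaseChart Γbar z
    (mfderiv 𝓘(ℝ, PhaseModel n N) 𝓘(ℝ, PhaseModel n N) c.phaseChart p (v i)) with hw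
  set V := liftCoord (c.vertComp X) z with hV
  rw [contract_apply]
  change _ = -dVert Γbar (theta Γ) p (Matrix.vecCons (lift X p) v)
  rw [dVert_apply, dVert_apply]
  change ContinuousAlternatingMap.alternatizeUncurryFin (fderiv ℝ (fun z => (coordForm
    c.phaseChart (momentumForm Γ X) z).compContinuousLinearMap
      (frame c.phaseChart Γbar z)) z ∘L fibreDir) w =
    -ContinuousAlternatingMap.alternatizeUncurryFin (fderiv ℝ (fun z => (coordForm
    c.phaseChart (theta Γ) z).compContinuousLinearMap
      (frame c.phaseChart Γbar z)) z ∘L fibreDir) _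
  rw [c.fderiv_coordForm_momentumForm hX hΓ hz, c.fderiv_coordForm_theta hΓ hz]
  -- The coframe fixes vertical vectors, so the lift keeps its coordinate expression and contraction
  -- becomes insertion of `V`.
  have h1 : (fun i => coframe c.phaseChart Γbar z
      (mfderiv 𝓘(ℝ, PhaseModel n N) 𝓘(ℝ, PhaseModel n N) c.phaseChart p
        ((Matrix.vecCons (lift X p) v : Fin (n + 2) → TangentSpace 𝓘(ℝ, PhaseModel n N) p) i))) =
      Matrix.vecCons V w := by
    ext1 i
    refine Fin.cases ?_ (fun i => ?_) i
    · refine (congrArg (coframe c.phaseChart Γbar z) (c.mfderiv_phaseChart_lift hX hp)).trans ?_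
      exact c.coframe_eq_self hz rfl
    · rfl
  exact (alternatize_momentumModel (c.vertComp X) z w).trans (congrArg (fun u =>
    -ContinuousAlternatingMap.alternatizeUncurryFin ((thetaModel n N ∘L
      ContinuousLinearMap.snd ℝ (TotModel n N) (Fin N → Fin (n + 1) → ℝ)) ∘L fibreDir) u) h1.symm)

theorem isHamiltonianField_lift (hΓ : Γbar.ProjectsTo Γ) (hX : IsVerticalField π X) :
    IsHamiltonianField Γ Γbar (momentumForm Γ X) (lift X) :=
  ⟨isSmoothField_lift hX, dVert_momentumForm hΓ hX⟩

theorem isHamiltonianForm_momentumForm (hΓ : Γbar.ProjectsTo Γ) (hX : IsVerticalField π X) :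
    IsHamiltonianForm Γ Γbar (momentumForm Γ X) :=
  ⟨isSmoothForm_momentumForm hΓ hX, isHorizontalForm_momentumForm hΓ hX,
    ⟨_, isHamiltonianField_lift hΓ hX⟩⟩

/-- By Hamilton's equation the inner contraction is $d_{\bar\Gamma}I(Y)$. Inserting the vertical
vector $\hat X$ differentiates the coefficients $p_AY^A$ along it: the fibre part gives
$p_AX^B\partial_BY^A$ and the momentum part gives $-p_B\,\partial_AX^B\,Y^A$. -/
theorem contract_lift_contract_lift_omega (hΓ : Γbar.ProjectsTo Γ) (hX : IsVerticalField π X)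
    (hY : IsVerticalField π Y) :
    contract (lift X) (contract (lift Y) (omega Γ Γbar)) =
      momentumForm Γ (VectorField.mlieBracket 𝓘(ℝ, TotModel n N) X Y) := by
  rw [← dVert_momentumForm hΓ hY]
  ext p v
  let c : FibredChart n N π := fibredChartAt π p.pt
  have hp : p.pt ∈ c.tot.source := mem_fibredChartAt_source π p.pt
  have hz : c.phaseChart p ∈ c.phaseChart.target := c.phaseChart.map_source hp
  rw [momentumForm_apply hΓ (hX.mlieBracket hY) c hp, c.vertComp_mlieBracket hX hY hz,
    contract_apply, dVert_apply]
  set z := c.phaseChart p with hzdef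
  set w : Fin n → PhaseModel n N := fun i => coframe c.phaseChart Γbar z
    (mfderiv 𝓘(ℝ, PhaseModel n N) 𝓘(ℝ, PhaseModel n N) c.phaseChart p (v i)) with hw
  set V := liftCoord (c.vertComp X) z with hV
  have h1 : (fun i => coframe c.phaseChart Γbar z
      (mfderiv 𝓘(ℝ, PhaseModel n N) 𝓘(ℝ, PhaseModel n N) c.phaseChart p
        ((Matrix.vecCons (lift X p) v : Fin (n + 1) → TangentSpace 𝓘(ℝ, PhaseModel n N) p) i))) =
      Matrix.vecCons V w := by
    ext1 i
    refine Fin.cases ?_ (fun i => ?_) i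
    · refine (congrArg (coframe c.phaseChart Γbar z) (c.mfderiv_phaseChart_lift hX hp)).trans ?_
      exact c.coframe_eq_self hz rfl
    · rfl
  refine (congrArg (ContinuousAlternatingMap.alternatizeUncurryFin (fderiv ℝ (fun z => (coordForm
    c.phaseChart (momentumForm Γ Y) z).compContinuousLinearMap
      (frame c.phaseChart Γbar z)) z ∘L fibreDir)) h1).trans ?_
  rw [c.fderiv_coordForm_momentumForm hY hΓ hz, ContinuousLinearMap.comp_assoc,
    alternatize_volContract_cons _ (v := V) rfl w]
  have h2 : volContract n N (momMap n N z.2 (vertBracket (c.vertComp X) (c.vertComp Y) z.1)) w =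
      volContract n N (momMap n N z.2 (vertBracket (c.vertComp X) (c.vertComp Y) z.1))
        (fun i => mfderiv 𝓘(ℝ, PhaseModel n N) 𝓘(ℝ, PhaseModel n N) c.phaseChart p (v i)) :=
    volContract_congr _ fun i => c.coframe_base hz _
  rw [← h2]
  have h3 : momMap n N V.2 (c.vertComp Y z.1) =
      -momMap n N z.2 (fderiv ℝ (c.vertComp X) z.1 (0, c.vertComp Y z.1)) :=
    momMap_liftCoord _ _ _
  change volContract n N (((n : ℝ) + 1)⁻¹ •
    (momMap n N z.2 (fderiv ℝ (c.vertComp Y) z.1 (0, c.vertComp X z.1)) +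
      momMap n N V.2 (c.vertComp Y z.1))) w = _
  rw [h3, ← sub_eq_add_neg, ← map_sub, map_smul]
  rfl

/-- The field of $G$ enters only through its contraction with $\Omega_\Gamma$, which is
$d_{\bar\Gamma}G$; antisymmetry gives the same for $F$. The arbitrary choices in `bracket` are
therefore harmless. -/
theorem IsHamiltonianField.contract_contract_omega_eq {F G : PhaseForm n N π n}
    {XF XF' XG XG' : ∀ p : Phase n N π, TangentSpace 𝓘(ℝ, PhaseModel n N) p}
    (hF : IsHamiltonianField Γ Γbar F XF) (hF' : IsHamiltonianField Γ Γbar F XF')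
    (hG : IsHamiltonianField Γ Γbar G XG) (hG' : IsHamiltonianField Γ Γbar G XG') :
    contract XF (contract XG (omega Γ Γbar)) = contract XF' (contract XG' (omega Γ Γbar)) := by
  rw [← hG.dVert_eq, hG'.dVert_eq, contract_contract_swap, ← hF.dVert_eq, hF'.dVert_eq,
    contract_contract_swap XF']

theorem bracket_momentumForm (hΓ : Γbar.ProjectsTo Γ) (hX : IsVerticalField π X)
    (hY : IsVerticalField π Y) :
    bracket Γ Γbar (momentumForm Γ X) (momentumForm Γ Y) =
      momentumForm Γ (VectorField.mlieBracket 𝓘(ℝ, TotModel n N) X Y) := by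
  have h : IsHamiltonianForm Γ Γbar (momentumForm Γ X) ∧
      IsHamiltonianForm Γ Γbar (momentumForm Γ Y) :=
    ⟨isHamiltonianForm_momentumForm hΓ hX, isHamiltonianForm_momentumForm hΓ hY⟩
  rw [bracket, dif_pos h, ← contract_lift_contract_lift_omega hΓ hX hY]
  exact h.1.exists_field.choose_spec.contract_contract_omega_eq (isHamiltonianField_lift hΓ hX)
    h.2.exists_field.choose_spec (isHamiltonianField_lift hΓ hY)

end Polysymplectic

end

theorem mainTheorem4 {n N : ℕ}
    {M : Type*} [TopologicalSpace M] [ChartedSpace (BaseModel n) M]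
    [IsManifold 𝓘(ℝ, BaseModel n) ∞ M]
    {E : Type*} [TopologicalSpace E] [ChartedSpace (TotModel n N) E]
    [IsManifold 𝓘(ℝ, TotModel n N) ∞ E]
    (π : E → M) [SmoothFibreBundle n N π]
    (Γ : Connection n (TotModel n N) π)
    (Γbar : Connection n (PhaseModel n N)
      (Phase.toBase : Phase n N π → M))
    (hΓ : Γbar.ProjectsTo Γ) :
    -- the canonical lift: it is smooth, and generated by the transported one-parameter families
    (∀ X, IsVerticalField π X →
      IsSmoothField (PhaseModel n N)
        (lift (π := π) X) ∧
      IsGeneratorOfLift X (lift (π := π) X)) ∧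
    -- the lift and `I` are linear
    (∀ (a b : ℝ) (X Y), IsVerticalField π X → IsVerticalField π Y →
      lift (π := π) (a • X + b • Y) =
        a • lift X + b • lift Y ∧
      momentumForm Γ (a • X + b • Y) =
        a • momentumForm Γ X + b • momentumForm Γ Y) ∧
    -- `I(X)` is a Hamiltonian form with Hamiltonian vector field `X̂`
    (∀ X, IsVerticalField π X →
      IsHamiltonianForm Γ Γbar (momentumForm Γ X) ∧
      IsHamiltonianField Γ Γbar (momentumForm Γ X)
        (lift X)) ∧
    ∀ X Y, IsVerticalField π X → IsVerticalField π Y →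
      IsVerticalField π
        (VectorField.mlieBracket 𝓘(ℝ, TotModel n N) X Y) ∧
      -- the lift is a homomorphism of Lie algebras
      lift (π := π)
          (VectorField.mlieBracket 𝓘(ℝ, TotModel n N) X Y) =
        VectorField.mlieBracket 𝓘(ℝ, PhaseModel n N)
          (lift X) (lift Y) ∧
      -- `X̂ ⌟ Ŷ ⌟ Ω_Γ = [X̂, Ŷ] ⌟ Θ_Γ`
      contract (lift X)
          (contract (lift Y) (omega Γ Γbar)) =
        contract
          (VectorField.mlieBracket 𝓘(ℝ, PhaseModel n N)
            (lift X) (lift Y))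
          (theta Γ) ∧
      -- `{I(X), I(Y)} = I([X, Y])`
      bracket Γ Γbar
          (momentumForm Γ X) (momentumForm Γ Y) =
        momentumForm Γ
          (VectorField.mlieBracket 𝓘(ℝ, TotModel n N) X Y) ∧
      -- the same with the sign `(-1)^(dim M - |F|) = -1` in the definition of the bracket
      gerstenhaberBracket Γ Γbar
          (momentumForm Γ X) (momentumForm Γ Y) =
        -momentumForm Γ
          (VectorField.mlieBracket 𝓘(ℝ, TotModel n N) X Y) := by
  refine ⟨fun X hX => ⟨isSmoothField_lift hX, isGeneratorOfLift_lift hX⟩,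
    fun a b X Y hX hY => ⟨lift_add_smul a b hX hY, momentumForm_add_smul Γ a b hX hY⟩,
    fun X hX => ⟨isHamiltonianForm_momentumForm hΓ hX, isHamiltonianField_lift hΓ hX⟩,
    fun X Y hX hY => ⟨hX.mlieBracket hY, lift_mlieBracket hX hY, ?_,
      bracket_momentumForm hΓ hX hY, ?_⟩⟩
  · rw [contract_lift_contract_lift_omega hΓ hX hY, momentumForm, lift_mlieBracket hX hY]
  · rw [gerstenhaberBracket, bracket_momentumForm hΓ hX hY, Nat.add_sub_cancel_left, pow_one]
    exact funext fun p => neg_one_smul ℝ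
      (momentumForm Γ (VectorField.mlieBracket 𝓘(ℝ, TotModel n N) X Y) p)
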